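/- **Notation.** Let $k$ be a field, $V$ a $k$-vector space and $V^+\subseteq V$ a subspace. Subspaces $A,B\subseteq V$ are commensurable, $A\sim B$, if $\dim_k (A+B)/(A\cap B)<\infty$. Let $Gl(V)=Gl(V,V^+)$ be the group of $k$-linear automorphisms $S$ of $V$ with $S(V^+)\sim V^+$ and $S^{-1}(V^+)\sim V^+$. The winding number of $S\in Gl(V)$ is $$w(S)=\dim_k V^+/(V^+\cap S(V^+))-\dim_k S(V^+)/(V^+\cap S(V^+)),$$ and $Gl^0(V)=\{S\in Gl(V): w(S)=0\}$. For a finite dimensional space $W$ let $\wedge W$ be its top exterior power. For $A,B\sim V^+$ let $L(A,B)$ be the line $(\wedge (A/M))^*\otimes \wedge (B/M)$, where $M\subseteq A\cap B$ and $M\sim V^+$; up to canonical isomorphism (through $\wedge(A/M')=\wedge(M/M')\otimes\wedge(A/M)$ for $M'\subseteq M$) it does not depend on $M$. Composition of homomorphisms $\wedge(A/M)\to\wedge(B/M)\to\wedge(C/M)$, for $M\subseteq A\cap B\cap C$, defines a product $L(A,B)\otimes L(B,C)\to L(A,C)$. The pairs $(\sigma,S)$ with $S\in Gl(V)$ and $0\ne\sigma\in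 L(V^+,S(V^+))$ form a group $\widetilde{Gl}(V)$ with product $(\sigma,S)(\tau,T)=(\sigma\cdot S_*\tau, ST)$, which is a central extension $1\to k^*\to\widetilde{Gl}(V)\to Gl(V)\to 1$. For commuting $S,T\in Gl(V)$ let $\langle S,T\rangle=\tilde S\tilde T\tilde S^{-1}\tilde T^{-1}\in k^*$, where $\tilde S,\tilde T\in \widetilde{Gl}(V)$ are any preimages of $S,T$. **Theorem.** Let $X$ be a proper, irreducible, non singular algebraic curve over a perfect field $k$ that is algebraically closed in the function field of $X$. For a closed point $x\in X$ let $A_x=\widehat{\mathcal O}_{X,x}$ and let $K_x$ be its field of fractions. Let $\mathbb A_X=\prod'_x K_x$ be the adele ring (the restricted product with respect to the $A_x$) and $\mathbb A_X^+=\prod_x A_x$. Consider the pairs $(K_x,A_x)$ and $(\mathbb A_X,\mathbb A_X^+)$ over $k$. Let $S_x,T_x\in Gl(K_x)$, for all closed points $x$, be such that $S=\prod_x S_x$ and $T=\prod_x T_x$ are elements of $Gl^0(\mathbb A_X)$ which commute with each other. Write $w_x(S)$ and $w_x(T)$ for the winding numbers of $S_x$ and $T_x$. Then $\langle S_x,T_x\rangle=1$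 for almost all $x$, $w_x(S)=w_x(T)=0$ for almost all $x$, and $$\langle S,T\rangle=\prod_{x} (-1)^{w_x(S)\,w_x(T)}\,\langle S_x,T_x\rangle .$$ -/

import Mathlib

universe u v

namespace DetExt

section Wedge
variable {k : Type u} [Field k] {U : Type v} [AddCommGroup U] [Module k U]

/-- The top exterior power `∧W` of a finite dimensional subspace `W ⊆ U`, realised as the line
spanned by the products `w₁ ∧ ⋯ ∧ wₙ` (`wᵢ ∈ W`, `n = dim W`) in the exterior algebra of `U`. -/
noncomputable def topWedge (W : Submodule k U) : Submodule k (ExteriorAlgebra k U) :=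
  (W.map (ExteriorAlgebra.ι k)) ^ Module.finrank k W

lemma pow_eq_map (W : Submodule k U) (n : ℕ) :
    (W.map (ExteriorAlgebra.ι k)) ^ n =
      (⋀[k]^n W).map (ExteriorAlgebra.map W.subtype).toLinearMap := by
  rw [ExteriorAlgebra.exteriorPower, Submodule.map_pow, ExteriorAlgebra.ι_range_map_map, Submodule.range_subtype]

lemma finrank_pow (W : Submodule k U) [FiniteDimensional k W] (n : ℕ) :
    Module.finrank k ↥((W.map (ExteriorAlgebra.ι k)) ^ n) = (Module.finrank k W).choose n := by
  rw [pow_eq_map, ← exteriorPower.finrank_eq k n]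
  exact (Submodule.equivMapOfInjective _
    (ExteriorAlgebra.map_injective_field (Submodule.ker_subtype W)) _).finrank_eq.symm

lemma finrank_topWedge (W : Submodule k U) [FiniteDimensional k W] :
    Module.finrank k (topWedge W) = 1 := by
  rw [topWedge, finrank_pow, Nat.choose_self]

lemma pow_eq_bot (W : Submodule k U) [FiniteDimensional k W] {n : ℕ}
    (h : Module.finrank k W < n) : (W.map (ExteriorAlgebra.ι k)) ^ n = ⊥ := by
  have h0 := exteriorPower.finrank_eq k (M := W) n
  rw [Nat.choose_eq_zero_of_lt h, Submodule.finrank_eq_zero] at h0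
  rw [pow_eq_map, h0, Submodule.map_bot]

lemma commute_map_ι (W W' : Submodule k U) :
    Commute (W.map (ExteriorAlgebra.ι k)) (W'.map (ExteriorAlgebra.ι k)) := by
  have key : ∀ W W' : Submodule k U, W.map (ExteriorAlgebra.ι k) * W'.map (ExteriorAlgebra.ι k) ≤
      W'.map (ExteriorAlgebra.ι k) * W.map (ExteriorAlgebra.ι k) := by
    intro W W'
    rw [Submodule.mul_le]
    rintro _ ⟨a, ha, rfl⟩ _ ⟨b, hb, rfl⟩
    rw [eq_neg_of_add_eq_zero_left (ExteriorAlgebra.ι_add_mul_swap a b)]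
    exact neg_mem (Submodule.mul_mem_mul ⟨b, hb, rfl⟩ ⟨a, ha, rfl⟩)
  exact le_antisymm (key _ _) (key _ _)

lemma nsmul_submodule_le {A : Type*} [Ring A] [Algebra k A] (n : ℕ) (X : Submodule k A) :
    n • X ≤ X := by
  induction n with
  | zero => rw [zero_smul]; exact bot_le
  | succ n ih => rw [add_smul, one_smul]; exact sup_le ih le_rfl

/-- sup of independent -/
lemma sup_pow_le (W W' : Submodule k U) [FiniteDimensional k W] [FiniteDimensional k W'] :
    ((W ⊔ W').map (ExteriorAlgebra.ι k)) ^ (Module.finrank k W + Module.finrank k W') ≤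
      topWedge W * topWedge W' := by
  rw [Submodule.map_sup, ← Submodule.add_eq_sup, (commute_map_ι W W').add_pow']
  refine Finset.sum_induction _ (fun X => X ≤ topWedge W * topWedge W')
    (fun a b ha hb => sup_le ha hb) bot_le ?_
  rintro ⟨i, j⟩ hij
  refine (nsmul_submodule_le _ _).trans ?_
  have hij : i + j = _ := Finset.HasAntidiagonal.mem_antidiagonal.mp hij
  show Submodule.map _ _ ^ i * Submodule.map _ _ ^ j ≤ _
  rcases lt_trichotomy i (Module.finrank k W) with h | h | h
  · rw [pow_eq_bot W' (n := j) (by omega), Submodule.mul_bot]; exact bot_le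
  · obtain rfl : j = Module.finrank k W' := by omega
    subst h; exact le_rfl
  · rw [pow_eq_bot W h, Submodule.bot_mul]; exact bot_le

end Wedge

section Ref
variable {k : Type u} [Field k] {U U' : Type v} [AddCommGroup U] [Module k U]
  [AddCommGroup U'] [Module k U']

/-- multiplication by a top form on the kernel -/
lemma mul_ι_eq_zero (W : Submodule k U) [FiniteDimensional k W] {μ : ExteriorAlgebra k U}
    (hμ : μ ∈ topWedge W) {w : U} (hw : w ∈ W) : μ * ExteriorAlgebra.ι k w = 0 := by
  have : μ * ExteriorAlgebra.ι k w ∈ (W.map (ExteriorAlgebra.ι k)) ^ (Module.finrank k W + 1) := by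
    rw [pow_succ]; exact Submodule.mul_mem_mul hμ ⟨w, hw, rfl⟩
  rw [pow_eq_bot W (Nat.lt_succ_self _)] at this
  simpa using this

lemma mul_map_section (π : U →ₗ[k] U') (s : U' →ₗ[k] U) (hs : ∀ u, π (s u) = u)
    (α : ExteriorAlgebra k U) : ∀ ν : ExteriorAlgebra k U,
      (∀ w ∈ LinearMap.ker π, ν * ExteriorAlgebra.ι k w = 0) →
      ν * α = ν * ExteriorAlgebra.map s (ExteriorAlgebra.map π α) := by
  have step : ∀ (β ν : ExteriorAlgebra k U), 
      (∀ w ∈ LinearMap.ker π, ν * ExteriorAlgebra.ι k w = 0) →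
      ∀ w ∈ LinearMap.ker π, (ν * β) * ExteriorAlgebra.ι k w = 0 := by
    intro β
    induction β using ExteriorAlgebra.induction with
    | algebraMap r =>
      intro ν h w hw
      rw [← Algebra.commutes, mul_assoc, h w hw, mul_zero]
    | ι x =>
      intro ν h w hw
      rw [mul_assoc, eq_neg_of_add_eq_zero_left (ExteriorAlgebra.ι_add_mul_swap x w), mul_neg,
        ← mul_assoc, h w hw, zero_mul, neg_zero]
    | mul a b ha hb =>
      intro ν h
      rw [← mul_assoc]
      exact hb _ (ha _ h)
    | add a b ha hb =>
      intro ν h w hw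
      rw [mul_add, add_mul, ha _ h w hw, hb _ h w hw, add_zero]
  induction α using ExteriorAlgebra.induction with
  | algebraMap r => intro ν h; simp
  | ι x =>
    intro ν h
    rw [ExteriorAlgebra.map_apply_ι, ExteriorAlgebra.map_apply_ι, ← sub_eq_zero, ← mul_sub,
      ← map_sub]
    exact h _ (by simp [hs])
  | mul a b ha hb =>
    intro ν h
    rw [map_mul, map_mul, ← mul_assoc, ← mul_assoc, ← ha ν h, ← hb _ (step a ν h)]
  | add a b ha hb =>
    intro ν h
    rw [map_add, map_add, mul_add, mul_add, ← ha ν h, ← hb ν h]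

lemma topWedge_map (f : U →ₗ[k] U') (hf : Function.Injective f) (W : Submodule k U) :
    topWedge (W.map f) = (topWedge W).map (ExteriorAlgebra.map f).toLinearMap := by
  have h : (W.map f).map (ExteriorAlgebra.ι k) =
      (W.map (ExteriorAlgebra.ι k)).map (ExteriorAlgebra.map f).toLinearMap := by
    rw [← Submodule.map_comp, ← Submodule.map_comp, ExteriorAlgebra.map_comp_ι]
  rw [topWedge, topWedge, Submodule.map_pow, h,
    (Submodule.equivMapOfInjective f hf W).finrank_eq]

end Ref

variable {k : Type u} [Field k] {V : Type v} [AddCommGroup V] [Module k V]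

/-- Two subspaces `A, B ⊆ V` are commensurable when `(A + B)/(A ∩ B)` is finite dimensional. -/
def Commensurable (A B : Submodule k V) : Prop :=
  FiniteDimensional k (↥(A ⊔ B) ⧸ (A ⊓ B).submoduleOf (A ⊔ B))

section Comm

lemma finite_quot_iff (X Y : Submodule k V) :
    FiniteDimensional k (↥X ⧸ Y.submoduleOf X) ↔ FiniteDimensional k (X.map Y.mkQ) := by
  have e := (Y.mkQ.domRestrict X).quotKerEquivRange
  have h1 : LinearMap.ker (Y.mkQ.domRestrict X) = Y.submoduleOf X := by
    rw [LinearMap.ker_domRestrict, Submodule.ker_mkQ, Submodule.submoduleOf]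
  have h2 : LinearMap.range (Y.mkQ.domRestrict X) = X.map Y.mkQ := by
    rw [LinearMap.range_domRestrict]
  rw [h1, h2] at e
  exact ⟨fun _ => e.finiteDimensional, fun _ => e.symm.finiteDimensional⟩

lemma finite_map_iff (A B : Submodule k V) :
    FiniteDimensional k (A.map B.mkQ) ↔
      ∃ F : Submodule k V, FiniteDimensional k F ∧ A ≤ B ⊔ F := by
  constructor
  · intro h
    obtain ⟨s, hs⟩ := LinearMap.exists_rightInverse_of_surjective B.mkQ B.range_mkQ
    refine ⟨(A.map B.mkQ).map s, inferInstance, fun a ha => ?_⟩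
    rw [← sub_add_cancel a (s (B.mkQ a))]
    refine add_mem (Submodule.mem_sup_left ?_)
      (Submodule.mem_sup_right ⟨_, ⟨a, ha, rfl⟩, rfl⟩)
    have := LinearMap.congr_fun hs (B.mkQ a)
    have h0 : a - s (B.mkQ a) ∈ LinearMap.ker B.mkQ := by
      rw [LinearMap.mem_ker, map_sub, sub_eq_zero]
      exact this.symm
    rwa [Submodule.ker_mkQ] at h0
  · rintro ⟨F, hF, h⟩
    have : A.map B.mkQ ≤ F.map B.mkQ := by
      refine (Submodule.map_mono h).trans ?_
      rw [Submodule.map_sup, Submodule.mkQ_map_self, bot_sup_eq]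
    exact Submodule.finiteDimensional_of_le this

lemma commensurable_iff {A B : Submodule k V} : Commensurable A B ↔
    FiniteDimensional k (A.map B.mkQ) ∧ FiniteDimensional k (B.map A.mkQ) := by
  have key : ∀ A B : Submodule k V, FiniteDimensional k (A.map (A ⊓ B).mkQ) ↔
      FiniteDimensional k (A.map B.mkQ) := by
    intro A B
    rw [← finite_quot_iff, ← finite_quot_iff]
    have : (A ⊓ B).submoduleOf A = B.submoduleOf A := by
      ext x; simp [Submodule.submoduleOf]
    rw [this]
  rw [Commensurable, finite_quot_iff, Submodule.map_sup, ← key A B, ← key B A, inf_comm B A]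
  exact ⟨fun h => ⟨Submodule.finiteDimensional_of_le
      (S₂ := A.map (A ⊓ B).mkQ ⊔ B.map (A ⊓ B).mkQ) le_sup_left,
    Submodule.finiteDimensional_of_le
      (S₂ := A.map (A ⊓ B).mkQ ⊔ B.map (A ⊓ B).mkQ) le_sup_right⟩, fun ⟨_, _⟩ => inferInstance⟩

lemma Commensurable.refl (A : Submodule k V) : Commensurable A A := by
  rw [commensurable_iff, Submodule.mkQ_map_self]
  exact ⟨inferInstance, inferInstance⟩

lemma Commensurable.symm {A B : Submodule k V} (h : Commensurable A B) : Commensurable B A :=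
  commensurable_iff.2 (commensurable_iff.1 h).symm

lemma finite_map_trans {A B C : Submodule k V} (h : FiniteDimensional k (A.map B.mkQ))
    (h' : FiniteDimensional k (B.map C.mkQ)) : FiniteDimensional k (A.map C.mkQ) := by
  rw [finite_map_iff] at *
  obtain ⟨F, _, hF⟩ := h
  obtain ⟨F', _, hF'⟩ := h'
  refine ⟨F' ⊔ F, inferInstance, hF.trans ?_⟩
  rw [← sup_assoc]
  exact sup_le_sup_right hF' _

lemma Commensurable.trans {A B C : Submodule k V} (h : Commensurable A B)
    (h' : Commensurable B C) : Commensurable A C := by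
  rw [commensurable_iff] at *
  exact ⟨finite_map_trans h.1 h'.1, finite_map_trans h'.2 h.2⟩

lemma Commensurable.map {A B : Submodule k V} (h : Commensurable A B) (S : V ≃ₗ[k] V) :
    Commensurable (A.map (S : V →ₗ[k] V)) (B.map (S : V →ₗ[k] V)) := by
  have key : ∀ A B : Submodule k V, FiniteDimensional k (A.map B.mkQ) →
      FiniteDimensional k ((A.map (S : V →ₗ[k] V)).map (B.map (S : V →ₗ[k] V)).mkQ) := by
    intro A B h
    rw [finite_map_iff] at *
    obtain ⟨F, _, hF⟩ := h
    exact ⟨F.map (S : V →ₗ[k] V), inferInstance,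
      (Submodule.map_mono hF).trans (Submodule.map_sup _ _ _).le⟩
  rw [commensurable_iff] at *
  exact ⟨key _ _ h.1, key _ _ h.2⟩

lemma Commensurable.inf {A B P : Submodule k V} (h : Commensurable A P)
    (h' : Commensurable B P) : Commensurable (A ⊓ B) P := by
  rw [commensurable_iff] at *
  refine ⟨?_, ?_⟩
  · have := h.1
    exact Submodule.finiteDimensional_of_le (Submodule.map_mono inf_le_left)
  · have h1 := h.2
    have h2 := h'.2
    let f : (V ⧸ (A ⊓ B)) →ₗ[k] (V ⧸ A) × (V ⧸ B) :=
      (Submodule.factor inf_le_left).prod (Submodule.factor inf_le_right)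
    have hf : Function.Injective f := by
      rw [← LinearMap.ker_eq_bot, LinearMap.ker_eq_bot']
      intro m hm
      obtain ⟨v, rfl⟩ := Submodule.mkQ_surjective _ m
      have hA : A.mkQ v = 0 := congrArg Prod.fst hm
      have hB : B.mkQ v = 0 := congrArg Prod.snd hm
      rw [← LinearMap.mem_ker, Submodule.ker_mkQ] at hA hB ⊢
      exact ⟨hA, hB⟩
    have hle : (P.map (A ⊓ B).mkQ).map f ≤ (P.map A.mkQ).prod (P.map B.mkQ) := by
      rintro _ ⟨_, ⟨v, hv, rfl⟩, rfl⟩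
      exact ⟨⟨v, hv, rfl⟩, ⟨v, hv, rfl⟩⟩
    have : FiniteDimensional k ((P.map A.mkQ).prod (P.map B.mkQ)) :=
      
      (Submodule.fg_iff_finiteDimensional _).1 (Submodule.FG.prod
        ((Submodule.fg_iff_finiteDimensional _).2 h1) ((Submodule.fg_iff_finiteDimensional _).2 h2))
    have : FiniteDimensional k ((P.map (A ⊓ B).mkQ).map f) :=
      Submodule.finiteDimensional_of_le hle
    exact (Submodule.equivMapOfInjective f hf _).symm.finiteDimensional

end Comm

/-- The determinant line `∧(A/M)` for `M ⊆ A`, where `A/M` is viewed as a subspace of `V/M`. -/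
noncomputable def detLine (M A : Submodule k V) : Submodule k (ExteriorAlgebra k (V ⧸ M)) :=
  topWedge (A.map M.mkQ)

lemma exists_ne_zero (M A : Submodule k V) [FiniteDimensional k (A.map M.mkQ)] :
    ∃ μ ∈ detLine M A, μ ≠ 0 := by
  have h := finrank_topWedge (A.map M.mkQ)
  refine Submodule.exists_mem_ne_zero_of_ne_bot fun h0 => ?_
  rw [detLine] at h0
  rw [h0, finrank_bot] at h
  exact zero_ne_one h

lemma exists_smul {M A : Submodule k V} [FiniteDimensional k (A.map M.mkQ)]
    {x : ExteriorAlgebra k (V ⧸ M)} (hx : x ∈ detLine M A) (h0 : x ≠ 0)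
    {y : ExteriorAlgebra k (V ⧸ M)} (hy : y ∈ detLine M A) : ∃ c : k, y = c • x := by
  have h := finrank_topWedge (A.map M.mkQ)
  obtain ⟨c, hc⟩ := (finrank_eq_one_iff_of_nonzero' (⟨x, hx⟩ : topWedge (A.map M.mkQ))
    (fun h' => h0 (congrArg Subtype.val h'))).1 h ⟨y, hy⟩
  exact ⟨c, (congrArg Subtype.val hc).symm⟩

lemma exists_refine {M' M A : Submodule k V} (h1 : M' ≤ M) (h2 : M ≤ A)
    [hfd : FiniteDimensional k (A.map M'.mkQ)] {μ : ExteriorAlgebra k (V ⧸ M')}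
    (hμ : μ ∈ detLine M' M) (h0 : μ ≠ 0) :
    ∃ e : detLine M A ≃ₗ[k] detLine M' A, ∀ (x : detLine M A) (α : ExteriorAlgebra k (V ⧸ M')),
      (x : ExteriorAlgebra k (V ⧸ M)) = ExteriorAlgebra.map (Submodule.factor h1) α →
      (e x : ExteriorAlgebra k (V ⧸ M')) = μ * α := by
  obtain ⟨s, hs⟩ := LinearMap.exists_rightInverse_of_surjective (Submodule.factor h1)
    (LinearMap.range_eq_top.2 (Submodule.factor_surjective h1))
  have hs' : ∀ u, Submodule.factor h1 (s u) = u := fun u => LinearMap.congr_fun hs u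
  have hsinj : Function.Injective s := Function.LeftInverse.injective hs'
  have hker : LinearMap.ker (Submodule.factor h1) = M.map M'.mkQ := by
    ext z
    obtain ⟨v, rfl⟩ := Submodule.mkQ_surjective _ z
    rw [LinearMap.mem_ker, Submodule.factor_mk, ← LinearMap.mem_ker, Submodule.ker_mkQ]
    constructor
    · intro hv; exact ⟨v, hv, rfl⟩
    · rintro ⟨m, hm, hmv⟩
      rw [← sub_eq_zero, ← map_sub, ← LinearMap.mem_ker, Submodule.ker_mkQ] at hmv
      have := sub_mem hm (h1 hmv)
      simpa using this
  have hmapA : (A.map M'.mkQ).map (Submodule.factor h1) = A.map M.mkQ := by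
    rw [← Submodule.map_comp, Submodule.factor_comp_mk]
  have hfdM : FiniteDimensional k (M.map M'.mkQ) :=
    Submodule.finiteDimensional_of_le (Submodule.map_mono h2)
  have hfdA : FiniteDimensional k (A.map M.mkQ) := by rw [← hmapA]; infer_instance
  -- dimension count
  have hdim : Module.finrank k (A.map M'.mkQ) =
      Module.finrank k (M.map M'.mkQ) + Module.finrank k (A.map M.mkQ) := by
    have := LinearMap.finrank_range_add_finrank_ker
      ((Submodule.factor h1).domRestrict (A.map M'.mkQ))
    rw [LinearMap.range_domRestrict, hmapA, LinearMap.ker_domRestrict, hker] at this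
    rw [← this, add_comm]
    congr 1
    exact (Submodule.submoduleOfEquivOfLe (Submodule.map_mono (f := M'.mkQ) h2)).finrank_eq
  have hdim2 : Module.finrank k ((A.map M.mkQ).map s) = Module.finrank k (A.map M.mkQ) :=
    (Submodule.equivMapOfInjective s hsinj _).finrank_eq.symm
  have htop2 : topWedge ((A.map M.mkQ).map s) =
      (detLine M A).map (ExteriorAlgebra.map s).toLinearMap := by
    exact topWedge_map s hsinj _
  have hsup : A.map M'.mkQ = M.map M'.mkQ ⊔ (A.map M.mkQ).map s := by
    apply le_antisymm
    · intro z hz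
      rw [← sub_add_cancel z (s (Submodule.factor h1 z))]
      refine add_mem (Submodule.mem_sup_left ?_) (Submodule.mem_sup_right ?_)
      · rw [← hker, LinearMap.mem_ker, map_sub, hs', sub_self]
      · exact ⟨_, hmapA ▸ ⟨z, hz, rfl⟩, rfl⟩
    · refine sup_le (Submodule.map_mono h2) ?_
      rintro _ ⟨y, hy, rfl⟩
      rw [← hmapA] at hy
      obtain ⟨z, hz, rfl⟩ := hy
      have : s (Submodule.factor h1 z) - z ∈ M.map M'.mkQ := by
        rw [← hker, LinearMap.mem_ker, map_sub, hs', sub_self]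
      simpa using add_mem (Submodule.map_mono (f := M'.mkQ) h2 this) hz
  have hprod : detLine M' A =
      detLine M' M * (detLine M A).map (ExteriorAlgebra.map s).toLinearMap := by
    rw [← htop2]
    apply le_antisymm
    · have := sup_pow_le (M.map M'.mkQ) ((A.map M.mkQ).map s)
      rw [hdim2, ← hdim, ← hsup] at this
      exact this
    · rw [detLine, topWedge, topWedge, detLine, topWedge, hdim, hdim2, pow_add]
      exact mul_le_mul' (pow_le_pow_left' (Submodule.map_mono (Submodule.map_mono h2)) _)
        (pow_le_pow_left' (Submodule.map_mono (hsup ▸ le_sup_right)) _)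
  let f : detLine M A →ₗ[k] detLine M' A :=
    LinearMap.codRestrict _ ((LinearMap.mulLeft k μ) ∘ₗ (ExteriorAlgebra.map s).toLinearMap ∘ₗ
      (detLine M A).subtype) (fun x => by
        rw [hprod]; exact Submodule.mul_mem_mul hμ ⟨_, x.2, rfl⟩)
  have hf : ∀ x, (f x : ExteriorAlgebra k (V ⧸ M')) =
      μ * ExteriorAlgebra.map s (x : ExteriorAlgebra k (V ⧸ M)) := fun _ => rfl
  have hsurj : Function.Surjective f := by
    have : ∀ y ∈ detLine M' A, ∃ x, (f x : ExteriorAlgebra k (V ⧸ M')) = y := by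
      intro y hy
      rw [hprod] at hy
      induction hy using Submodule.mul_induction_on' with
      | mem_mul_mem m hm n hn =>
        obtain ⟨c, rfl⟩ := exists_smul hμ h0 hm
        obtain ⟨z, hz, rfl⟩ := hn
        refine ⟨c • ⟨z, hz⟩, ?_⟩
        rw [map_smul, Submodule.coe_smul, hf, smul_mul_assoc]
        rfl
      | add a _ b _ ha hb =>
        obtain ⟨x, hx⟩ := ha
        obtain ⟨x', hx'⟩ := hb
        exact ⟨x + x', by rw [map_add, Submodule.coe_add, hx, hx']⟩
    rintro ⟨y, hy⟩
    obtain ⟨x, hx⟩ := this y hy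
    exact ⟨x, Subtype.ext hx⟩
  have hfin : Module.finrank k (detLine M A) = 1 := finrank_topWedge _
  have hfin' : Module.finrank k (detLine M' A) = 1 := finrank_topWedge _
  have : FiniteDimensional k (detLine M A) := Module.finite_of_finrank_eq_succ hfin
  have : FiniteDimensional k (detLine M' A) := Module.finite_of_finrank_eq_succ hfin'
  have hinj : Function.Injective f :=
    (LinearMap.injective_iff_surjective_of_finrank_eq_finrank (hfin.trans hfin'.symm)).2 hsurj
  refine ⟨LinearEquiv.ofBijective f ⟨hinj, hsurj⟩, fun x α hx => ?_⟩
  refine (hf x).trans ?_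
  rw [hx]
  refine (mul_map_section _ s hs' α μ fun w hw => ?_).symm
  rw [hker] at hw
  exact mul_ι_eq_zero _ hμ hw


/-- `M` is a common "denominator" of `A` and `B`: a subspace `M ⊆ A ∩ B` with `M ∼ P`. -/
structure IsLevel (P A B M : Submodule k V) : Prop where
  comm : Commensurable M P
  le_left : M ≤ A
  le_right : M ≤ B

/-- For `M' ⊆ M ⊆ A ∩ B`: an isomorphism `σ : ∧(A/M) ≃ ∧(B/M)` and an isomorphism
`σ' : ∧(A/M') ≃ ∧(B/M')` correspond to each other under the canonical identifications
`∧(A/M') = ∧(M/M') ⊗ ∧(A/M)` and `∧(B/M') = ∧(M/M') ⊗ ∧(B/M)`, that is,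
`σ'(μ ∧ α) = μ ∧ σ(α)` for all `μ ∈ ∧(M/M')` and `α ∈ ∧(A/M)` (in the formula below, `α` and `β`
are lifts to `⋀(V/M')` of an element of `∧(A/M)` and of its image under `σ`). -/
def Compat {A B M M' : Submodule k V} (h : M' ≤ M) (σ : detLine M A ≃ₗ[k] detLine M B)
    (σ' : detLine M' A ≃ₗ[k] detLine M' B) : Prop :=
  ∀ μ ∈ detLine M' M, ∀ (α β : ExteriorAlgebra k (V ⧸ M')) (x : detLine M A) (x' : detLine M' A),
    (x : ExteriorAlgebra k (V ⧸ M)) = ExteriorAlgebra.map (Submodule.factor h) α →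
    (σ x : ExteriorAlgebra k (V ⧸ M)) = ExteriorAlgebra.map (Submodule.factor h) β →
    (x' : ExteriorAlgebra k (V ⧸ M')) = μ * α →
    (σ' x' : ExteriorAlgebra k (V ⧸ M')) = μ * β

section Compat

lemma map_factor_surjective {M M' : Submodule k V} (h : M' ≤ M) :
    Function.Surjective (ExteriorAlgebra.map (Submodule.factor h)) :=
  ExteriorAlgebra.map_surjective_iff.2 (Submodule.factor_surjective h)

lemma compat_iff {A B M M' : Submodule k V} (h : M' ≤ M) (hA : M ≤ A) (hB : M ≤ B)
    [FiniteDimensional k (A.map M'.mkQ)] [FiniteDimensional k (B.map M'.mkQ)] :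
    ∃ (f : detLine M A ≃ₗ[k] detLine M' A) (g : detLine M B ≃ₗ[k] detLine M' B),
      ∀ (σ : detLine M A ≃ₗ[k] detLine M B) (σ' : detLine M' A ≃ₗ[k] detLine M' B),
      Compat h σ σ' ↔ σ' = (f.symm.trans σ).trans g := by
  have : FiniteDimensional k (M.map M'.mkQ) :=
    Submodule.finiteDimensional_of_le (Submodule.map_mono hA)
  obtain ⟨μ, hμ, h0⟩ := exists_ne_zero M' M
  obtain ⟨f, hf⟩ := exists_refine h hA hμ h0
  obtain ⟨g, hg⟩ := exists_refine h hB hμ h0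
  refine ⟨f, g, fun σ σ' => ⟨fun H => ?_, ?_⟩⟩
  · ext x'
    obtain ⟨x, rfl⟩ := f.surjective x'
    obtain ⟨α, hα⟩ := map_factor_surjective h (x : ExteriorAlgebra k (V ⧸ M))
    obtain ⟨β, hβ⟩ := map_factor_surjective h (σ x : ExteriorAlgebra k (V ⧸ M))
    rw [H μ hμ α β x (f x) hα.symm hβ.symm (hf x α hα.symm)]
    simp [hg (σ x) β hβ.symm]
  · rintro rfl ν hν α β x x' hα hβ hx'
    obtain ⟨c, rfl⟩ := exists_smul hμ h0 hν
    have : x' = c • f x := Subtype.ext (by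
      rw [hx', Submodule.coe_smul, hf x α hα, smul_mul_assoc])
    rw [this]
    simp [hg (σ x) β hβ]

lemma compat_trans {A B M M' M'' : Submodule k V} (h : M' ≤ M) (h' : M'' ≤ M') (hA : M ≤ A)
    [FiniteDimensional k (A.map M''.mkQ)]
    {σ : detLine M A ≃ₗ[k] detLine M B} {σ' : detLine M' A ≃ₗ[k] detLine M' B}
    {σ'' : detLine M'' A ≃ₗ[k] detLine M'' B} (H : Compat h σ σ') (H' : Compat h' σ' σ'') :
    Compat (h'.trans h) σ σ'' := by
  have fA : FiniteDimensional k (A.map M'.mkQ) := by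
    rw [← Submodule.factor_comp_mk h', Submodule.map_comp]; infer_instance
  have : FiniteDimensional k (M.map M'.mkQ) :=
    Submodule.finiteDimensional_of_le (Submodule.map_mono hA)
  have : FiniteDimensional k (M'.map M''.mkQ) :=
    Submodule.finiteDimensional_of_le (Submodule.map_mono (h.trans hA))
  have : FiniteDimensional k (M.map M''.mkQ) :=
    Submodule.finiteDimensional_of_le (Submodule.map_mono hA)
  obtain ⟨μ, hμ, hμ0⟩ := exists_ne_zero M' M
  obtain ⟨ν, hν, hν0⟩ := exists_ne_zero M'' M'
  obtain ⟨e, he⟩ := exists_refine h' h hν hν0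
  obtain ⟨eA, heA⟩ := exists_refine h hA hμ hμ0
  obtain ⟨μ', hμ'⟩ := map_factor_surjective h' μ
  have hfac : ∀ α : ExteriorAlgebra k (V ⧸ M''),
      ExteriorAlgebra.map (Submodule.factor h) (ExteriorAlgebra.map (Submodule.factor h') α) =
      ExteriorAlgebra.map (Submodule.factor (h'.trans h)) α := by
    intro α
    rw [← AlgHom.comp_apply, ExteriorAlgebra.map_comp_map, Submodule.factor_comp]
  have hκ := he ⟨μ, hμ⟩ μ' hμ'.symm
  have hκ0 : (e ⟨μ, hμ⟩ : ExteriorAlgebra k (V ⧸ M'')) ≠ 0 := by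
    intro h0
    have := e.map_eq_zero_iff.1 (Subtype.ext h0)
    exact hμ0 (congrArg Subtype.val this)
  rintro κ hκm α β x x' hα hβ hx'
  obtain ⟨c, rfl⟩ := exists_smul (e ⟨μ, hμ⟩).2 hκ0 hκm
  rw [hκ] at hx' ⊢
  have h1 := H μ hμ _ _ x (eA x) (hα.trans (hfac α).symm) (hβ.trans (hfac β).symm)
    (heA x _ (hα.trans (hfac α).symm))
  have h2 := heA x _ (hα.trans (hfac α).symm)
  have h3 := H' (c • ν) (Submodule.smul_mem _ _ hν) (μ' * α) (μ' * β) (eA x) x'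
    (by rw [h2, map_mul, hμ']) (by rw [h1, map_mul, hμ'])
    (by rw [hx', smul_mul_assoc, smul_mul_assoc, mul_assoc])
  rw [h3, smul_mul_assoc, smul_mul_assoc, mul_assoc]

end Compat

/-- The nonzero elements of the relative determinant line `∧(A/M)^* ⊗ ∧(B/M)` of two subspaces
`A, B` commensurable with `P`; this line does not depend on the choice of `M ∼ P`, `M ⊆ A ∩ B`.
Such an element is the same as an isomorphism `∧(A/M) ≃ ∧(B/M)` for each `M`, these isomorphisms
corresponding to each other under the canonical identifications. -/
@[ext] structure DetIso (P A B : Submodule k V) where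
  toEquiv : ∀ M : Submodule k V, IsLevel P A B M → (detLine M A ≃ₗ[k] detLine M B)
  compat : ∀ {M M' : Submodule k V} (hM : IsLevel P A B M) (hM' : IsLevel P A B M')
    (h : M' ≤ M), Compat h (toEquiv M hM) (toEquiv M' hM')

namespace DetIso
variable {P A B C : Submodule k V}

lemma finite_of_level {M : Submodule k V} (hA : Commensurable A P) (hM : Commensurable M P) :
    FiniteDimensional k (A.map M.mkQ) :=
  (commensurable_iff.1 (hA.trans hM.symm)).1

lemma exists_of_level (hA : Commensurable A P) (hB : Commensurable B P) {M₀ : Submodule k V}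
    (h₀ : IsLevel P A B M₀) (e : detLine M₀ A ≃ₗ[k] detLine M₀ B) :
    ∃ σ : DetIso P A B, σ.toEquiv M₀ h₀ = e := by
  have ex : ∀ {M M' : Submodule k V} (_ : IsLevel P A B M) (_ : IsLevel P A B M') (h : M' ≤ M)
      (σ : detLine M A ≃ₗ[k] detLine M B), ∃ σ', Compat h σ σ' := by
    intro M M' hM hM' h σ
    have := finite_of_level hA hM'.comm
    have := finite_of_level hB hM'.comm
    obtain ⟨f, g, H⟩ := compat_iff h hM.le_left hM.le_right
    exact ⟨_, (H _ _).2 rfl⟩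
  have uniq : ∀ {M M' : Submodule k V} (_ : IsLevel P A B M) (_ : IsLevel P A B M') (h : M' ≤ M)
      {σ : detLine M A ≃ₗ[k] detLine M B} {σ' σ''}, Compat h σ σ' → Compat h σ σ'' →
      σ' = σ'' := by
    intro M M' hM hM' h σ σ' σ'' h1 h2
    have := finite_of_level hA hM'.comm
    have := finite_of_level hB hM'.comm
    obtain ⟨f, g, H⟩ := compat_iff h hM.le_left hM.le_right
    rw [(H _ _).1 h1, (H _ _).1 h2]
  have ex' : ∀ {M M' : Submodule k V} (_ : IsLevel P A B M) (_ : IsLevel P A B M') (h : M' ≤ M)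
      (σ' : detLine M' A ≃ₗ[k] detLine M' B), ∃ σ, Compat h σ σ' := by
    intro M M' hM hM' h σ'
    have := finite_of_level hA hM'.comm
    have := finite_of_level hB hM'.comm
    obtain ⟨f, g, H⟩ := compat_iff h hM.le_left hM.le_right
    refine ⟨(f.trans σ').trans g.symm, (H _ _).2 ?_⟩
    ext x
    simp
  have uniq' : ∀ {M M' : Submodule k V} (_ : IsLevel P A B M) (_ : IsLevel P A B M') (h : M' ≤ M)
      {σ' : detLine M' A ≃ₗ[k] detLine M' B} {σ τ}, Compat h σ σ' → Compat h τ σ' →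
      σ = τ := by
    intro M M' hM hM' h σ' σ τ h1 h2
    have := finite_of_level hA hM'.comm
    have := finite_of_level hB hM'.comm
    obtain ⟨f, g, H⟩ := compat_iff h hM.le_left hM.le_right
    rw [H] at h1 h2
    rw [h1] at h2
    ext x
    have := LinearEquiv.congr_fun h2 (f x)
    simp at this
    rw [this]
  have tr : ∀ {M M' M'' : Submodule k V} (_ : IsLevel P A B M) (_ : IsLevel P A B M'')
      (h : M' ≤ M) (h' : M'' ≤ M') {σ : detLine M A ≃ₗ[k] detLine M B} {σ' σ''}, Compat h σ σ' →
      Compat h' σ' σ'' → Compat (h'.trans h) σ σ'' := by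
    intro M M' M'' hM hM'' h h' σ σ' σ'' h1 h2
    have := finite_of_level hA hM''.comm
    have := finite_of_level hB hM''.comm
    exact compat_trans h h' hM.le_left h1 h2
  have lev : ∀ {M : Submodule k V}, IsLevel P A B M → IsLevel P A B (M ⊓ M₀) := fun hM =>
    ⟨hM.comm.inf h₀.comm, inf_le_left.trans hM.le_left, inf_le_left.trans hM.le_right⟩
  have key : ∀ (M : Submodule k V) (hM : IsLevel P A B M), ∃ σ : detLine M A ≃ₗ[k] detLine M B,
      ∃ τ, Compat (inf_le_right : M ⊓ M₀ ≤ M₀) e τ ∧ Compat (inf_le_left : M ⊓ M₀ ≤ M) σ τ := by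
    intro M hM
    obtain ⟨τ, hτ⟩ := ex h₀ (lev hM) inf_le_right e
    obtain ⟨σ, hσ⟩ := ex' hM (lev hM) inf_le_left τ
    exact ⟨σ, τ, hτ, hσ⟩
  choose σ τ h1 h2 using key
  refine ⟨⟨σ, ?_⟩, ?_⟩
  · intro M M' hM hM' h
    obtain ⟨ρ, hρ⟩ := ex hM hM' h (σ M hM)
    obtain ⟨ρ', hρ'⟩ := ex hM' (lev hM') inf_le_left ρ
    have hle : M' ⊓ M₀ ≤ M ⊓ M₀ := inf_le_inf_right _ h
    obtain ⟨τ', hτ'⟩ := ex (lev hM) (lev hM') hle (τ M hM)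
    have e1 : τ' = τ M' hM' :=
      uniq h₀ (lev hM') inf_le_right (tr h₀ (lev hM') inf_le_right hle (h1 M hM) hτ') (h1 M' hM')
    have e2 : ρ' = τ' := uniq hM (lev hM') (inf_le_left.trans h)
      (tr hM (lev hM') h inf_le_left hρ hρ')
      (tr hM (lev hM') inf_le_left hle (h2 M hM) hτ')
    have e3 : ρ = σ M' hM' := by
      refine uniq' hM' (lev hM') inf_le_left hρ' ?_
      rw [e2, e1]
      exact h2 M' hM'
    exact e3 ▸ hρ
  · refine uniq' h₀ (lev h₀) inf_le_left (h2 M₀ h₀) (h1 M₀ h₀)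

/-- `σ` is defined at the level `M` and maps `x ∈ ∧(A/M)` to `y`. -/
def Rel (σ : DetIso P A B) (M : Submodule k V) (x y : ExteriorAlgebra k (V ⧸ M)) : Prop :=
  ∃ (h : IsLevel P A B M) (hx : x ∈ detLine M A), (σ.toEquiv M h ⟨x, hx⟩ : ExteriorAlgebra k _) = y

lemma Rel.right_mem {σ : DetIso P A B} {M : Submodule k V} {x y : ExteriorAlgebra k (V ⧸ M)}
    (h : σ.Rel M x y) : y ∈ detLine M B := by
  obtain ⟨h, hx, rfl⟩ := h
  exact Subtype.property _

lemma Rel.ne_zero {σ : DetIso P A B} {M : Submodule k V} {x y : ExteriorAlgebra k (V ⧸ M)}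
    (h : σ.Rel M x y) (hx : x ≠ 0) : y ≠ 0 := by
  obtain ⟨h, hx', rfl⟩ := h
  intro h0
  exact hx (congrArg Subtype.val ((σ.toEquiv M h).map_eq_zero_iff.1 (Subtype.ext h0)))

lemma Rel.smul_both {σ : DetIso P A B} {M : Submodule k V} {x y : ExteriorAlgebra k (V ⧸ M)}
    (h : σ.Rel M x y) (c : k) : σ.Rel M (c • x) (c • y) := by
  obtain ⟨h, hx, rfl⟩ := h
  refine ⟨h, Submodule.smul_mem _ _ hx, ?_⟩
  exact congrArg Subtype.val ((σ.toEquiv M h).map_smul c ⟨x, hx⟩)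

/-- Every element has a value at every level. -/
lemma exists_rel (σ : DetIso P A B) {M : Submodule k V} (h : IsLevel P A B M)
    {x : ExteriorAlgebra k (V ⧸ M)} (hx : x ∈ detLine M A) : ∃ y, σ.Rel M x y :=
  ⟨_, h, hx, rfl⟩

lemma ext_of_rel (hA : Commensurable A P) (hB : Commensurable B P) {σ τ : DetIso P A B}
    {M₀ : Submodule k V} {x y : ExteriorAlgebra k (V ⧸ M₀)} (hx : x ≠ 0) (h1 : σ.Rel M₀ x y)
    (h2 : τ.Rel M₀ x y) : σ = τ := by
  obtain ⟨h₀, hxm, e1⟩ := h1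
  obtain ⟨_, _, e2⟩ := h2
  have e0 : σ.toEquiv M₀ h₀ = τ.toEquiv M₀ h₀ := by
    have := finite_of_level hA h₀.comm
    ext ⟨z, hz⟩
    obtain ⟨c, rfl⟩ := exists_smul hxm hx hz
    have : (⟨c • x, hz⟩ : detLine M₀ A) = c • ⟨x, hxm⟩ := rfl
    rw [this, map_smul, map_smul, Submodule.coe_smul, Submodule.coe_smul, e1, e2]
  ext1
  funext M hM
  have hN : IsLevel P A B (M ⊓ M₀) :=
    ⟨hM.comm.inf h₀.comm, inf_le_left.trans hM.le_left, inf_le_left.trans hM.le_right⟩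
  have := finite_of_level hA hN.comm
  have := finite_of_level hB hN.comm
  obtain ⟨f, g, H⟩ := compat_iff (inf_le_right : M ⊓ M₀ ≤ M₀) h₀.le_left h₀.le_right
  have e3 : σ.toEquiv _ hN = τ.toEquiv _ hN := by
    rw [(H _ _).1 (σ.compat h₀ hN inf_le_right), (H _ _).1 (τ.compat h₀ hN inf_le_right), e0]
  obtain ⟨f, g, H⟩ := compat_iff (inf_le_left : M ⊓ M₀ ≤ M) hM.le_left hM.le_right
  have h1 := (H _ _).1 (σ.compat hM hN inf_le_left)
  have h2 := (H _ _).1 (τ.compat hM hN inf_le_left)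
  rw [e3, h2] at h1
  ext x
  have := LinearEquiv.congr_fun h1 (f x)
  simp at this
  rw [this]

/-- Composition at one level determines an element of the relative determinant line. -/
lemma exists_comp (hA : Commensurable A P) (hB : Commensurable B P) (hC : Commensurable C P)
    (σ : DetIso P A B) (τ : DetIso P B C) :
    ∃ ρ : DetIso P A C, ∀ M (h1 : IsLevel P A B M) (h2 : IsLevel P B C M),
      ρ.toEquiv M ⟨h1.comm, h1.le_left, h2.le_right⟩ =
        (σ.toEquiv M h1).trans (τ.toEquiv M h2) := by
  let M₀ := A ⊓ B ⊓ C
  have c₀ : Commensurable M₀ P := (hA.inf hB).inf hC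
  have hl1 : IsLevel P A B M₀ :=
    ⟨c₀, inf_le_left.trans inf_le_left, inf_le_left.trans inf_le_right⟩
  have hl2 : IsLevel P B C M₀ := ⟨c₀, inf_le_left.trans inf_le_right, inf_le_right⟩
  have hl : IsLevel P A C M₀ := ⟨c₀, hl1.le_left, hl2.le_right⟩
  obtain ⟨ρ, hρ⟩ := exists_of_level hA hC hl ((σ.toEquiv M₀ hl1).trans (τ.toEquiv M₀ hl2))
  refine ⟨ρ, fun M h1 h2 => ?_⟩
  have hle : M ≤ M₀ := le_inf (le_inf h1.le_left h1.le_right) h2.le_right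
  have hM : IsLevel P A C M := ⟨h1.comm, h1.le_left, h2.le_right⟩
  have := finite_of_level hA hM.comm
  have := finite_of_level hC hM.comm
  obtain ⟨f, g, H⟩ := compat_iff hle hl.le_left hl.le_right
  have e1 := (H _ _).1 (ρ.compat hl hM hle)
  refine e1.trans ((H _ _).1 ?_).symm
  rw [hρ]
  intro μ hμ α β x x' hα hβ hx'
  obtain ⟨γ, hγ⟩ := map_factor_surjective hle (σ.toEquiv M₀ hl1 x : ExteriorAlgebra k (V ⧸ M₀))
  exact τ.compat hl2 h2 hle μ hμ γ β _ _ hγ.symm hβ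
    (σ.compat hl1 h1 hle μ hμ α γ x x' hα hγ.symm hx')

/-- The inverse isomorphism. -/
noncomputable def symm (hA : Commensurable A P) (σ : DetIso P A B) : DetIso P B A where
  toEquiv M h := (σ.toEquiv M ⟨h.comm, h.le_right, h.le_left⟩).symm
  compat := by
    intro M M' hM hM' h μ hμ α β x x' hα hβ hx'
    have hl : IsLevel P A B M := ⟨hM.comm, hM.le_right, hM.le_left⟩
    have hl' : IsLevel P A B M' := ⟨hM'.comm, hM'.le_right, hM'.le_left⟩
    rcases eq_or_ne μ 0 with rfl | h0
    · rw [zero_mul] at hx' ⊢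
      have : x' = 0 := Subtype.ext hx'
      rw [this, map_zero]
      rfl
    · have := finite_of_level hA hM'.comm
      obtain ⟨f, hf⟩ := exists_refine h hl.le_left hμ h0
      have h1 := hf ((σ.toEquiv M hl).symm x) β hβ
      have h2 := σ.compat hl hl' h μ hμ β α ((σ.toEquiv M hl).symm x)
        (f ((σ.toEquiv M hl).symm x)) hβ (by rw [LinearEquiv.apply_symm_apply, hα]) h1
      have h3 : x' = σ.toEquiv M' hl' (f ((σ.toEquiv M hl).symm x)) :=
        Subtype.ext (hx'.trans h2.symm)
      rw [h3, LinearEquiv.symm_apply_apply, h1]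

/-- Change of (propositionally equal) endpoints. -/
def copy {A' B' : Submodule k V} (σ : DetIso P A B) (hA : A = A') (hB : B = B') :
    DetIso P A' B' := hA ▸ hB ▸ σ

lemma rel_copy {A' B' : Submodule k V} (σ : DetIso P A B) (hA : A = A') (hB : B = B')
    (M : Submodule k V) (x y : ExteriorAlgebra k (V ⧸ M)) :
    (σ.copy hA hB).Rel M x y ↔ σ.Rel M x y := by
  subst hA hB; rfl

lemma rel_symm (hA : Commensurable A P) (σ : DetIso P A B)
    {M : Submodule k V} {x y : ExteriorAlgebra k (V ⧸ M)} (h : σ.Rel M x y) :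
    (σ.symm hA).Rel M y x := by
  obtain ⟨h, hx, rfl⟩ := h
  refine ⟨⟨h.comm, h.le_right, h.le_left⟩, Subtype.property _, ?_⟩
  simp [symm]

/-- The identity. -/
noncomputable def refl (hA : Commensurable A P) : DetIso P A A where
  toEquiv M _ := LinearEquiv.refl k _
  compat := by
    intro M M' hM hM' h μ hμ α β x x' hα hβ hx'
    rcases eq_or_ne μ 0 with rfl | h0
    · simpa using hx'
    · have := finite_of_level hA hM'.comm
      obtain ⟨f, hf⟩ := exists_refine h hM.le_left hμ h0
      rw [LinearEquiv.refl_apply, hx', ← hf x α hα, ← hf x β hβ]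

lemma rel_refl (hA : Commensurable A P) {M : Submodule k V} (hM : IsLevel P A A M)
    {x : ExteriorAlgebra k (V ⧸ M)} (hx : x ∈ detLine M A) : (refl hA).Rel M x x :=
  ⟨hM, hx, rfl⟩

/-- Multiplication by a scalar. -/
noncomputable def smul (c : kˣ) (σ : DetIso P A B) : DetIso P A B where
  toEquiv M h := (σ.toEquiv M h).trans (LinearEquiv.smulOfUnit c)
  compat := by
    intro M M' hM hM' h μ hμ α β x x' hα hβ hx'
    have := σ.compat hM hM' h μ hμ α (((c⁻¹ : kˣ) : k) • β) x x' hα (by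
      rw [map_smul, ← hβ]
      simp [LinearEquiv.smulOfUnit, Units.smul_def]) hx'
    simp [LinearEquiv.smulOfUnit, Units.smul_def, this]

lemma rel_smul (c : kˣ) (σ : DetIso P A B)
    {M : Submodule k V} {x y : ExteriorAlgebra k (V ⧸ M)} (h : σ.Rel M x y) :
    (σ.smul c).Rel M x ((c : k) • y) := by
  obtain ⟨h, hx, rfl⟩ := h
  exact ⟨h, hx, rfl⟩

/-- The product of `σ ∈ ∧(A/M)^* ⊗ ∧(B/M)` and `τ ∈ ∧(B/M)^* ⊗ ∧(C/M)`: the composite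
`∧(A/M) ≃ ∧(B/M) ≃ ∧(C/M)` for all `M ∼ P` contained in `A ∩ B ∩ C`. -/
noncomputable def comp (hA : Commensurable A P) (hB : Commensurable B P) (hC : Commensurable C P)
    (σ : DetIso P A B) (τ : DetIso P B C) : DetIso P A C := (exists_comp hA hB hC σ τ).choose

lemma rel_comp (hA : Commensurable A P) (hB : Commensurable B P) (hC : Commensurable C P)
    (σ : DetIso P A B) (τ : DetIso P B C)
    {M : Submodule k V} {x y z : ExteriorAlgebra k (V ⧸ M)} (h : σ.Rel M x y) (h' : τ.Rel M y z) :
    (comp hA hB hC σ τ).Rel M x z := by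
  obtain ⟨h1, hx, rfl⟩ := h
  obtain ⟨h2, hy, rfl⟩ := h'
  refine ⟨⟨h1.comm, h1.le_left, h2.le_right⟩, hx, ?_⟩
  rw [comp, (exists_comp hA hB hC σ τ).choose_spec M h1 h2]
  rfl

end DetIso

section Shift

/-- The map `⋀(V/M) → ⋀(V/S(M))` induced by `S`. -/
noncomputable def shift (S : V ≃ₗ[k] V) (M N : Submodule k V) (h : M.map (S : V →ₗ[k] V) = N) :
    ExteriorAlgebra k (V ⧸ M) →ₐ[k] ExteriorAlgebra k (V ⧸ N) :=
  ExteriorAlgebra.map (Submodule.Quotient.equiv M N S h : (V ⧸ M) →ₗ[k] (V ⧸ N))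

variable (S : V ≃ₗ[k] V) {M N M' N' : Submodule k V}

lemma shift_bijective (h : M.map (S : V →ₗ[k] V) = N) : Function.Bijective (shift S M N h) := by
  constructor
  · refine ExteriorAlgebra.map_injective_field ?_
    exact LinearEquiv.ker _
  · exact ExteriorAlgebra.map_surjective_iff.2 (Submodule.Quotient.equiv M N S h).surjective

lemma map_shift (h : M.map (S : V →ₗ[k] V) = N) {A B : Submodule k V}
    (hA : A.map (S : V →ₗ[k] V) = B) :
    (detLine M A).map (shift S M N h).toLinearMap = detLine N B := by
  subst hA h
  rw [detLine, shift, ← topWedge_map _ (LinearEquiv.injective _), detLine, ← Submodule.map_comp,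
    ← Submodule.map_comp]
  rfl

lemma shift_factor (h : M.map (S : V →ₗ[k] V) = N) (h' : M'.map (S : V →ₗ[k] V) = N')
    (hM : M' ≤ M) (hN : N' ≤ N) (α : ExteriorAlgebra k (V ⧸ M')) :
    shift S M N h (ExteriorAlgebra.map (Submodule.factor hM) α) =
      ExteriorAlgebra.map (Submodule.factor hN) (shift S M' N' h' α) := by
  rw [shift, shift, ← AlgHom.comp_apply, ← AlgHom.comp_apply, ExteriorAlgebra.map_comp_map,
    ExteriorAlgebra.map_comp_map]
  congr 2
  ext v
  rfl

/-- The isomorphism `∧(A/M) ≃ ∧(S(A)/S(M))` induced by `S`. -/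
noncomputable def detShift (h : M.map (S : V →ₗ[k] V) = N) {A B : Submodule k V}
    (hA : A.map (S : V →ₗ[k] V) = B) : detLine M A ≃ₗ[k] detLine N B :=
  (Submodule.equivMapOfInjective (shift S M N h).toLinearMap (shift_bijective S h).1
    (detLine M A)).trans (LinearEquiv.ofEq _ _ (map_shift S h hA))

lemma coe_detShift (h : M.map (S : V →ₗ[k] V) = N) {A B : Submodule k V}
    (hA : A.map (S : V →ₗ[k] V) = B) (x : detLine M A) :
    (detShift S h hA x : ExteriorAlgebra k (V ⧸ N)) = shift S M N h x := rfl

lemma shift_shift (T : V ≃ₗ[k] V) {L : Submodule k V} (h : M.map (S : V →ₗ[k] V) = N)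
    (h' : N.map (T : V →ₗ[k] V) = L) (h'' : M.map ((T * S : V ≃ₗ[k] V) : V →ₗ[k] V) = L) 
    (α : ExteriorAlgebra k (V ⧸ M)) :
    shift T N L h' (shift S M N h α) = shift (T * S) M L h'' α := by
  rw [shift, shift, shift, ← AlgHom.comp_apply, ExteriorAlgebra.map_comp_map]
  congr 2
  ext v
  rfl

lemma shift_one (h : M.map ((1 : V ≃ₗ[k] V) : V →ₗ[k] V) = M) (α : ExteriorAlgebra k (V ⧸ M)) :
    shift 1 M M h α = α := by
  have : ((Submodule.Quotient.equiv M M 1 h : (V ⧸ M) ≃ₗ[k] (V ⧸ M)) : (V ⧸ M) →ₗ[k] (V ⧸ M)) =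
      LinearMap.id := by
    ext v
    rfl
  rw [shift, this, ExteriorAlgebra.map_id]
  rfl

lemma map_comap_self (M : Submodule k V) :
    (M.comap (S : V →ₗ[k] V)).map (S : V →ₗ[k] V) = M :=
  Submodule.map_comap_eq_of_surjective S.surjective _

lemma level_comap {P A B : Submodule k V} (hS : Commensurable (P.map (S : V →ₗ[k] V)) P)
    (hM : IsLevel P (A.map (S : V →ₗ[k] V)) (B.map (S : V →ₗ[k] V)) M) :
    IsLevel P A B (M.comap (S : V →ₗ[k] V)) := by
  have inj : ∀ X : Submodule k V, (X.map (S : V →ₗ[k] V)).comap (S : V →ₗ[k] V) = X := fun X =>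
    Submodule.comap_map_eq_of_injective S.injective X
  refine ⟨?_, ?_, ?_⟩
  · have := (hM.comm.trans hS.symm).map S.symm
    have e : ∀ X : Submodule k V, X.map (S.symm : V →ₗ[k] V) = X.comap (S : V →ₗ[k] V) := fun X =>
      Submodule.map_equiv_eq_comap_symm S.symm X
    rwa [e, e, inj] at this
  · rw [← inj A]; exact Submodule.comap_mono hM.le_left
  · rw [← inj B]; exact Submodule.comap_mono hM.le_right

/-- Transport of structure by `S`, from `∧(A/M)^* ⊗ ∧(B/M)` to
`∧(S(A)/S(M))^* ⊗ ∧(S(B)/S(M))`. -/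
noncomputable def DetIso.map {P A B : Submodule k V} (σ : DetIso P A B) (S : V ≃ₗ[k] V)
    (hS : Commensurable (P.map (S : V →ₗ[k] V)) P) :
    DetIso P (A.map (S : V →ₗ[k] V)) (B.map (S : V →ₗ[k] V)) where
  toEquiv M hM := ((detShift S (map_comap_self S M) rfl).symm.trans
    (σ.toEquiv _ (level_comap S hS hM))).trans (detShift S (map_comap_self S M) rfl)
  compat := by
    intro M M' hM hM' h μ hμ α β x x' hα hβ hx'
    have hle : M'.comap (S : V →ₗ[k] V) ≤ M.comap (S : V →ₗ[k] V) := Submodule.comap_mono h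
    obtain ⟨α, rfl⟩ := (shift_bijective S (map_comap_self S M')).2 α
    obtain ⟨β, rfl⟩ := (shift_bijective S (map_comap_self S M')).2 β
    obtain ⟨x, rfl⟩ := (detShift S (map_comap_self S M) rfl).surjective x
    obtain ⟨x', rfl⟩ := (detShift S (map_comap_self S M') rfl).surjective x'
    rw [← map_shift S (map_comap_self S M') (map_comap_self S M)] at hμ
    obtain ⟨μ, hμ, rfl⟩ := hμ
    simp only [LinearEquiv.trans_apply, LinearEquiv.symm_apply_apply, coe_detShift] at hα hβ hx' ⊢
    rw [← shift_factor S (map_comap_self S M) (map_comap_self S M') hle] at hα hβ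
    rw [AlgHom.toLinearMap_apply, ← map_mul] at hx' ⊢
    congr 1
    exact σ.compat (level_comap S hS hM) (level_comap S hS hM') hle μ hμ α β x x'
      ((shift_bijective S _).1 hα) ((shift_bijective S _).1 hβ) ((shift_bijective S _).1 hx')

lemma DetIso.rel_map {P A B : Submodule k V} (σ : DetIso P A B) (S : V ≃ₗ[k] V)
    (hS : Commensurable (P.map (S : V →ₗ[k] V)) P) {M N : Submodule k V}
    (h : M.map (S : V →ₗ[k] V) = N) (hN : Commensurable N P) {x y : ExteriorAlgebra k (V ⧸ M)}
    (H : σ.Rel M x y) : (σ.map S hS).Rel N (shift S M N h x) (shift S M N h y) := by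
  obtain rfl : M = N.comap (S : V →ₗ[k] V) := by
    rw [← h, Submodule.comap_map_eq_of_injective S.injective]
  obtain ⟨hl, hx, rfl⟩ := H
  have hm : shift S _ N h x ∈ detLine N (A.map (S : V →ₗ[k] V)) := by
    rw [← map_shift S h rfl]; exact ⟨x, hx, rfl⟩
  refine ⟨⟨hN, ?_, ?_⟩, hm, ?_⟩
  · rw [← h]; exact Submodule.map_mono hl.le_left
  · rw [← h]; exact Submodule.map_mono hl.le_right
  · have : (⟨_, hm⟩ : detLine N (A.map (S : V →ₗ[k] V))) = detShift S h rfl ⟨x, hx⟩ := rfl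
    rw [this, DetIso.map]
    simp only [LinearEquiv.trans_apply, LinearEquiv.symm_apply_apply, coe_detShift]

end Shift


/-- The group `Gl(V)` of the pair `(V, P)`: linear automorphisms `S` of `V` such that `S(P)` and
`S⁻¹(P)` are commensurable with `P`. -/
def Gl (P : Submodule k V) : Subgroup (V ≃ₗ[k] V) where
  carrier := {S | Commensurable (P.map (S : V →ₗ[k] V)) P ∧
    Commensurable (P.map ((S⁻¹ : V ≃ₗ[k] V) : V →ₗ[k] V)) P}
  mul_mem' := by
    have key : ∀ S T : V ≃ₗ[k] V, Commensurable (P.map (S : V →ₗ[k] V)) P →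
        Commensurable (P.map (T : V →ₗ[k] V)) P →
        Commensurable (P.map ((S * T : V ≃ₗ[k] V) : V →ₗ[k] V)) P := by
      intro S T hS hT
      have : P.map ((S * T : V ≃ₗ[k] V) : V →ₗ[k] V) =
          (P.map (T : V →ₗ[k] V)).map (S : V →ₗ[k] V) := by
        rw [← Submodule.map_comp]; rfl
      rw [this]
      exact (hT.map S).trans hS
    rintro S T ⟨h1, h2⟩ ⟨h3, h4⟩
    exact ⟨key _ _ h1 h3, by rw [mul_inv_rev]; exact key _ _ h4 h2⟩
  one_mem' := by
    have : P.map ((1 : V ≃ₗ[k] V) : V →ₗ[k] V) = P := Submodule.map_id P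
    refine ⟨?_, ?_⟩
    · rw [this]; exact Commensurable.refl P
    · rw [inv_one, this]; exact Commensurable.refl P
  inv_mem' := by
    rintro S ⟨h1, h2⟩
    exact ⟨h2, by rwa [inv_inv]⟩

/-- The winding number `w(S) = dim P/(P ∩ S(P)) - dim S(P)/(P ∩ S(P))`. -/
noncomputable def windingNumber {P : Submodule k V} (S : Gl P) : ℤ :=
  (Module.finrank k (↥P ⧸ (P ⊓ P.map (S.1 : V →ₗ[k] V)).submoduleOf P) : ℤ) -
    (Module.finrank k (↥(P.map (S.1 : V →ₗ[k] V)) ⧸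
      (P ⊓ P.map (S.1 : V →ₗ[k] V)).submoduleOf (P.map (S.1 : V →ₗ[k] V))) : ℤ)

/-- `Gl⁰(V)`, the elements of winding number zero. -/
def Gl0 (P : Submodule k V) : Set (Gl P) := {S | windingNumber S = 0}

/-- The extension of `Gl(V)` by `k^*`: pairs `(σ, S)` with `S ∈ Gl(V)` and `σ` a nonzero element
of `∧(P/M)^* ⊗ ∧(S(P)/M)`, the line of homomorphisms from the pull back of the determinant bundle
of the infinite Grassmannian of `(V, P)` by `S⁻¹` to the determinant bundle itself. -/
structure GlTilde (P : Submodule k V) where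
  toGl : Gl P
  iso : DetIso P P (P.map (toGl.1 : V →ₗ[k] V))

namespace GlTilde
variable {P : Submodule k V}

lemma ext_of_rel {x y : GlTilde P} (h : x.toGl = y.toGl) {M : Submodule k V}
    {a b : ExteriorAlgebra k (V ⧸ M)} (ha : a ≠ 0) (h1 : x.iso.Rel M a b)
    (h2 : y.iso.Rel M a b) : x = y := by
  obtain ⟨S, σ⟩ := x
  obtain ⟨T, τ⟩ := y
  obtain rfl : S = T := h
  congr 1
  exact DetIso.ext_of_rel (Commensurable.refl P) S.2.1 ha h1 h2

/-- The group law `(σ, S)(τ, T) = (σ ∘ S_*(τ), ST)`. -/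
noncomputable instance : Mul (GlTilde P) where
  mul x y := ⟨x.toGl * y.toGl, DetIso.comp (Commensurable.refl P) x.toGl.2.1
    (x.toGl * y.toGl).2.1 x.iso
    ((y.iso.map x.toGl.1 x.toGl.2.1).copy rfl (by rw [← Submodule.map_comp]; rfl))⟩

noncomputable instance : One (GlTilde P) where
  one := ⟨1, (DetIso.refl (Commensurable.refl P)).copy rfl (Submodule.map_id P).symm⟩

noncomputable instance : Inv (GlTilde P) where
  inv x := ⟨x.toGl⁻¹, ((x.iso.symm (Commensurable.refl P)).map (x.toGl⁻¹).1 (x.toGl⁻¹).2.1).copy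
    (by
      rw [← Submodule.map_comp]
      exact (congrArg (fun S : V ≃ₗ[k] V => P.map (S : V →ₗ[k] V))
        (inv_mul_cancel x.toGl.1)).trans (Submodule.map_id P)) rfl⟩

lemma mul_toGl (x y : GlTilde P) : (x * y).toGl = x.toGl * y.toGl := rfl

lemma mul_rel (x y : GlTilde P) {M N : Submodule k V} (h : M.map (x.toGl.1 : V →ₗ[k] V) = N)
    {a : ExteriorAlgebra k (V ⧸ N)} {b c : ExteriorAlgebra k (V ⧸ M)}
    (h1 : x.iso.Rel N a (shift x.toGl.1 M N h b)) (h2 : y.iso.Rel M b c) :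
    (x * y).iso.Rel N a (shift x.toGl.1 M N h c) := by
  have hN : Commensurable N P := by obtain ⟨hl, _⟩ := h1; exact hl.comm
  exact DetIso.rel_comp (Commensurable.refl P) x.toGl.2.1 (x.toGl * y.toGl).2.1 _ _ h1
    ((DetIso.rel_copy _ _ _ _ _ _).2 (DetIso.rel_map _ _ x.toGl.2.1 h hN h2))

lemma one_rel {M : Submodule k V} (hM : Commensurable M P) (hMP : M ≤ P)
    {a : ExteriorAlgebra k (V ⧸ M)} (ha : a ∈ detLine M P) : (1 : GlTilde P).iso.Rel M a a :=
  (DetIso.rel_copy _ _ _ _ _ _).2 (DetIso.rel_refl _ ⟨hM, hMP, hMP⟩ ha)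

lemma inv_rel (x : GlTilde P) {M N : Submodule k V}
    (h : M.map ((x.toGl⁻¹).1 : V →ₗ[k] V) = N) (hN : Commensurable N P)
    {a b : ExteriorAlgebra k (V ⧸ M)} (h1 : x.iso.Rel M a b) :
    (x⁻¹).iso.Rel N (shift (x.toGl⁻¹).1 M N h b) (shift (x.toGl⁻¹).1 M N h a) :=
  (DetIso.rel_copy _ _ _ _ _ _).2
    (DetIso.rel_map _ _ (x.toGl⁻¹).2.1 h hN (DetIso.rel_symm _ _ h1))

lemma comm_map (S : Gl P) {M : Submodule k V} (h : Commensurable M P) :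
    Commensurable (M.map (S.1 : V →ₗ[k] V)) P := (h.map S.1).trans S.2.1

lemma map_map_mul (S T : Gl P) (M : Submodule k V) :
    (M.map (T.1 : V →ₗ[k] V)).map (S.1 : V →ₗ[k] V) = M.map ((S * T).1 : V →ₗ[k] V) := by
  rw [← Submodule.map_comp]; rfl

lemma map_inv_map (S : Gl P) (M : Submodule k V) :
    (M.map (S.1 : V →ₗ[k] V)).map ((S⁻¹).1 : V →ₗ[k] V) = M := by
  rw [map_map_mul, inv_mul_cancel]; exact Submodule.map_id M

lemma map_map_inv (S : Gl P) (M : Submodule k V) :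
    (M.map ((S⁻¹).1 : V →ₗ[k] V)).map (S.1 : V →ₗ[k] V) = M := by
  rw [map_map_mul, mul_inv_cancel]; exact Submodule.map_id M

lemma exists_ne_zero' {M : Submodule k V} (hM : Commensurable M P) :
    ∃ a ∈ detLine M P, a ≠ 0 := by
  have : FiniteDimensional k (P.map M.mkQ) :=
    DetIso.finite_of_level (Commensurable.refl P) hM
  exact exists_ne_zero M P

noncomputable instance : Group (GlTilde P) := Group.ofLeftAxioms
  (by
    intro x y z
    -- a lattice small enough
    let X := P ⊓ P.map (x.toGl.1 : V →ₗ[k] V) ⊓ P.map ((x.toGl * y.toGl).1 : V →ₗ[k] V) ⊓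
      P.map ((x.toGl * y.toGl * z.toGl).1 : V →ₗ[k] V)
    have hX : Commensurable X P := (((Commensurable.refl P).inf (x.toGl).2.1).inf
      (x.toGl * y.toGl).2.1).inf (x.toGl * y.toGl * z.toGl).2.1
    have hXP : X ≤ P := inf_le_left.trans (inf_le_left.trans inf_le_left)
    have hX1 : X ≤ P.map (x.toGl.1 : V →ₗ[k] V) :=
      inf_le_left.trans (inf_le_left.trans inf_le_right)
    have hX2 : X ≤ P.map ((x.toGl * y.toGl).1 : V →ₗ[k] V) := inf_le_left.trans inf_le_right
    have hX3 : X ≤ P.map ((x.toGl * y.toGl * z.toGl).1 : V →ₗ[k] V) := inf_le_right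
    let Y := X.map ((x.toGl⁻¹).1 : V →ₗ[k] V)
    let Z := Y.map ((y.toGl⁻¹).1 : V →ₗ[k] V)
    have hY : Commensurable Y P := comm_map _ hX
    have hZ : Commensurable Z P := comm_map _ hY
    have hYX : Y.map (x.toGl.1 : V →ₗ[k] V) = X := map_map_inv _ _
    have hZY : Z.map (y.toGl.1 : V →ₗ[k] V) = Y := map_map_inv _ _
    have hZX : Z.map ((x.toGl * y.toGl).1 : V →ₗ[k] V) = X := by rw [← map_map_mul, hZY, hYX]
    have pull : ∀ (S : Gl P) {A B : Submodule k V}, A ≤ B →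
        A.map ((S⁻¹).1 : V →ₗ[k] V) ≤ B.map ((S⁻¹).1 : V →ₗ[k] V) :=
      fun S _ _ h => Submodule.map_mono h
    have lY1 : Y ≤ P := by
      have := pull x.toGl hX1; rwa [map_inv_map] at this
    have lY2 : Y ≤ P.map (y.toGl.1 : V →ₗ[k] V) := by
      have := pull x.toGl hX2; rwa [← map_map_mul, map_inv_map] at this
    have lY3 : Y ≤ (P.map (z.toGl.1 : V →ₗ[k] V)).map (y.toGl.1 : V →ₗ[k] V) := by
      have := pull x.toGl hX3
      rwa [← map_map_mul, ← map_map_mul, map_inv_map] at this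
    have lZ1 : Z ≤ P := by
      have := pull y.toGl lY2; rwa [map_inv_map] at this
    have lZ2 : Z ≤ P.map (z.toGl.1 : V →ₗ[k] V) := by
      have := pull y.toGl lY3; rwa [map_inv_map] at this
    obtain ⟨a, ha, ha0⟩ := exists_ne_zero' hX
    obtain ⟨b', hb⟩ := x.iso.exists_rel ⟨hX, hXP, hX1⟩ ha
    obtain ⟨b, rfl⟩ := (shift_bijective x.toGl.1 hYX).2 b'
    have hbm : b ∈ detLine Y P := by
      have := hb.right_mem
      rw [← map_shift x.toGl.1 hYX rfl] at this
      obtain ⟨b', h1, h2⟩ := this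
      exact (shift_bijective x.toGl.1 hYX).1 h2 ▸ h1
    obtain ⟨c', hc⟩ := y.iso.exists_rel ⟨hY, lY1, lY2⟩ hbm
    obtain ⟨c, rfl⟩ := (shift_bijective y.toGl.1 hZY).2 c'
    have hcm : c ∈ detLine Z P := by
      have := hc.right_mem
      rw [← map_shift y.toGl.1 hZY rfl] at this
      obtain ⟨b', h1, h2⟩ := this
      exact (shift_bijective y.toGl.1 hZY).1 h2 ▸ h1
    obtain ⟨d, hd⟩ := z.iso.exists_rel ⟨hZ, lZ1, lZ2⟩ hcm
    have e1 := mul_rel x (y * z) hYX hb (mul_rel y z hZY hc hd)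
    have e2 := mul_rel x y hYX hb hc
    rw [shift_shift _ _ hZY hYX hZX] at e1 e2
    exact ext_of_rel (mul_assoc _ _ _) ha0 (mul_rel (x * y) z hZX e2 hd) e1)
  (by
    intro x
    let X := P ⊓ P.map (x.toGl.1 : V →ₗ[k] V)
    have hX : Commensurable X P := (Commensurable.refl P).inf (x.toGl).2.1
    have h1 : X.map ((1 : GlTilde P).toGl.1 : V →ₗ[k] V) = X := Submodule.map_id X
    obtain ⟨a, ha, ha0⟩ := exists_ne_zero' hX
    obtain ⟨b, hb⟩ := x.iso.exists_rel ⟨hX, inf_le_left, inf_le_right⟩ ha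
    have e := mul_rel 1 x h1 (a := a) (b := a) (c := b)
      (by rw [show shift (1 : GlTilde P).toGl.1 X X h1 a = a from shift_one h1 a]
          exact one_rel hX inf_le_left ha) hb
    rw [show shift (1 : GlTilde P).toGl.1 X X h1 b = b from shift_one h1 b] at e
    exact ext_of_rel (one_mul _) ha0 e hb)
  (by
    intro x
    let X := P ⊓ P.map (x.toGl.1 : V →ₗ[k] V)
    have hX : Commensurable X P := (Commensurable.refl P).inf (x.toGl).2.1
    let Y := X.map ((x.toGl⁻¹).1 : V →ₗ[k] V)
    have hY : Commensurable Y P := comm_map _ hX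
    have lY : Y ≤ P := by
      have : Y ≤ (P.map (x.toGl.1 : V →ₗ[k] V)).map ((x.toGl⁻¹).1 : V →ₗ[k] V) :=
        Submodule.map_mono inf_le_right
      rwa [map_inv_map] at this
    obtain ⟨a, ha, ha0⟩ := exists_ne_zero' hX
    obtain ⟨b, hb⟩ := x.iso.exists_rel ⟨hX, inf_le_left, inf_le_right⟩ ha
    have hbm : shift (x.toGl⁻¹).1 X Y rfl b ∈ detLine Y P := by
      have : (P.map (x.toGl.1 : V →ₗ[k] V)).map ((x.toGl⁻¹).1 : V →ₗ[k] V) = P := map_inv_map _ _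
      rw [← map_shift _ rfl this]
      exact ⟨b, hb.right_mem, rfl⟩
    have e := mul_rel x⁻¹ x (M := X) (N := Y) rfl (inv_rel x rfl hY hb) hb
    refine ext_of_rel (inv_mul_cancel _) ?_ e (one_rel hY lY hbm)
    intro h0
    exact hb.ne_zero ha0 ((shift_bijective (x.toGl⁻¹).1 (M := X) rfl).1 (by rw [h0, _root_.map_zero])))


/-- The projection `(σ, S) ↦ S`. -/
def proj (P : Submodule k V) : GlTilde P →* Gl P where
  toFun := toGl
  map_one' := rfl
  map_mul' _ _ := rfl

lemma proj_surjective : Function.Surjective (proj P) := by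
  intro S
  let X := P ⊓ P.map (S.1 : V →ₗ[k] V)
  have hX : Commensurable X P := (Commensurable.refl P).inf S.2.1
  have h1 : FiniteDimensional k (P.map X.mkQ) := DetIso.finite_of_level (Commensurable.refl P) hX
  have h2 : FiniteDimensional k ((P.map (S.1 : V →ₗ[k] V)).map X.mkQ) :=
    DetIso.finite_of_level S.2.1 hX
  have f1 : Module.finrank k (detLine X P) = 1 := finrank_topWedge _
  have f2 : Module.finrank k (detLine X (P.map (S.1 : V →ₗ[k] V))) = 1 := finrank_topWedge _
  have : FiniteDimensional k (detLine X P) := Module.finite_of_finrank_eq_succ f1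
  have : FiniteDimensional k (detLine X (P.map (S.1 : V →ₗ[k] V))) :=
    Module.finite_of_finrank_eq_succ f2
  obtain ⟨σ, -⟩ := DetIso.exists_of_level (Commensurable.refl P) S.2.1
    ⟨hX, inf_le_left, inf_le_right⟩ (LinearEquiv.ofFinrankEq _ _ (f1.trans f2.symm))
  exact ⟨⟨S, σ⟩, rfl⟩

/-- The element `(c, 1)`. -/
noncomputable def scalarAux (c : kˣ) : GlTilde P :=
  ⟨1, ((DetIso.refl (Commensurable.refl P)).smul c).copy rfl (Submodule.map_id P).symm⟩

lemma scalarAux_rel (c : kˣ) {M : Submodule k V} (hM : Commensurable M P) (hMP : M ≤ P)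
    {a : ExteriorAlgebra k (V ⧸ M)} (ha : a ∈ detLine M P) :
    (scalarAux c : GlTilde P).iso.Rel M a ((c : k) • a) :=
  (DetIso.rel_copy _ _ _ _ _ _).2 (DetIso.rel_smul c _ (DetIso.rel_refl _ ⟨hM, hMP, hMP⟩ ha))

lemma scalarAux_mul_rel (c : kˣ) (x : GlTilde P) {M : Submodule k V} (hM : Commensurable M P)
    (hMP : M ≤ P) {a b : ExteriorAlgebra k (V ⧸ M)} (ha : a ∈ detLine M P)
    (h : x.iso.Rel M a b) : (scalarAux c * x).iso.Rel M a ((c : k) • b) := by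
  have h1 : M.map ((scalarAux c : GlTilde P).toGl.1 : V →ₗ[k] V) = M := Submodule.map_id M
  have hs : ∀ d, shift (scalarAux c : GlTilde P).toGl.1 M M h1 d = d := fun d => shift_one h1 d
  have e := mul_rel (scalarAux c) x h1 (a := a) (b := (c : k) • a)
    (by rw [hs]; exact scalarAux_rel c hM hMP ha) (h.smul_both _)
  rwa [hs] at e

/-- The inclusion of `k^*` in the extension. -/
noncomputable def scalar (P : Submodule k V) : kˣ →* GlTilde P where
  toFun := scalarAux
  map_one' := by
    obtain ⟨a, ha, ha0⟩ := exists_ne_zero' (Commensurable.refl P)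
    have e := scalarAux_rel (1 : kˣ) (Commensurable.refl P) le_rfl ha
    rw [Units.val_one, one_smul] at e
    exact ext_of_rel rfl ha0 e (one_rel (Commensurable.refl P) le_rfl ha)
  map_mul' c d := by
    obtain ⟨a, ha, ha0⟩ := exists_ne_zero' (Commensurable.refl P)
    have e := scalarAux_rel (c * d) (Commensurable.refl P) le_rfl ha
    have e' := scalarAux_mul_rel c (scalarAux d) (Commensurable.refl P) le_rfl ha
      (scalarAux_rel d (Commensurable.refl P) le_rfl ha)
    rw [Units.val_mul, mul_smul] at e
    exact ext_of_rel (mul_one 1).symm ha0 e e'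

lemma scalar_injective : Function.Injective (scalar P) := by
  intro c d h
  obtain ⟨a, ha, ha0⟩ := exists_ne_zero' (Commensurable.refl P)
  obtain ⟨_, _, e⟩ := scalarAux_rel c (Commensurable.refl P) le_rfl ha
  obtain ⟨_, _, e'⟩ : (scalarAux c : GlTilde P).iso.Rel P a ((d : k) • a) := by
    rw [show (scalarAux c : GlTilde P) = scalarAux d from h]
    exact scalarAux_rel d (Commensurable.refl P) le_rfl ha
  have e2 : (c : k) • a = (d : k) • a := e.symm.trans e'
  exact Units.ext (smul_left_injective k ha0 e2)

/-- exactness in the middle -/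
lemma ker_proj : (proj P).ker = (scalar P).range := by
  ext x
  constructor
  · intro hx
    have hx : x.toGl = 1 := hx
    have hP : P.map (x.toGl.1 : V →ₗ[k] V) = P := by rw [hx]; exact Submodule.map_id P
    obtain ⟨a, ha, ha0⟩ := exists_ne_zero' (Commensurable.refl P)
    have : FiniteDimensional k (P.map P.mkQ) :=
      DetIso.finite_of_level (Commensurable.refl P) (Commensurable.refl P)
    obtain ⟨b, hb⟩ := x.iso.exists_rel ⟨Commensurable.refl P, le_rfl, hP.ge⟩ ha
    obtain ⟨c, rfl⟩ := exists_smul ha ha0 (hP ▸ hb.right_mem)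
    have hc : c ≠ 0 := by
      rintro rfl
      exact hb.ne_zero ha0 (zero_smul _ _)
    exact ⟨Units.mk0 c hc, ext_of_rel hx.symm ha0
      (scalarAux_rel (Units.mk0 c hc) (Commensurable.refl P) le_rfl ha) hb⟩
  · rintro ⟨c, rfl⟩
    rfl

/-- centrality -/
lemma scalar_mul_comm (c : kˣ) (x : GlTilde P) : scalar P c * x = x * scalar P c := by
  let X := P ⊓ P.map (x.toGl.1 : V →ₗ[k] V)
  have hX : Commensurable X P := (Commensurable.refl P).inf (x.toGl).2.1
  let Y := X.map ((x.toGl⁻¹).1 : V →ₗ[k] V)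
  have hY : Commensurable Y P := comm_map _ hX
  have hYX : Y.map (x.toGl.1 : V →ₗ[k] V) = X := map_map_inv _ _
  have lY : Y ≤ P := by
    have : Y ≤ (P.map (x.toGl.1 : V →ₗ[k] V)).map ((x.toGl⁻¹).1 : V →ₗ[k] V) :=
      Submodule.map_mono inf_le_right
    rwa [map_inv_map] at this
  obtain ⟨a, ha, ha0⟩ := exists_ne_zero' hX
  obtain ⟨b', hb⟩ := x.iso.exists_rel ⟨hX, inf_le_left, inf_le_right⟩ ha
  obtain ⟨b, rfl⟩ := (shift_bijective x.toGl.1 hYX).2 b'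
  have hbm : b ∈ detLine Y P := by
    have := hb.right_mem
    rw [← map_shift x.toGl.1 hYX rfl] at this
    obtain ⟨b', h1, h2⟩ := this
    exact (shift_bijective x.toGl.1 hYX).1 h2 ▸ h1
  have e1 := scalarAux_mul_rel c x hX inf_le_left ha hb
  have e2 := mul_rel x (scalarAux c) hYX hb (scalarAux_rel c hY lY hbm)
  rw [map_smul] at e2
  exact ext_of_rel ((one_mul _).trans (mul_one _).symm) ha0 e1 e2

end GlTilde

/-- For commuting `S` and `T` the commutator of two lifts is a scalar which does not depend on
the lifts. -/
lemma exists_commutator {P : Submodule k V} {S T : Gl P} (h : Commute S T) :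
    ∃ c : kˣ, ∀ x y : GlTilde P, GlTilde.proj P x = S → GlTilde.proj P y = T →
      x * y * x⁻¹ * y⁻¹ = GlTilde.scalar P c := by
  obtain ⟨x₀, hx₀⟩ := GlTilde.proj_surjective S
  obtain ⟨y₀, hy₀⟩ := GlTilde.proj_surjective T
  have hker : x₀ * y₀ * x₀⁻¹ * y₀⁻¹ ∈ (GlTilde.proj P).ker := by
    rw [MonoidHom.mem_ker, map_mul, map_mul, map_mul, map_inv, map_inv, hx₀, hy₀, h.eq,
      mul_inv_cancel_right, mul_inv_cancel]
  have lift : ∀ {x x₀ : GlTilde P}, GlTilde.proj P x = GlTilde.proj P x₀ →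
      ∃ c, x = GlTilde.scalar P c * x₀ := by
    intro x x₀ hx
    have : x * x₀⁻¹ ∈ (GlTilde.proj P).ker := by
      rw [MonoidHom.mem_ker, map_mul, map_inv, hx, mul_inv_cancel]
    rw [GlTilde.ker_proj] at this
    obtain ⟨c, hc⟩ := this
    exact ⟨c, by rw [hc, inv_mul_cancel_right]⟩
  rw [GlTilde.ker_proj] at hker
  obtain ⟨c, hc⟩ := hker
  refine ⟨c, fun x y hx hy => ?_⟩
  obtain ⟨a, rfl⟩ := lift (hx.trans hx₀.symm)
  obtain ⟨b, rfl⟩ := lift (hy.trans hy₀.symm)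
  rw [hc]
  have key : ∀ (A B x y : GlTilde P), (∀ z, A * z = z * A) → (∀ z, B * z = z * B) →
      A * x * (B * y) * (A * x)⁻¹ * (B * y)⁻¹ = x * y * x⁻¹ * y⁻¹ := by
    intro A B x y ca cb
    have h1 : A * x * (B * y) = x * y * (A * B) := by
      rw [ca x, cb y, mul_assoc, ← mul_assoc A, ca y, mul_assoc, mul_assoc]
    have h2 : (B * y) * (A * x) = y * x * (A * B) := by
      rw [cb y, ca x, mul_assoc, ← mul_assoc B, cb x, mul_assoc, mul_assoc, cb A]
    rw [mul_assoc _ (A * x)⁻¹, ← mul_inv_rev, h1, h2, mul_inv_rev]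
    group
  exact key _ _ _ _ (GlTilde.scalar_mul_comm a) (GlTilde.scalar_mul_comm b)

open Classical in
/-- The commutator `⟨S, T⟩ ∈ k^*` of two commuting elements of `Gl(V)`: the commutator of any two
lifts to the central extension (see `scalarCommutator_spec`). Elements which do not commute have no
commutator in `k^*`; for them the value is `1` by convention. -/
noncomputable def scalarCommutator {P : Submodule k V} (S T : Gl P) : kˣ :=
  if h : Commute S T then (exists_commutator h).choose else 1

lemma scalarCommutator_spec {P : Submodule k V} {S T : Gl P} (h : Commute S T) (x y : GlTilde P)
    (hx : GlTilde.proj P x = S) (hy : GlTilde.proj P y = T) :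
    x * y * x⁻¹ * y⁻¹ = GlTilde.scalar P (scalarCommutator S T) := by
  rw [scalarCommutator, dif_pos h]
  exact (exists_commutator h).choose_spec x y hx hy

open AlgebraicGeometry CategoryTheory RestrictedProduct

/-- A proper, irreducible, non singular algebraic curve over `k`. -/
structure ProperCurve (k : Type u) [Field k] where
  /-- the underlying scheme -/
  scheme : Scheme.{u}
  /-- the structure morphism -/
  str : scheme ⟶ Spec (CommRingCat.of k)
  isProper : IsProper str
  isIntegral : IsIntegral scheme
  dim_eq_one : topologicalKrullDim scheme = 1
  isRegular : ∀ x : scheme, IsRegularLocalRing (scheme.presheaf.stalk x)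

namespace ProperCurve

attribute [instance] isIntegral

variable {k : Type u} [Field k] (X : ProperCurve k)

/-- The closed points of `X`. -/
abbrev ClosedPoint : Type u := {x : X.scheme // IsClosed ({x} : Set X.scheme)}

/-- The local rings of `X` are `k`-algebras through the structure morphism. In particular, so is
the function field, the local ring at the generic point. -/
noncomputable instance (x : X.scheme) : Algebra k (X.scheme.presheaf.stalk x) :=
  RingHom.toAlgebra ((Scheme.ΓSpecIso (CommRingCat.of k)).inv ≫ X.str.appTop ≫
    X.scheme.presheaf.germ ⊤ x trivial).hom

/-- `A_x`, the completion of the local ring at `x`. -/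
abbrev CompletedLocalRing (x : X.ClosedPoint) : Type u :=
  AdicCompletion (IsLocalRing.maximalIdeal (X.scheme.presheaf.stalk x.1))
    (X.scheme.presheaf.stalk x.1)

/-- `K_x`, the field of fractions of `A_x`. -/
abbrev LocalField (x : X.ClosedPoint) : Type u := FractionRing (X.CompletedLocalRing x)

/-- `A_x` as a subalgebra of `K_x`. -/
noncomputable def localIntegers (x : X.ClosedPoint) : Subalgebra k (X.LocalField x) :=
  (IsScalarTower.toAlgHom k (X.CompletedLocalRing x) (X.LocalField x)).range

/-- `A_x` as a `k`-subspace of `K_x`. -/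
noncomputable abbrev localPlus (x : X.ClosedPoint) : Submodule k (X.LocalField x) :=
  (X.localIntegers x).toSubmodule

/-- The ring of adeles, the restricted product of the `K_x` with respect to the `A_x`. -/
abbrev Adeles : Type u := Πʳ x : X.ClosedPoint, [X.LocalField x, X.localIntegers x]

/-- The integral adeles `∏ A_x`, as a `k`-subspace of the adeles. -/
noncomputable def adelesPlus : Submodule k X.Adeles where
  carrier := {a | ∀ x, a x ∈ X.localPlus x}
  add_mem' ha hb x := add_mem (ha x) (hb x)
  zero_mem' _ := zero_mem _
  smul_mem' c _ ha x := Submodule.smul_mem _ c (ha x)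

end ProperCurve

end DetExt

open DetExt

/-! The proof is bilinear algebra with the commutator pairing. In a central extension the pairing is
multiplicative in each argument on commuting elements, and a single evaluation computes it: apply `x
* y` and `y * x` to one nonzero form at one level and compare the values
(`scalarCommutator_eq_of_rel`).

By commensurability there is a finite set `F` of points outside which both `S_x` and `T_x` preserve
`A_x`. For a set `Z` of points let `S_Z` act as `S` on the coordinates in `Z` and trivially
elsewhere; `exists_part` shows that `S_Z` stays in the group. Then `S` is the product of the `S_{x}`
for `x ∈ F` and of the part outside `F`, and likewise `T`. Three computations evaluate the resulting
pairings.

Parts outside `F` contribute `1`. Such a part preserves the integral adeles and fixes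
representatives, supported on `F`, of everything that the other automorphism moves
(`scalarCommutator_eq_one`).

Two parts at the same point `x` contribute `⟨S_x, T_x⟩`. The remaining integral coordinates lie in
both the top and the bottom of every determinant line involved, so they cancel
(`scalarCommutator_extend`).

Parts at distinct points `x` and `y` contribute `(-1) ^ (w_x(S) * w_y(T))`. The forms on the two
factors are independent, and only the signs from moving them past each other survive
(`scalarCommutator_disjoint`).

For fixed `x ∈ F` the signs over `y ≠ x` multiply to `-1` raised to `w_x(S)` times the sum of the
other `w_y(T)`. The local winding numbers of `T` add up to `w(T) = 0` (`windingNumber_eq_sum`), so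
that sum is `-w_x(T)`, and the sign is the one in the formula. -/

namespace DetExt

/-! ### Computing in the central extension with representatives in `⋀V` -/

section Lifts
variable {k : Type u} [Field k] {V : Type v} [AddCommGroup V] [Module k V] {P : Submodule k V}

/-- The projection `⋀V → ⋀(V/M)`. -/
noncomputable abbrev wedgeMkQ (M : Submodule k V) :
    ExteriorAlgebra k V →ₐ[k] ExteriorAlgebra k (V ⧸ M) :=
  ExteriorAlgebra.map M.mkQ

lemma map_factor_wedgeMkQ {M' M : Submodule k V} (h : M' ≤ M) (a : ExteriorAlgebra k V) :
    ExteriorAlgebra.map (Submodule.factor h) (wedgeMkQ M' a) = wedgeMkQ M a := by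
  rw [← AlgHom.comp_apply, ExteriorAlgebra.map_comp_map, Submodule.factor_comp_mk]

lemma shift_wedgeMkQ (S : V ≃ₗ[k] V) {M N : Submodule k V} (h : M.map (S : V →ₗ[k] V) = N)
    (a : ExteriorAlgebra k V) :
    shift S M N h (wedgeMkQ M a) = wedgeMkQ N (ExteriorAlgebra.map (S : V →ₗ[k] V) a) := by
  rw [shift, ← AlgHom.comp_apply, ← AlgHom.comp_apply, ExteriorAlgebra.map_comp_map,
    ExteriorAlgebra.map_comp_map]
  congr 2

lemma wedgeMkQ_mem_iff (S : V ≃ₗ[k] V) {M N A B : Submodule k V}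
    (h : M.map (S : V →ₗ[k] V) = N) (hA : A.map (S : V →ₗ[k] V) = B)
    {a : ExteriorAlgebra k V} : wedgeMkQ N (ExteriorAlgebra.map (S : V →ₗ[k] V) a) ∈ detLine N B ↔
      wedgeMkQ M a ∈ detLine M A := by
  rw [← map_shift S h hA, ← shift_wedgeMkQ S h]
  constructor
  · rintro ⟨b, hb, e⟩
    exact (shift_bijective S h).1 e ▸ hb
  · exact fun ha => ⟨_, ha, rfl⟩

/-- Change of level, in terms of lifts to `⋀V`. -/
lemma DetIso.Rel.refine {A B : Submodule k V} {σ : DetIso P A B} (hA : Commensurable A P)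
    {M M' : Submodule k V} (h : M' ≤ M) (hM' : Commensurable M' P) {a b μ : ExteriorAlgebra k V}
    (H : σ.Rel M (wedgeMkQ M a) (wedgeMkQ M b)) (hμ : wedgeMkQ M' μ ∈ detLine M' M) :
    σ.Rel M' (wedgeMkQ M' (μ * a)) (wedgeMkQ M' (μ * b)) := by
  obtain ⟨hl, ha, hb⟩ := H
  have hl' : IsLevel P A B M' := ⟨hM', h.trans hl.le_left, h.trans hl.le_right⟩
  have hmem : wedgeMkQ M' (μ * a) ∈ detLine M' A := by
    have := finite_of_level hA hM'
    rw [map_mul]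
    -- The zero form is set apart because `exists_refine` needs a generator of `∧(M/M')`.
    rcases eq_or_ne (wedgeMkQ M' μ) 0 with h0 | h0
    · rw [h0, zero_mul]; exact zero_mem _
    · obtain ⟨e, he⟩ := exists_refine h hl.le_left hμ h0
      rw [← he ⟨_, ha⟩ (wedgeMkQ M' a) (map_factor_wedgeMkQ h a).symm]
      exact Subtype.property _
  refine ⟨hl', hmem, ?_⟩
  rw [map_mul _ μ b]
  exact σ.compat hl hl' h _ hμ (wedgeMkQ M' a) _ ⟨_, ha⟩ _ (map_factor_wedgeMkQ h a).symm
    (hb.trans (map_factor_wedgeMkQ h b).symm) (map_mul _ _ _)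

lemma GlTilde.mul_rel_lift (x y : GlTilde P) {M N : Submodule k V}
    (h : M.map (x.toGl.1 : V →ₗ[k] V) = N) {a b c : ExteriorAlgebra k V}
    (h1 : x.iso.Rel N (wedgeMkQ N a)
      (wedgeMkQ N (ExteriorAlgebra.map (x.toGl.1 : V →ₗ[k] V) b)))
    (h2 : y.iso.Rel M (wedgeMkQ M b) (wedgeMkQ M c)) :
    (x * y).iso.Rel N (wedgeMkQ N a)
      (wedgeMkQ N (ExteriorAlgebra.map (x.toGl.1 : V →ₗ[k] V) c)) := by
  rw [← shift_wedgeMkQ _ h] at h1 ⊢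
  exact mul_rel x y h h1 h2

lemma GlTilde.eq_scalar_mul {x y : GlTilde P} (h : x.toGl = y.toGl) {M : Submodule k V} (c : kˣ)
    {a b : ExteriorAlgebra k (V ⧸ M)} (ha : a ≠ 0) (hx : x.iso.Rel M a ((c : k) • b))
    (hy : y.iso.Rel M a b) : x = GlTilde.scalar P c * y := by
  obtain ⟨hl, hm, -⟩ := id hy
  exact ext_of_rel (h.trans (one_mul _).symm) ha hx
    (scalarAux_mul_rel c y hl.comm hl.le_left hm hy)

lemma scalarCommutator_eq_of_mul_eq {S T : Gl P} (h : Commute S T) {x y : GlTilde P}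
    (hx : x.toGl = S) (hy : y.toGl = T) {c : kˣ} (e : x * y = GlTilde.scalar P c * (y * x)) :
    scalarCommutator S T = c := by
  apply GlTilde.scalar_injective (P := P)
  rw [← scalarCommutator_spec h x y hx hy, e]
  group

lemma mul_eq_scalarCommutator_mul {S T : Gl P} (h : Commute S T) {x y : GlTilde P}
    (hx : x.toGl = S) (hy : y.toGl = T) :
    x * y = GlTilde.scalar P (scalarCommutator S T) * (y * x) := by
  rw [← scalarCommutator_spec h x y hx hy]
  group

/-- Two lifts of the same automorphism differ by a scalar, and the determinant lines are one
dimensional, so the scalar can be read off from one nonzero form at one level. All explicit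
evaluations of the pairing rest on this criterion. -/
lemma scalarCommutator_eq_of_rel {S T : Gl P} (h : Commute S T) {x y : GlTilde P}
    (hx : x.toGl = S) (hy : y.toGl = T) {M : Submodule k V} (c : kˣ)
    {a b : ExteriorAlgebra k (V ⧸ M)} (ha : a ≠ 0) (hxy : (x * y).iso.Rel M a ((c : k) • b))
    (hyx : (y * x).iso.Rel M a b) : scalarCommutator S T = c := by
  refine scalarCommutator_eq_of_mul_eq h hx hy (GlTilde.eq_scalar_mul ?_ c ha hxy hyx)
  rw [GlTilde.mul_toGl, GlTilde.mul_toGl, hx, hy, h.eq]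

end Lifts

/-! ### Formal properties of the commutator pairing -/

section Pairing
variable {k : Type u} [Field k] {V : Type v} [AddCommGroup V] [Module k V] {P : Submodule k V}

lemma scalarCommutator_swap {S T : Gl P} (h : Commute S T) :
    scalarCommutator T S = (scalarCommutator S T)⁻¹ := by
  obtain ⟨x, hx⟩ := GlTilde.proj_surjective S
  obtain ⟨y, hy⟩ := GlTilde.proj_surjective T
  apply GlTilde.scalar_injective (P := P)
  rw [map_inv, ← scalarCommutator_spec h x y hx hy, ← scalarCommutator_spec h.symm y x hy hx]
  group

lemma scalarCommutator_mul_left {S S' T : Gl P} (h : Commute S T) (h' : Commute S' T) :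
    scalarCommutator (S * S') T = scalarCommutator S T * scalarCommutator S' T := by
  obtain ⟨x, hx⟩ := GlTilde.proj_surjective S
  obtain ⟨x', hx'⟩ := GlTilde.proj_surjective S'
  obtain ⟨y, hy⟩ := GlTilde.proj_surjective T
  apply GlTilde.scalar_injective (P := P)
  have e := scalarCommutator_spec (h.mul_left h') (x * x') y (by rw [map_mul, hx, hx']) hy
  rw [map_mul, ← e]
  -- The inner commutator is a scalar, hence central, and can be moved out of the conjugation by
  -- `x`.
  calc x * x' * y * (x * x')⁻¹ * y⁻¹ = x * (x' * y * x'⁻¹ * y⁻¹) * (y * x⁻¹ * y⁻¹) := by group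
    _ = _ := by
      rw [scalarCommutator_spec h' x' y hx' hy, ← GlTilde.scalar_mul_comm, mul_assoc,
        GlTilde.scalar_mul_comm, ← scalarCommutator_spec h x y hx hy]
      group

lemma scalarCommutator_mul_right {S T T' : Gl P} (h : Commute S T) (h' : Commute S T') :
    scalarCommutator S (T * T') = scalarCommutator S T * scalarCommutator S T' := by
  rw [scalarCommutator_swap (h.mul_right h').symm, scalarCommutator_mul_left h.symm h'.symm,
    mul_inv, ← scalarCommutator_swap h.symm, ← scalarCommutator_swap h'.symm]

lemma scalarCommutator_one_left (T : Gl P) : scalarCommutator 1 T = 1 := by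
  have := scalarCommutator_mul_left (Commute.one_left T) (Commute.one_left T)
  rw [mul_one] at this
  exact left_eq_mul.1 this

end Pairing

/-! ### Vanishing of the pairing when one automorphism fixes representatives -/

section Fixed
variable {k : Type u} [Field k] {V : Type v} [AddCommGroup V] [Module k V] {P : Submodule k V}

lemma map_wedge_pow (f : V →ₗ[k] V) (W : Submodule k V) (hf : ∀ w ∈ W, f w = w) (n : ℕ)
    {a : ExteriorAlgebra k V} (ha : a ∈ (W.map (ExteriorAlgebra.ι k)) ^ n) :
    ExteriorAlgebra.map f a = a := by
  induction ha using Submodule.pow_induction_on_left' with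
  | algebraMap r => exact AlgHom.commutes _ r
  | add x y i _ _ hx hy => rw [map_add, hx, hy]
  | mem_mul m hm i x _ hx =>
    obtain ⟨w, hw, rfl⟩ := hm
    rw [map_mul, hx, ExteriorAlgebra.map_apply_ι, hf w hw]

lemma map_pow_wedgeMkQ (M W : Submodule k V) (n : ℕ) :
    ((W.map (ExteriorAlgebra.ι k)) ^ n).map (wedgeMkQ M).toLinearMap =
      ((W.map M.mkQ).map (ExteriorAlgebra.ι k)) ^ n := by
  rw [Submodule.map_pow, ← Submodule.map_comp, ← Submodule.map_comp, ExteriorAlgebra.map_comp_ι]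

/-- Vectors of `M` vanish in `V/M`, so a top form on `A/M` only needs representatives from `W`. No
finiteness of `W` is required, which allows `W` to be the space of all families supported on a set
of indices. -/
lemma exists_lift_of_le {M A W : Submodule k V} (h : A ≤ W ⊔ M) {b : ExteriorAlgebra k (V ⧸ M)}
    (hb : b ∈ detLine M A) : ∃ n, ∃ a ∈ (W.map (ExteriorAlgebra.ι k)) ^ n, wedgeMkQ M a = b := by
  have hle : A.map M.mkQ ≤ W.map M.mkQ := by
    refine (Submodule.map_mono h).trans ?_
    rw [Submodule.map_sup, Submodule.mkQ_map_self, sup_bot_eq]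
  have := pow_le_pow_left' (Submodule.map_mono (f := ExteriorAlgebra.ι k) hle)
    (Module.finrank k (A.map M.mkQ)) hb
  rw [← map_pow_wedgeMkQ] at this
  exact ⟨_, this⟩

/-- If `S` stabilises `P` and acts trivially on representatives of `P` and of `T(P)` modulo
`P ∩ T(P)`, then `⟨S, T⟩ = 1`. -/
lemma scalarCommutator_eq_one {S T : Gl P} (hST : Commute S T)
    (hS : P.map (S.1 : V →ₗ[k] V) = P) (W : Submodule k V) (hW : ∀ w ∈ W, S.1 w = w)
    (h1 : P ≤ W ⊔ (P ⊓ P.map (T.1 : V →ₗ[k] V)))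
    (h2 : P.map (T.1 : V →ₗ[k] V) ≤ W ⊔ (P ⊓ P.map (T.1 : V →ₗ[k] V))) :
    scalarCommutator S T = 1 := by
  obtain ⟨y, rfl⟩ := GlTilde.proj_surjective T
  change Commute S y.toGl at hST
  change P ≤ W ⊔ (P ⊓ P.map (y.toGl.1 : V →ₗ[k] V)) at h1
  change P.map (y.toGl.1 : V →ₗ[k] V) ≤ W ⊔ (P ⊓ P.map (y.toGl.1 : V →ₗ[k] V)) at h2
  -- Since `S(P) = P`, the identity of `∧(P/M)` is a canonical lift of `S`.
  let x : GlTilde P := ⟨S, (DetIso.refl (Commensurable.refl P)).copy rfl hS.symm⟩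
  have hx : ∀ {M : Submodule k V} (_ : Commensurable M P) (_ : M ≤ P)
      {a : ExteriorAlgebra k (V ⧸ M)}, a ∈ detLine M P → x.iso.Rel M a a := fun hM hMP a ha =>
    (DetIso.rel_copy _ _ _ _ _ _).2 (DetIso.rel_refl _ ⟨hM, hMP, hMP⟩ ha)
  have hTS : (P.map (y.toGl.1 : V →ₗ[k] V)).map (S.1 : V →ₗ[k] V) =
      P.map (y.toGl.1 : V →ₗ[k] V) := by
    rw [GlTilde.map_map_mul, hST.eq, ← GlTilde.map_map_mul, hS]
  obtain ⟨M, hMdef⟩ : ∃ M, M = P ⊓ P.map (y.toGl.1 : V →ₗ[k] V) := ⟨_, rfl⟩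
  rw [← hMdef] at h1 h2
  have hM : Commensurable M P := hMdef ▸ (Commensurable.refl P).inf y.toGl.2.1
  have hMP : M ≤ P := hMdef ▸ inf_le_left
  have hMT : M ≤ P.map (y.toGl.1 : V →ₗ[k] V) := hMdef ▸ inf_le_right
  have hSM : M.map (S.1 : V →ₗ[k] V) = M := by
    rw [hMdef, Submodule.map_inf _ S.1.injective, hS, hTS]
  obtain ⟨a, ha, ha0⟩ := GlTilde.exists_ne_zero' hM
  obtain ⟨b, hb⟩ := y.iso.exists_rel ⟨hM, hMP, hMT⟩ ha
  have hbm := hb.right_mem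
  obtain ⟨n, a, haW, rfl⟩ := exists_lift_of_le h1 ha
  obtain ⟨m, b, hbW, rfl⟩ := exists_lift_of_le h2 hbm
  have hSa := map_wedge_pow (S.1 : V →ₗ[k] V) W hW n haW
  have hSb := map_wedge_pow (S.1 : V →ₗ[k] V) W hW m hbW
  -- Both `a` and `b` have been represented by products of vectors of `W`, so `S` fixes them and `x
  -- * y` sends `a` to `b`.
  have e1 := GlTilde.mul_rel_lift x y (M := M) (N := M) hSM (a := a) (b := a) (c := b)
    (by rw [hSa]; exact hx hM hMP ha) hb
  rw [hSb] at e1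
  obtain ⟨N, hN⟩ : ∃ N, N = M.map ((y.toGl⁻¹).1 : V →ₗ[k] V) := ⟨_, rfl⟩
  have hNM : N.map (y.toGl.1 : V →ₗ[k] V) = M := by rw [hN]; exact GlTilde.map_map_inv _ _
  have hNc : Commensurable N P := hN ▸ GlTilde.comm_map _ hM
  have hNP : N ≤ P := by
    rw [hN]
    refine (Submodule.map_mono hMT).trans ?_
    rw [GlTilde.map_inv_map]
  obtain ⟨d, hd⟩ : ∃ d, ExteriorAlgebra.map (y.toGl.1 : V →ₗ[k] V) d = b :=
    ExteriorAlgebra.map_surjective_iff.2 y.toGl.1.surjective b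
  have hdm : wedgeMkQ N d ∈ detLine N P := by
    rw [← hd] at hbm
    exact (wedgeMkQ_mem_iff y.toGl.1 hNM rfl).1 hbm
  -- In the other order `y` sends `a` to `b = T(d)`, the canonical lift `x` leaves `d` unchanged at
  -- the level `N = T⁻¹(M)`, and `T` brings it back to `b`.
  have e2 := GlTilde.mul_rel_lift y x (M := N) (N := M) hNM (a := a) (b := d) (c := d)
    (by rw [hd]; exact hb) (hx hNc hNP hdm)
  rw [hd] at e2
  exact scalarCommutator_eq_of_rel hST (x := x) (y := y) rfl rfl 1 ha0
    (by rw [Units.val_one, one_smul]; exact e1) e2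

end Fixed

/-! ### Cancellation, graded commutativity and degrees of forms -/

section Cancel
variable {k : Type u} [Field k] {V : Type v} [AddCommGroup V] [Module k V] {P : Submodule k V}

lemma DetIso.Rel.unique {A B : Submodule k V} {σ : DetIso P A B} {M : Submodule k V}
    {x y z : ExteriorAlgebra k (V ⧸ M)} (h : σ.Rel M x y) (h' : σ.Rel M x z) : y = z := by
  obtain ⟨_, _, rfl⟩ := h
  obtain ⟨_, _, rfl⟩ := h'
  rfl

/-- Multiplication by a generator of `∧(M/M')` is the isomorphism `∧(A/M) ≃ ∧(A/M')` of
`exists_refine`, hence injective. This allows a return from a finer level to a coarser one. -/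
lemma wedgeMkQ_mul_cancel {A M M' : Submodule k V} (h : M' ≤ M) (hA : M ≤ A)
    (hc : Commensurable A P) (hM' : Commensurable M' P) {μ a b : ExteriorAlgebra k V}
    (hμ : wedgeMkQ M' μ ∈ detLine M' M) (h0 : wedgeMkQ M' μ ≠ 0) (ha : wedgeMkQ M a ∈ detLine M A)
    (hb : wedgeMkQ M b ∈ detLine M A) (hab : wedgeMkQ M' (μ * a) = wedgeMkQ M' (μ * b)) :
    wedgeMkQ M a = wedgeMkQ M b := by
  have := DetIso.finite_of_level hc hM'
  obtain ⟨e, he⟩ := exists_refine h hA hμ h0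
  have h1 := he ⟨_, ha⟩ (wedgeMkQ M' a) (map_factor_wedgeMkQ h a).symm
  have h2 := he ⟨_, hb⟩ (wedgeMkQ M' b) (map_factor_wedgeMkQ h b).symm
  rw [← map_mul] at h1 h2
  exact congrArg Subtype.val (e.injective (Subtype.ext (h1.trans (hab.trans h2.symm))))

lemma wedgeMkQ_mul_ne_zero {A M M' : Submodule k V} (h : M' ≤ M) (hA : M ≤ A)
    (hc : Commensurable A P) (hM' : Commensurable M' P) {μ a : ExteriorAlgebra k V}
    (hμ : wedgeMkQ M' μ ∈ detLine M' M) (h0 : wedgeMkQ M' μ ≠ 0) (ha : wedgeMkQ M a ∈ detLine M A)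
    (ha0 : wedgeMkQ M a ≠ 0) : wedgeMkQ M' (μ * a) ≠ 0 := by
  intro h1
  refine ha0 ?_
  rw [wedgeMkQ_mul_cancel h hA hc hM' hμ h0 ha (b := 0) (by rw [map_zero]; exact zero_mem _)
    (by rw [h1, mul_zero, map_zero]), map_zero]

lemma wedgeMkQ_surjective (M : Submodule k V) : Function.Surjective (wedgeMkQ M) :=
  ExteriorAlgebra.map_surjective_iff.2 M.mkQ_surjective

/-- The representative is kept homogeneous of degree `dim A/M`; this degree governs the signs when
forms are interchanged. -/
lemma exists_lift_ne_zero {A M : Submodule k V} (hA : Commensurable A P)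
    (hM : Commensurable M P) :
    ∃ a ∈ (A.map (ExteriorAlgebra.ι k)) ^ Module.finrank k (A.map M.mkQ),
      wedgeMkQ M a ∈ detLine M A ∧ wedgeMkQ M a ≠ 0 := by
  have := DetIso.finite_of_level hA hM
  obtain ⟨b, hb, hb0⟩ := exists_ne_zero M A
  have hb' := hb
  rw [detLine, topWedge, ← map_pow_wedgeMkQ] at hb'
  obtain ⟨a, ha, rfl⟩ := hb'
  exact ⟨a, ha, hb, hb0⟩

lemma ι_mul_pow_comm (W : Submodule k V) (v : V) (n : ℕ) {a : ExteriorAlgebra k V}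
    (ha : a ∈ (W.map (ExteriorAlgebra.ι k)) ^ n) :
    ExteriorAlgebra.ι k v * a = (-1 : k) ^ n • (a * ExteriorAlgebra.ι k v) := by
  induction ha using Submodule.pow_induction_on_left' with
  | algebraMap r => rw [pow_zero, one_smul]; exact (Algebra.commutes r _).symm
  | add x y i _ _ hx hy => rw [mul_add, hx, hy, add_mul, smul_add]
  | mem_mul m hm i x _ hx =>
    obtain ⟨w, hw, rfl⟩ := hm
    rw [← mul_assoc, eq_neg_of_add_eq_zero_left (ExteriorAlgebra.ι_add_mul_swap v w), neg_mul,
      mul_assoc, hx, mul_smul_comm, pow_succ, mul_smul, neg_one_smul, smul_neg,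
      mul_assoc]

/-- Graded commutativity of the exterior algebra. -/
lemma pow_mul_pow_comm (W W' : Submodule k V) (m n : ℕ) {a b : ExteriorAlgebra k V}
    (ha : a ∈ (W.map (ExteriorAlgebra.ι k)) ^ m) (hb : b ∈ (W'.map (ExteriorAlgebra.ι k)) ^ n) :
    a * b = (-1 : k) ^ (m * n) • (b * a) := by
  induction ha using Submodule.pow_induction_on_left' with
  | algebraMap r => rw [zero_mul, pow_zero, one_smul]; exact Algebra.commutes r _
  | add x y i _ _ hx hy => rw [mul_add, add_mul, hx, hy, smul_add]
  | mem_mul m hm i x _ hx =>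
    obtain ⟨w, hw, rfl⟩ := hm
    rw [mul_assoc, hx, mul_smul_comm, ← mul_assoc, ι_mul_pow_comm W' w n hb, smul_mul_assoc,
      smul_smul, ← pow_add, mul_assoc, Nat.succ_mul]

lemma finrank_quot_submoduleOf (X Y : Submodule k V) :
    Module.finrank k (↥X ⧸ Y.submoduleOf X) = Module.finrank k (X.map Y.mkQ) := by
  have e := (Y.mkQ.domRestrict X).quotKerEquivRange
  have h1 : LinearMap.ker (Y.mkQ.domRestrict X) = Y.submoduleOf X := by
    rw [LinearMap.ker_domRestrict, Submodule.ker_mkQ, Submodule.submoduleOf]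
  have h2 : LinearMap.range (Y.mkQ.domRestrict X) = X.map Y.mkQ := by
    rw [LinearMap.range_domRestrict]
  rw [h1, h2] at e
  exact e.finrank_eq

/-- In this form the winding number is a difference of degrees of top forms over `P ∩ S(P)`, which
is how it enters the signs. -/
lemma windingNumber_eq (S : Gl P) : windingNumber S =
    (Module.finrank k (P.map (P ⊓ P.map (S.1 : V →ₗ[k] V)).mkQ) : ℤ) -
      (Module.finrank k ((P.map (S.1 : V →ₗ[k] V)).map (P ⊓ P.map (S.1 : V →ₗ[k] V)).mkQ) : ℤ) := by
  rw [windingNumber, finrank_quot_submoduleOf, finrank_quot_submoduleOf]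

lemma commensurable_of_le {A B F F' : Submodule k V} [hF : FiniteDimensional k F]
    [hF' : FiniteDimensional k F'] (h : A ≤ B ⊔ F) (h' : B ≤ A ⊔ F') : Commensurable A B :=
  commensurable_iff.2 ⟨(finite_map_iff _ _).2 ⟨F, hF, h⟩, (finite_map_iff _ _).2 ⟨F', hF', h'⟩⟩

end Cancel

/-! ### Extension by the identity on a complementary lattice -/

section Extend
variable {k : Type u} [Field k] {U V : Type v} [AddCommGroup U] [Module k U] [AddCommGroup V]
  [Module k V]

/-- The subspace `i(A) + Q`. -/
def extend (i : U →ₗ[k] V) (Q : Submodule k V) (A : Submodule k U) : Submodule k V := A.map i ⊔ Q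

/-- `i : U → V` is a split inclusion, and `Q` is contained in a complement of `i(U)`. -/
structure IsSplit (i : U →ₗ[k] V) (p : V →ₗ[k] U) (Q : Submodule k V) : Prop where
  left_inv : ∀ u, p (i u) = u
  apply_eq_zero : ∀ v ∈ Q, p v = 0

variable (i : U →ₗ[k] V) {p : V →ₗ[k] U} (Q : Submodule k V) {P₁ : Submodule k U}

lemma extend_mono {A B : Submodule k U} (h : A ≤ B) : extend i Q A ≤ extend i Q B :=
  sup_le_sup_right (Submodule.map_mono h) Q

lemma Commensurable.extend {A B : Submodule k U} (h : Commensurable A B) :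
    Commensurable (extend i Q A) (extend i Q B) := by
  have key : ∀ {A B : Submodule k U}, FiniteDimensional k (A.map B.mkQ) →
      FiniteDimensional k ((DetExt.extend i Q A).map (DetExt.extend i Q B).mkQ) := by
    intro A B h
    rw [finite_map_iff] at *
    obtain ⟨F, _, hF⟩ := h
    refine ⟨F.map i, inferInstance, sup_le ?_ (le_sup_of_le_left le_sup_right)⟩
    refine (Submodule.map_mono hF).trans ((Submodule.map_sup _ _ _).le.trans ?_)
    exact sup_le_sup_right le_sup_left _
  rw [commensurable_iff] at *
  exact ⟨key h.1, key h.2⟩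

lemma map_extend (f : V →ₗ[k] V) (g : U →ₗ[k] U) (hf : ∀ u, f (i u) = i (g u))
    (hQ : ∀ v ∈ Q, f v = v) (A : Submodule k U) :
    (extend i Q A).map f = extend i Q (A.map g) := by
  rw [extend, extend, Submodule.map_sup, ← Submodule.map_comp, ← Submodule.map_comp,
    show f ∘ₗ i = i ∘ₗ g from LinearMap.ext hf]
  congr 1
  ext v
  constructor
  · rintro ⟨w, hw, rfl⟩
    rwa [hQ w hw]
  · exact fun hv => ⟨v, hv, hQ v hv⟩

/-- The map `U/M → V/(i(M) + Q)` induced by `i`. -/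
def extendQuot (M : Submodule k U) : (U ⧸ M) →ₗ[k] (V ⧸ extend i Q M) :=
  M.mapQ _ i (Submodule.map_le_iff_le_comap.1 le_sup_left)

variable {i Q}

/-- If `i u = i m + q`, then applying `p` gives `u = m`: the retraction kills the contribution of
`Q`. -/
lemma extendQuot_injective (h : IsSplit i p Q) (M : Submodule k U) :
    Function.Injective (extendQuot i Q M) := by
  rw [← LinearMap.ker_eq_bot, LinearMap.ker_eq_bot']
  intro m hm
  obtain ⟨u, rfl⟩ := Submodule.mkQ_surjective _ m
  have hm : Submodule.Quotient.mk (i u) = (0 : V ⧸ extend i Q M) := hm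
  rw [Submodule.Quotient.mk_eq_zero, extend, Submodule.mem_sup] at hm
  obtain ⟨_, ⟨m, hm, rfl⟩, q, hq, e⟩ := hm
  have := congrArg p e
  rw [map_add, h.left_inv, h.apply_eq_zero q hq, add_zero, h.left_inv] at this
  rw [← this]
  exact (Submodule.Quotient.mk_eq_zero _).2 hm

lemma extendQuot_comp_mkQ (M : Submodule k U) :
    extendQuot i Q M ∘ₗ M.mkQ = (extend i Q M).mkQ ∘ₗ i := rfl

lemma map_extendQuot (M A : Submodule k U) :
    (A.map M.mkQ).map (extendQuot i Q M) = (extend i Q A).map (extend i Q M).mkQ := by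
  rw [← Submodule.map_comp, extendQuot_comp_mkQ, Submodule.map_comp, extend, extend,
    Submodule.map_sup, eq_comm, sup_eq_left]
  refine le_trans (b := ⊥) ?_ bot_le
  rw [Submodule.map_le_iff_le_comap, ← LinearMap.ker, Submodule.ker_mkQ]
  exact le_sup_right

lemma extendQuot_wedgeMkQ (M : Submodule k U) (a : ExteriorAlgebra k U) :
    ExteriorAlgebra.map (extendQuot i Q M) (wedgeMkQ M a) =
      wedgeMkQ (extend i Q M) (ExteriorAlgebra.map i a) := by
  rw [← AlgHom.comp_apply, ← AlgHom.comp_apply, ExteriorAlgebra.map_comp_map,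
    ExteriorAlgebra.map_comp_map, extendQuot_comp_mkQ]

/-- The space `Q` lies in both `i(A) + Q` and `i(M) + Q`, so it drops out of the quotient and only
the copy of `A/M` is left. -/
lemma detLine_extend (h : IsSplit i p Q) (M A : Submodule k U) :
    detLine (extend i Q M) (extend i Q A) =
      (detLine M A).map (ExteriorAlgebra.map (extendQuot i Q M)).toLinearMap := by
  rw [detLine, ← map_extendQuot, topWedge_map _ (extendQuot_injective h M), detLine]

lemma wedgeMkQ_extend_mem (h : IsSplit i p Q) {M A : Submodule k U} {a : ExteriorAlgebra k U}
    (ha : wedgeMkQ M a ∈ detLine M A) :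
    wedgeMkQ (extend i Q M) (ExteriorAlgebra.map i a) ∈
      detLine (extend i Q M) (extend i Q A) := by
  rw [detLine_extend h, ← extendQuot_wedgeMkQ]
  exact ⟨_, ha, rfl⟩

lemma wedgeMkQ_extend_ne_zero (h : IsSplit i p Q) {M : Submodule k U} {a : ExteriorAlgebra k U}
    (ha : wedgeMkQ M a ≠ 0) : wedgeMkQ (extend i Q M) (ExteriorAlgebra.map i a) ≠ 0 := by
  rw [← extendQuot_wedgeMkQ]
  intro h0
  refine ha (ExteriorAlgebra.map_injective_field
    (LinearMap.ker_eq_bot.2 (extendQuot_injective h M)) ?_)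
  rw [h0, map_zero]

lemma exists_lift_extend (h : IsSplit i p Q) {M A : Submodule k U}
    {b : ExteriorAlgebra k (V ⧸ extend i Q M)}
    (hb : b ∈ detLine (extend i Q M) (extend i Q A)) :
    ∃ a ∈ (A.map (ExteriorAlgebra.ι k)) ^ Module.finrank k (A.map M.mkQ),
      wedgeMkQ M a ∈ detLine M A ∧ wedgeMkQ (extend i Q M) (ExteriorAlgebra.map i a) = b := by
  rw [detLine_extend h] at hb
  obtain ⟨c, hc, rfl⟩ := hb
  have hc' : c ∈ detLine M A := hc
  rw [detLine, topWedge, ← map_pow_wedgeMkQ] at hc'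
  obtain ⟨a, ha, rfl⟩ := hc'
  exact ⟨a, ha, hc, (extendQuot_wedgeMkQ M a).symm⟩

lemma wedgeMkQ_extend_eq {M : Submodule k U} {a b : ExteriorAlgebra k U}
    (hab : wedgeMkQ M a = wedgeMkQ M b) :
    wedgeMkQ (extend i Q M) (ExteriorAlgebra.map i a) =
      wedgeMkQ (extend i Q M) (ExteriorAlgebra.map i b) := by
  rw [← extendQuot_wedgeMkQ, ← extendQuot_wedgeMkQ, hab]

lemma wedge_map_map (f : V →ₗ[k] V) (g : U →ₗ[k] U) (hf : ∀ u, f (i u) = i (g u))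
    (a : ExteriorAlgebra k U) : ExteriorAlgebra.map f (ExteriorAlgebra.map i a) =
      ExteriorAlgebra.map i (ExteriorAlgebra.map g a) := by
  rw [← AlgHom.comp_apply, ← AlgHom.comp_apply, ExteriorAlgebra.map_comp_map,
    ExteriorAlgebra.map_comp_map, show f ∘ₗ i = i ∘ₗ g from LinearMap.ext hf]

/-- A lift of `S₁ ∈ Gl(U)` to the central extension determines a lift of an extension of `S₁`
to `V` which is the identity on `Q`. -/
lemma exists_transfer (h : IsSplit i p Q) (x₁ : GlTilde P₁) (S : Gl (extend i Q P₁))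
    (hS : ∀ u, S.1 (i u) = i (x₁.toGl.1 u)) (hQ : ∀ v ∈ Q, S.1 v = v) :
    ∃ x : GlTilde (extend i Q P₁), x.toGl = S ∧ ∀ (M : Submodule k U) (a b : ExteriorAlgebra k U),
      x₁.iso.Rel M (wedgeMkQ M a) (wedgeMkQ M b) →
      x.iso.Rel (extend i Q M) (wedgeMkQ _ (ExteriorAlgebra.map i a))
        (wedgeMkQ _ (ExteriorAlgebra.map i b)) := by
  have hSP : (extend i Q P₁).map (S.1 : V →ₗ[k] V) =
      extend i Q (P₁.map (x₁.toGl.1 : U →ₗ[k] U)) := map_extend i Q _ _ hS hQ _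
  let M₀ := P₁ ⊓ P₁.map (x₁.toGl.1 : U →ₗ[k] U)
  have hM₀ : Commensurable M₀ P₁ := (Commensurable.refl P₁).inf x₁.toGl.2.1
  have hl₀ : IsLevel P₁ P₁ (P₁.map (x₁.toGl.1 : U →ₗ[k] U)) M₀ := ⟨hM₀, inf_le_left, inf_le_right⟩
  obtain ⟨a₀, -, ha₀, ha₀'⟩ := exists_lift_ne_zero (Commensurable.refl P₁) hM₀
  obtain ⟨b₀, hb₀⟩ := x₁.iso.exists_rel hl₀ ha₀
  obtain ⟨b₀, rfl⟩ := wedgeMkQ_surjective M₀ b₀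
  have hlev : ∀ {M}, IsLevel P₁ P₁ (P₁.map (x₁.toGl.1 : U →ₗ[k] U)) M →
      IsLevel (extend i Q P₁) (extend i Q P₁) ((extend i Q P₁).map (S.1 : V →ₗ[k] V))
        (extend i Q M) := fun hM =>
    ⟨hM.comm.extend i Q, extend_mono i Q hM.le_left, hSP ▸ extend_mono i Q hM.le_right⟩
  obtain ⟨x, hxS, hx₀⟩ : ∃ x : GlTilde (extend i Q P₁), x.toGl = S ∧
      x.iso.Rel (extend i Q M₀) (wedgeMkQ _ (ExteriorAlgebra.map i a₀))
        (wedgeMkQ _ (ExteriorAlgebra.map i b₀)) := by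
    -- Start from an arbitrary lift of `S` and rescale it, so that it agrees with `x₁` on the
    -- reference form `a₀` at the reference level `M₀`.
    obtain ⟨x, rfl⟩ := GlTilde.proj_surjective S
    have hmem := wedgeMkQ_extend_mem h ha₀
    obtain ⟨z, hz⟩ := x.iso.exists_rel (hlev hl₀) hmem
    have hz0 := hz.ne_zero (wedgeMkQ_extend_ne_zero h ha₀')
    have hb := wedgeMkQ_extend_mem h hb₀.right_mem
    rw [← hSP] at hb
    have := DetIso.finite_of_level x.toGl.2.1 (hlev hl₀).comm
    obtain ⟨c, hc⟩ := exists_smul hz.right_mem hz0 hb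
    have hc0 : c ≠ 0 := by
      rintro rfl
      rw [zero_smul] at hc
      exact wedgeMkQ_extend_ne_zero h (hb₀.ne_zero ha₀') hc
    refine ⟨GlTilde.scalarAux (Units.mk0 c hc0) * x, one_mul _, ?_⟩
    rw [hc]
    exact GlTilde.scalarAux_mul_rel _ x (hlev hl₀).comm (hlev hl₀).le_left hmem hz
  subst hxS
  refine ⟨x, rfl, fun M a b H => ?_⟩
  obtain ⟨hl, ha, -⟩ := id H
  -- An arbitrary level `M` is compared with `M₀` through their intersection, where both forms lie
  -- on the same line.
  let N := M ⊓ M₀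
  have hN : Commensurable N P₁ := hl.comm.inf hM₀
  have hlN : IsLevel P₁ P₁ (P₁.map (x₁.toGl.1 : U →ₗ[k] U)) N :=
    ⟨hN, inf_le_left.trans hl.le_left, inf_le_left.trans hl.le_right⟩
  obtain ⟨ν, -, hν, hν0⟩ := exists_lift_ne_zero hM₀ hN
  obtain ⟨μ, -, hμ, hμ0⟩ := exists_lift_ne_zero hl.comm hN
  have r1 := hb₀.refine (Commensurable.refl _) (inf_le_right : N ≤ M₀) hN hν
  have r2 := H.refine (Commensurable.refl _) (inf_le_left : N ≤ M) hN hμ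
  have n1 := wedgeMkQ_mul_ne_zero (inf_le_right : N ≤ M₀) hl₀.le_left (Commensurable.refl _) hN
    hν hν0 ha₀ ha₀'
  have := DetIso.finite_of_level (Commensurable.refl P₁) hN
  have m1 : wedgeMkQ N (ν * a₀) ∈ detLine N P₁ := by obtain ⟨_, hm, -⟩ := r1; exact hm
  have m2 : wedgeMkQ N (μ * a) ∈ detLine N P₁ := by obtain ⟨_, hm, -⟩ := r2; exact hm
  -- The scalar relating the refined forms `μ * a` and `ν * a₀` also relates their images under
  -- `x₁`. The two relations can then be carried over to `V`.
  obtain ⟨c, hc⟩ := exists_smul m1 n1 m2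
  have hc' : wedgeMkQ N (μ * b) = c • wedgeMkQ N (ν * b₀) := by
    have := r1.smul_both c
    rw [← hc] at this
    exact r2.unique this
  rw [← map_smul] at hc hc'
  have s1 := hx₀.refine (Commensurable.refl _) (extend_mono i Q (inf_le_right : N ≤ M₀))
    (hlev hlN).comm (wedgeMkQ_extend_mem h hν)
  have s2 := s1.smul_both c
  rw [← map_mul, ← map_mul, ← map_smul, ← map_smul, ← map_smul, ← map_smul,
    ← wedgeMkQ_extend_eq hc, ← wedgeMkQ_extend_eq hc', map_mul (ExteriorAlgebra.map i),
    map_mul (ExteriorAlgebra.map i)] at s2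
  obtain ⟨z, hz⟩ := x.iso.exists_rel (hlev hl) (wedgeMkQ_extend_mem h ha)
  obtain ⟨z, rfl⟩ := wedgeMkQ_surjective _ z
  have s3 := hz.refine (Commensurable.refl _) (extend_mono i Q (inf_le_left : N ≤ M))
    (hlev hlN).comm (wedgeMkQ_extend_mem h hμ)
  have hb := wedgeMkQ_extend_mem h H.right_mem
  rw [← hSP] at hb
  -- At the finer level the unknown value `z` and the image of `b` agree after multiplication by the
  -- image of `μ`; cancelling it shows that they agree at the level of `M`.
  rw [wedgeMkQ_mul_cancel (extend_mono i Q (inf_le_left : N ≤ M)) (hlev hl).le_right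
    x.toGl.2.1 (hlev hlN).comm (wedgeMkQ_extend_mem h hμ) (wedgeMkQ_extend_ne_zero h hμ0)
    hb hz.right_mem (s2.unique s3)]
  exact hz

/-- The commutator pairing is compatible with extension by the identity. -/
lemma scalarCommutator_extend {P : Submodule k V} (h : IsSplit i p Q) (hP : P = extend i Q P₁)
    {S₁ T₁ : Gl P₁} (hST₁ : Commute S₁ T₁) {S T : Gl P} (hST : Commute S T)
    (hS : ∀ u, S.1 (i u) = i (S₁.1 u)) (hSQ : ∀ v ∈ Q, S.1 v = v)
    (hT : ∀ u, T.1 (i u) = i (T₁.1 u)) (hTQ : ∀ v ∈ Q, T.1 v = v) :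
    scalarCommutator S T = scalarCommutator S₁ T₁ := by
  subst hP
  obtain ⟨x₁, rfl⟩ := GlTilde.proj_surjective S₁
  obtain ⟨y₁, rfl⟩ := GlTilde.proj_surjective T₁
  obtain ⟨x, rfl, hx⟩ := exists_transfer h x₁ S hS hSQ
  obtain ⟨y, rfl, hy⟩ := exists_transfer h y₁ T hT hTQ
  -- Transfer is compatible with products. The claim is stated for arbitrary pairs because it is
  -- applied to both orders of the factors.
  have key : ∀ (x₁ y₁ : GlTilde P₁) (x y : GlTilde (extend i Q P₁)),
      (∀ u, x.toGl.1 (i u) = i (x₁.toGl.1 u)) → (∀ v ∈ Q, x.toGl.1 v = v) →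
      (∀ (M : Submodule k U) (a b : ExteriorAlgebra k U),
        x₁.iso.Rel M (wedgeMkQ M a) (wedgeMkQ M b) →
        x.iso.Rel (extend i Q M) (wedgeMkQ _ (ExteriorAlgebra.map i a))
          (wedgeMkQ _ (ExteriorAlgebra.map i b))) →
      (∀ (M : Submodule k U) (a b : ExteriorAlgebra k U),
        y₁.iso.Rel M (wedgeMkQ M a) (wedgeMkQ M b) →
        y.iso.Rel (extend i Q M) (wedgeMkQ _ (ExteriorAlgebra.map i a))
          (wedgeMkQ _ (ExteriorAlgebra.map i b))) →
      ∀ (M : Submodule k U), Commensurable M P₁ → M ≤ P₁ → M ≤ P₁.map (x₁.toGl.1 : U →ₗ[k] U) →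
        M ≤ P₁.map ((x₁.toGl * y₁.toGl).1 : U →ₗ[k] U) →
        ∀ a, wedgeMkQ M a ∈ detLine M P₁ →
        ∃ d, (x₁ * y₁).iso.Rel M (wedgeMkQ M a) (wedgeMkQ M d) ∧
          (x * y).iso.Rel (extend i Q M) (wedgeMkQ _ (ExteriorAlgebra.map i a))
            (wedgeMkQ _ (ExteriorAlgebra.map i d)) := by
    intro x₁ y₁ x y hS hSQ hx hy M hM hMP hMS hMST a ha
    obtain ⟨b', hb⟩ := x₁.iso.exists_rel ⟨hM, hMP, hMS⟩ ha
    obtain ⟨b', rfl⟩ := wedgeMkQ_surjective M b'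
    obtain ⟨b, rfl⟩ := ExteriorAlgebra.map_surjective_iff.2 x₁.toGl.1.surjective b'
    obtain ⟨N, hNdef⟩ : ∃ N, N = M.map ((x₁.toGl⁻¹).1 : U →ₗ[k] U) := ⟨_, rfl⟩
    have hN : Commensurable N P₁ := hNdef ▸ GlTilde.comm_map _ hM
    have hNM : N.map (x₁.toGl.1 : U →ₗ[k] U) = M := by
      rw [hNdef]; exact GlTilde.map_map_inv _ _
    have hNP : N ≤ P₁ := by
      rw [hNdef]
      refine (Submodule.map_mono hMS).trans ?_
      rw [GlTilde.map_inv_map]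
    have hNT : N ≤ P₁.map (y₁.toGl.1 : U →ₗ[k] U) := by
      rw [hNdef]
      refine (Submodule.map_mono hMST).trans ?_
      rw [← GlTilde.map_map_mul, GlTilde.map_inv_map]
    have hbm : wedgeMkQ N b ∈ detLine N P₁ :=
      (wedgeMkQ_mem_iff x₁.toGl.1 hNM rfl).1 hb.right_mem
    obtain ⟨c, hc⟩ := y₁.iso.exists_rel ⟨hN, hNP, hNT⟩ hbm
    obtain ⟨c, rfl⟩ := wedgeMkQ_surjective N c
    refine ⟨_, GlTilde.mul_rel_lift x₁ y₁ hNM hb hc, ?_⟩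
    have hNM' : (extend i Q N).map (x.toGl.1 : V →ₗ[k] V) = extend i Q M := by
      rw [map_extend i Q _ (x₁.toGl.1 : U →ₗ[k] U) hS hSQ, hNM]
    rw [← wedge_map_map _ _ hS]
    refine GlTilde.mul_rel_lift x y hNM' ?_ (hy _ _ _ hc)
    rw [wedge_map_map _ _ hS]
    exact hx _ _ _ hb
  -- This level is contained in every lattice met along either product, so `x₁ * y₁` and `y₁ * x₁`
  -- can be evaluated on the same form.
  let M := P₁ ⊓ P₁.map (x₁.toGl.1 : U →ₗ[k] U) ⊓ P₁.map (y₁.toGl.1 : U →ₗ[k] U) ⊓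
    P₁.map ((x₁.toGl * y₁.toGl).1 : U →ₗ[k] U)
  have hM : Commensurable M P₁ := (((Commensurable.refl P₁).inf x₁.toGl.2.1).inf
    y₁.toGl.2.1).inf (x₁.toGl * y₁.toGl).2.1
  have l1 : M ≤ P₁ := inf_le_left.trans (inf_le_left.trans inf_le_left)
  have l2 : M ≤ P₁.map (x₁.toGl.1 : U →ₗ[k] U) :=
    inf_le_left.trans (inf_le_left.trans inf_le_right)
  have l3 : M ≤ P₁.map (y₁.toGl.1 : U →ₗ[k] U) := inf_le_left.trans inf_le_right
  have l4 : M ≤ P₁.map ((x₁.toGl * y₁.toGl).1 : U →ₗ[k] U) := inf_le_right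
  have hcomm : x₁.toGl * y₁.toGl = y₁.toGl * x₁.toGl := hST₁
  obtain ⟨a, -, ha, ha0⟩ := exists_lift_ne_zero (Commensurable.refl P₁) hM
  obtain ⟨d, hd1, hd2⟩ := key x₁ y₁ x y hS hSQ hx hy M hM l1 l2 l4 a ha
  obtain ⟨e, he1, he2⟩ := key y₁ x₁ y x hT hTQ hy hx M hM l1 l3 (hcomm ▸ l4) a ha
  have hde : wedgeMkQ M d =
      wedgeMkQ M ((scalarCommutator (GlTilde.proj P₁ x₁) (GlTilde.proj P₁ y₁) : k) • e) := by
    rw [mul_eq_scalarCommutator_mul hST₁ rfl rfl] at hd1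
    rw [map_smul]
    exact hd1.unique (GlTilde.scalarAux_mul_rel _ _ hM l1 ha he1)
  refine scalarCommutator_eq_of_rel hST rfl rfl _ (wedgeMkQ_extend_ne_zero h ha0) ?_ he2
  rw [← map_smul, ← map_smul, ← wedgeMkQ_extend_eq hde]
  exact hd2

end Extend

/-! ### Automorphisms acting on independent factors -/

section Disjoint
variable {k : Type u} [Field k] {U U' V : Type v} [AddCommGroup U] [Module k U]
  [AddCommGroup U'] [Module k U'] [AddCommGroup V] [Module k V]
  {i : U →ₗ[k] V} {p : V →ₗ[k] U} {j : U' →ₗ[k] V} {p' : V →ₗ[k] U'} {Q : Submodule k V}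
  {P₁ : Submodule k U} {P₂ : Submodule k U'}

lemma IsSplit.extend (h : IsSplit i p Q) (hj : ∀ u, p (j u) = 0) (B : Submodule k U') :
    IsSplit i p (extend j Q B) := by
  refine ⟨h.left_inv, fun v hv => ?_⟩
  rw [DetExt.extend, Submodule.mem_sup] at hv
  obtain ⟨_, ⟨w, -, rfl⟩, q, hq, rfl⟩ := hv
  rw [map_add, hj, h.apply_eq_zero q hq, add_zero]

lemma extend_comm (A : Submodule k U) (B : Submodule k U') :
    extend j (extend i Q A) B = extend i (extend j Q B) A := by
  rw [extend, extend, extend, extend, sup_left_comm]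

lemma map_wedge_mem_pow (f : U →ₗ[k] V) (A : Submodule k U) (n : ℕ) {a : ExteriorAlgebra k U}
    (ha : a ∈ (A.map (ExteriorAlgebra.ι k)) ^ n) :
    ExteriorAlgebra.map f a ∈ ((A.map f).map (ExteriorAlgebra.ι k)) ^ n := by
  have h : (A.map f).map (ExteriorAlgebra.ι k) =
      (A.map (ExteriorAlgebra.ι k)).map (ExteriorAlgebra.map f).toLinearMap := by
    rw [← Submodule.map_comp, ← Submodule.map_comp, ExteriorAlgebra.map_comp_ι]
  rw [h, ← Submodule.map_pow]
  exact ⟨a, ha, rfl⟩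

lemma exists_wedge_preimage (T : U' ≃ₗ[k] U') {M N A : Submodule k U'}
    (h : M.map (T : U' →ₗ[k] U') = N) {b : ExteriorAlgebra k U'}
    (hb : wedgeMkQ N b ∈ detLine N (A.map (T : U' →ₗ[k] U'))) :
    ∃ c, ExteriorAlgebra.map (T : U' →ₗ[k] U') c = b ∧ wedgeMkQ M c ∈ detLine M A := by
  obtain ⟨c, rfl⟩ := ExteriorAlgebra.map_surjective_iff.2 T.surjective b
  exact ⟨c, rfl, (wedgeMkQ_mem_iff T h rfl).1 hb⟩

/-- The target line comes from `W`, so the value has a homogeneous representative from `W` of known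
degree. This makes the later sign count possible. -/
lemma exists_rel_extend {W : Type v} [AddCommGroup W] [Module k W] {i : W →ₗ[k] V}
    {p : V →ₗ[k] W} {Q P : Submodule k V} (h : IsSplit i p Q) {P₀ A M : Submodule k W}
    (hP : extend i Q P₀ = P) {B : Submodule k V} (hB : B = extend i Q A) (σ : DetIso P P B)
    (hM : Commensurable M P₀) (hMP : M ≤ P₀) (hMA : M ≤ A) {a : ExteriorAlgebra k W}
    (ha : wedgeMkQ M a ∈ detLine M P₀) :
    ∃ b ∈ (A.map (ExteriorAlgebra.ι k)) ^ Module.finrank k (A.map M.mkQ),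
      wedgeMkQ M b ∈ detLine M A ∧ σ.Rel (extend i Q M)
        (wedgeMkQ _ (ExteriorAlgebra.map i a)) (wedgeMkQ _ (ExteriorAlgebra.map i b)) := by
  subst hP hB
  obtain ⟨z, hz⟩ := σ.exists_rel ⟨hM.extend i Q, extend_mono i Q hMP, extend_mono i Q hMA⟩
    (wedgeMkQ_extend_mem h ha)
  obtain ⟨b, hb, hbm, rfl⟩ := exists_lift_extend h hz.right_mem
  exact ⟨b, hb, hbm, hz⟩

lemma neg_one_zpow_eq (R : Type*) [Ring R] {m n : ℤ} (h : Even (m - n)) :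
    (-1 : Rˣ) ^ m = (-1) ^ n := by
  rw [← sub_add_cancel m n, zpow_add, h.neg_one_zpow, one_mul]

lemma neg_one_zpow_mul_neg_one_pow (R : Type*) [Ring R] (a a' b b' : ℕ) :
    (((-1 : Rˣ) ^ (((a : ℤ) - a') * ((b : ℤ) - b')) : Rˣ) : R) * (-1) ^ (a * b') =
      (-1) ^ (a * b + a' * b) * (-1) ^ (a' * b') := by
  have h : (-1 : Rˣ) ^ (((a : ℤ) - a') * ((b : ℤ) - b')) * (-1) ^ ((a * b' : ℕ) : ℤ) =
      (-1) ^ ((a * b + a' * b : ℕ) : ℤ) * (-1) ^ ((a' * b' : ℕ) : ℤ) := by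
    rw [← zpow_add, ← zpow_add]
    -- Expanding both exponents, everything cancels except `-2 * a' * b`.
    refine neg_one_zpow_eq R ⟨-((a' : ℤ) * b), ?_⟩
    push_cast
    ring
  rw [zpow_natCast, zpow_natCast, zpow_natCast] at h
  have := congrArg Units.val h
  push_cast at this
  exact this

/-- The commutator of two automorphisms with disjoint supports is a sign. -/
lemma scalarCommutator_disjoint {P : Submodule k V} (hi : IsSplit i p Q) (hj : IsSplit j p' Q)
    (hpj : ∀ u, p (j u) = 0) (hpi : ∀ u, p' (i u) = 0)
    (hP : P = extend i (extend j Q P₂) P₁) {S₁ : Gl P₁} {T₂ : Gl P₂} {S T : Gl P}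
    (hST : Commute S T)
    (hSi : ∀ u, S.1 (i u) = i (S₁.1 u)) (hSj : ∀ u, S.1 (j u) = j u) (hSQ : ∀ v ∈ Q, S.1 v = v)
    (hTi : ∀ u, T.1 (i u) = i u) (hTj : ∀ u, T.1 (j u) = j (T₂.1 u)) (hTQ : ∀ v ∈ Q, T.1 v = v) :
    scalarCommutator S T = (-1) ^ (windingNumber S₁ * windingNumber T₂) := by
  obtain ⟨x, rfl⟩ := GlTilde.proj_surjective S
  obtain ⟨y, rfl⟩ := GlTilde.proj_surjective T
  change ∀ u, x.toGl.1 (i u) = _ at hSi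
  change ∀ u, x.toGl.1 (j u) = _ at hSj
  change ∀ v ∈ Q, x.toGl.1 v = _ at hSQ
  change ∀ u, y.toGl.1 (i u) = _ at hTi
  change ∀ u, y.toGl.1 (j u) = _ at hTj
  change ∀ v ∈ Q, y.toGl.1 v = _ at hTQ
  have hI := fun B : Submodule k U' => hi.extend hpj B
  have hJ := fun A : Submodule k U => hj.extend hpi A
  -- `L A B` is `i(A) + j(B) + Q`. An opaque name lets the same space be read as an extension from
  -- `U` or from `U'`.
  obtain ⟨L, hL⟩ : ∃ L : Submodule k U → Submodule k U' → Submodule k V,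
      ∀ A B, extend i (extend j Q B) A = L A B := ⟨_, fun _ _ => rfl⟩
  have hL' : ∀ A B, extend j (extend i Q A) B = L A B := fun A B => by rw [extend_comm, hL]
  have hSL : ∀ A B, (L A B).map (x.toGl.1 : V →ₗ[k] V) = L (A.map (S₁.1 : U →ₗ[k] U)) B := by
    intro A B
    rw [← hL, ← hL]
    refine map_extend i _ _ _ hSi (fun v hv => ?_) A
    rw [extend, Submodule.mem_sup] at hv
    obtain ⟨_, ⟨w, -, rfl⟩, q, hq, rfl⟩ := hv
    rw [map_add]
    exact congrArg₂ (· + ·) (hSj w) (hSQ q hq)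
  have hTL : ∀ A B, (L A B).map (y.toGl.1 : V →ₗ[k] V) = L A (B.map (T₂.1 : U' →ₗ[k] U')) := by
    intro A B
    rw [← hL', ← hL']
    refine map_extend j _ _ _ hTj (fun v hv => ?_) B
    rw [extend, Submodule.mem_sup] at hv
    obtain ⟨_, ⟨w, -, rfl⟩, q, hq, rfl⟩ := hv
    rw [map_add]
    exact congrArg₂ (· + ·) (hTi w) (hTQ q hq)
  have hmono : ∀ {A A' B B'}, A ≤ A' → B ≤ B' → L A B ≤ L A' B' := by
    intro A A' B B' h h'
    rw [← hL, ← hL]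
    exact sup_le_sup (Submodule.map_mono h) (extend_mono j Q h')
  have hcomm : ∀ {A B}, Commensurable A P₁ → Commensurable B P₂ → Commensurable (L A B) P := by
    intro A B h h'
    have h1 := h.extend i (extend j Q B)
    have h2 := h'.extend j (extend i Q P₁)
    rw [hL] at h1 hP
    rw [hL] at h1
    rw [hL', hL'] at h2
    rw [hP]
    exact h1.trans h2
  rw [hL] at hP
  obtain ⟨M₁, hM₁⟩ : ∃ M₁, M₁ = P₁ ⊓ P₁.map (S₁.1 : U →ₗ[k] U) := ⟨_, rfl⟩
  obtain ⟨M₂, hM₂⟩ : ∃ M₂, M₂ = P₂ ⊓ P₂.map (T₂.1 : U' →ₗ[k] U') := ⟨_, rfl⟩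
  have c₁ : Commensurable M₁ P₁ := hM₁ ▸ (Commensurable.refl P₁).inf S₁.2.1
  have c₂ : Commensurable M₂ P₂ := hM₂ ▸ (Commensurable.refl P₂).inf T₂.2.1
  have l₁ : M₁ ≤ P₁ := hM₁ ▸ inf_le_left
  have l₁' : M₁ ≤ P₁.map (S₁.1 : U →ₗ[k] U) := hM₁ ▸ inf_le_right
  have l₂ : M₂ ≤ P₂ := hM₂ ▸ inf_le_left
  have l₂' : M₂ ≤ P₂.map (T₂.1 : U' →ₗ[k] U') := hM₂ ▸ inf_le_right
  -- representatives of generators of the determinant lines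
  obtain ⟨α, hα, hαm, hα0⟩ := exists_lift_ne_zero (Commensurable.refl P₁) c₁
  obtain ⟨β, hβ, hβm, hβ0⟩ := exists_lift_ne_zero (Commensurable.refl P₂) c₂
  obtain ⟨α', hα', hαm', hx⟩ := exists_rel_extend (hI P₂) ((hL _ _).trans hP.symm)
    (A := P₁.map (S₁.1 : U →ₗ[k] U))
    ((congrArg (Submodule.map _) hP).trans ((hSL _ _).trans (hL _ _).symm)) x.iso c₁ l₁ l₁' hαm
  obtain ⟨β', hβ', hβm', hy⟩ := exists_rel_extend (hJ P₁) ((hL' _ _).trans hP.symm)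
    (A := P₂.map (T₂.1 : U' →ₗ[k] U'))
    ((congrArg (Submodule.map _) hP).trans ((hTL _ _).trans (hL' _ _).symm)) y.iso c₂ l₂ l₂' hβm
  rw [hL] at hx
  rw [hL'] at hy
  -- preimages
  obtain ⟨N₁, hN₁⟩ : ∃ N₁, N₁ = M₁.map ((S₁⁻¹).1 : U →ₗ[k] U) := ⟨_, rfl⟩
  obtain ⟨N₂, hN₂⟩ : ∃ N₂, N₂ = M₂.map ((T₂⁻¹).1 : U' →ₗ[k] U') := ⟨_, rfl⟩
  have hNM₁ : N₁.map (S₁.1 : U →ₗ[k] U) = M₁ := by rw [hN₁]; exact GlTilde.map_map_inv _ _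
  have hNM₂ : N₂.map (T₂.1 : U' →ₗ[k] U') = M₂ := by rw [hN₂]; exact GlTilde.map_map_inv _ _
  have d₁ : Commensurable N₁ P₁ := hN₁ ▸ GlTilde.comm_map _ c₁
  have d₂ : Commensurable N₂ P₂ := hN₂ ▸ GlTilde.comm_map _ c₂
  have m₁ : N₁ ≤ P₁ := by
    rw [hN₁]; exact (Submodule.map_mono l₁').trans (GlTilde.map_inv_map _ _).le
  have m₂ : N₂ ≤ P₂ := by
    rw [hN₂]; exact (Submodule.map_mono l₂').trans (GlTilde.map_inv_map _ _).le
  obtain ⟨α'', hα'', hαm''⟩ := exists_wedge_preimage S₁.1 hNM₁ hαm'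
  obtain ⟨β'', hβ'', hβm''⟩ := exists_wedge_preimage T₂.1 hNM₂ hβm'
  have memI : ∀ {M A : Submodule k U} (B : Submodule k U') {a : ExteriorAlgebra k U},
      wedgeMkQ M a ∈ detLine M A →
      wedgeMkQ (L M B) (ExteriorAlgebra.map i a) ∈ detLine (L M B) (L A B) := by
    intro M A B a ha
    have := wedgeMkQ_extend_mem (hI B) ha
    rwa [hL, hL] at this
  have memJ : ∀ (A : Submodule k U) {M B : Submodule k U'} {b : ExteriorAlgebra k U'},
      wedgeMkQ M b ∈ detLine M B →
      wedgeMkQ (L A M) (ExteriorAlgebra.map j b) ∈ detLine (L A M) (L A B) := by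
    intro A M B b hb
    have := wedgeMkQ_extend_mem (hJ A) hb
    rwa [hL', hL'] at this
  have sgn : ∀ {A : Submodule k U} {B : Submodule k U'} {m n : ℕ} {a : ExteriorAlgebra k U}
      {b : ExteriorAlgebra k U'}, a ∈ (A.map (ExteriorAlgebra.ι k)) ^ m →
      b ∈ (B.map (ExteriorAlgebra.ι k)) ^ n →
      ExteriorAlgebra.map i a * ExteriorAlgebra.map j b =
        (-1 : k) ^ (m * n) • (ExteriorAlgebra.map j b * ExteriorAlgebra.map i a) := fun ha hb =>
    pow_mul_pow_comm _ _ _ _ (map_wedge_mem_pow i _ _ ha) (map_wedge_mem_pow j _ _ hb)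
  have fixS : ∀ b, ExteriorAlgebra.map (x.toGl.1 : V →ₗ[k] V) (ExteriorAlgebra.map j b) =
      ExteriorAlgebra.map j b := fun b => by
    rw [wedge_map_map (i := j) _ LinearMap.id hSj, ExteriorAlgebra.map_id]; rfl
  have fixT : ∀ a, ExteriorAlgebra.map (y.toGl.1 : V →ₗ[k] V) (ExteriorAlgebra.map i a) =
      ExteriorAlgebra.map i a := fun b => by
    rw [wedge_map_map (i := i) _ LinearMap.id hTi, ExteriorAlgebra.map_id]; rfl
  -- Refinement multiplies by the auxiliary form on the left. Thus `x` is known on products with the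
  -- `j` factor first and `y` on products with the `i` factor first, and passing between the two
  -- orders is the source of all the signs.
  have x1 := hx.refine (Commensurable.refl P) (hmono le_rfl l₂) (hcomm c₁ c₂) (memJ M₁ hβm)
  have x2 := hx.refine (Commensurable.refl P) (hmono le_rfl m₂) (hcomm c₁ d₂) (memJ M₁ hβm'')
  have y1 := hy.refine (Commensurable.refl P) (hmono l₁ le_rfl) (hcomm c₁ c₂) (memI M₂ hαm)
  have y2 := hy.refine (Commensurable.refl P) (hmono m₁ le_rfl) (hcomm d₁ c₂) (memI M₂ hαm'')
  obtain ⟨a, ha⟩ : ∃ a, a = Module.finrank k (P₁.map M₁.mkQ) := ⟨_, rfl⟩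
  obtain ⟨a', ha'⟩ : ∃ a', a' = Module.finrank k ((P₁.map (S₁.1 : U →ₗ[k] U)).map M₁.mkQ) :=
    ⟨_, rfl⟩
  obtain ⟨b, hb⟩ : ∃ b, b = Module.finrank k (P₂.map M₂.mkQ) := ⟨_, rfl⟩
  obtain ⟨b', hb'⟩ : ∃ b', b' = Module.finrank k ((P₂.map (T₂.1 : U' →ₗ[k] U')).map M₂.mkQ) :=
    ⟨_, rfl⟩
  rw [← ha] at hα
  rw [← ha'] at hα'
  rw [← hb] at hβ
  rw [← hb'] at hβ'
  have sq : ∀ n : ℕ, (-1 : k) ^ n * (-1 : k) ^ n = 1 := fun n => by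
    rw [← mul_pow, neg_one_mul, neg_neg, one_pow]
  -- the two products
  have e1 := GlTilde.mul_rel_lift x y (M := L N₁ M₂) (N := L M₁ M₂)
    (by rw [hSL, hNM₁]) (a := ExteriorAlgebra.map i α * ExteriorAlgebra.map j β)
    (b := (-1 : k) ^ (a * b + a' * b) •
      (ExteriorAlgebra.map i α'' * ExteriorAlgebra.map j β))
    (c := (-1 : k) ^ (a * b + a' * b) •
      (ExteriorAlgebra.map i α'' * ExteriorAlgebra.map j β'))
    (by
      rw [map_smul, map_mul _ (ExteriorAlgebra.map i α''), fixS, wedge_map_map _ _ hSi, hα'',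
        sgn hα hβ, sgn hα' hβ, smul_smul, pow_add, mul_assoc, sq, mul_one, map_smul, map_smul]
      exact x1.smul_both _)
    (by rw [map_smul, map_smul]; exact y2.smul_both _)
  have e2 := GlTilde.mul_rel_lift y x (M := L M₁ N₂) (N := L M₁ M₂)
    (by rw [hTL, hNM₂]) (a := ExteriorAlgebra.map i α * ExteriorAlgebra.map j β)
    (b := (-1 : k) ^ (a * b') • (ExteriorAlgebra.map j β'' * ExteriorAlgebra.map i α))
    (c := (-1 : k) ^ (a * b') • (ExteriorAlgebra.map j β'' * ExteriorAlgebra.map i α'))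
    (by
      rw [map_smul, map_mul _ (ExteriorAlgebra.map j β''), fixT, wedge_map_map _ _ hTj, hβ'',
        ← sgn hα hβ']
      exact y1)
    (by rw [map_smul, map_smul]; exact x2.smul_both _)
  rw [map_smul, map_mul _ (ExteriorAlgebra.map i α''), fixS, wedge_map_map _ _ hSi, hα'',
    sgn hα' hβ', smul_smul] at e1
  rw [map_smul, map_mul _ (ExteriorAlgebra.map j β''), fixT, wedge_map_map _ _ hTj, hβ''] at e2
  -- The chain `L M₁ M₂ ≤ L P₁ M₂ ≤ L P₁ P₂` exhibits the form as a product of generators of two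
  -- successive determinant lines.
  have hne : wedgeMkQ (L M₁ M₂) (ExteriorAlgebra.map i α * ExteriorAlgebra.map j β) ≠ 0 := by
    have h0 := wedgeMkQ_extend_ne_zero (hI M₂) hα0
    have h0' := wedgeMkQ_extend_ne_zero (hJ P₁) hβ0
    rw [hL] at h0
    rw [hL'] at h0'
    exact wedgeMkQ_mul_ne_zero (hmono l₁ le_rfl) (hmono le_rfl l₂)
      (hcomm (Commensurable.refl _) (Commensurable.refl _)) (hcomm c₁ c₂) (memI M₂ hαm) h0
      (memJ P₁ hβm) h0'
  -- Both products send the test form to a multiple of `j(β') * i(α')`: the sign exponent is `ab +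
  -- a'b + a'b'` for `x * y` and `ab'` for `y * x`. Modulo `2` they differ by `(a - a')(b - b')`,
  -- the product of the winding numbers.
  refine scalarCommutator_eq_of_rel hST rfl rfl _ hne ?_ e2
  convert e1 using 1
  rw [map_smul, map_smul, smul_smul]
  congr 1
  rw [windingNumber_eq, windingNumber_eq, ← hM₁, ← hM₂, ← ha, ← ha', ← hb, ← hb']
  exact neg_one_zpow_mul_neg_one_pow k a a' b b'

end Disjoint

universe w

/-! ### Spaces of families and their diagonal automorphisms -/

section Coordinates
variable {k : Type u} [Field k] {V : Type v} [AddCommGroup V] [Module k V] {ι : Type w}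
  {K : ι → Type v} [∀ x, AddCommGroup (K x)] [∀ x, Module k (K x)]

/-- The structure of a space of families: `V` embeds in `∏ₓ Kₓ`, contains `⨁ₓ Kₓ`, and is stable
under replacing by `0` the coordinates outside any set of indices. -/
structure Coordinates (k : Type u) [Field k] (V : Type v) [AddCommGroup V] [Module k V]
    {ι : Type w} (K : ι → Type v) [∀ x, AddCommGroup (K x)] [∀ x, Module k (K x)] where
  ev : ∀ x, V →ₗ[k] K x
  single : ∀ x, K x →ₗ[k] V
  cut : Set ι → V →ₗ[k] V
  ext : ∀ {v w}, (∀ x, ev x v = ev x w) → v = w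
  ev_single_same : ∀ x u, ev x (single x u) = u
  ev_single_ne : ∀ {x y} (_ : y ≠ x) u, ev y (single x u) = 0
  ev_cut_mem : ∀ {Z x} (_ : x ∈ Z) v, ev x (cut Z v) = ev x v
  ev_cut_notMem : ∀ {Z x} (_ : x ∉ Z) v, ev x (cut Z v) = 0

open Classical in
/-- The family which agrees with `f` on `Z` and is `1` outside `Z`. -/
noncomputable def cutOff {G : ι → Type*} [∀ x, One (G x)] (Z : Set ι) (f : ∀ x, G x) :
    ∀ x, G x := fun x => if x ∈ Z then f x else 1

lemma cutOff_mem {G : ι → Type*} [∀ x, One (G x)] {Z : Set ι} {f : ∀ x, G x} {x : ι}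
    (h : x ∈ Z) : cutOff Z f x = f x := if_pos h

lemma cutOff_notMem {G : ι → Type*} [∀ x, One (G x)] {Z : Set ι} {f : ∀ x, G x} {x : ι}
    (h : x ∉ Z) : cutOff Z f x = 1 := if_neg h

lemma cutOff_univ {G : ι → Type*} [∀ x, One (G x)] (f : ∀ x, G x) : cutOff Set.univ f = f :=
  funext fun x => cutOff_mem (Set.mem_univ x)

namespace Coordinates
variable (C : Coordinates k V K)

/-- The families with coordinates in the `A x`. -/
def integral (A : ∀ x, Submodule k (K x)) : Submodule k V := ⨅ x, (A x).comap (C.ev x)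

variable {A : ∀ x, Submodule k (K x)}

lemma mem_integral {v : V} : v ∈ C.integral A ↔ ∀ x, C.ev x v ∈ A x := by
  simp [integral]

/-- `S` acts on the coordinate `x` by `Sx x`. -/
def IsDiag (S : V ≃ₗ[k] V) (Sx : ∀ x, K x ≃ₗ[k] K x) : Prop :=
  ∀ v x, C.ev x (S v) = Sx x (C.ev x v)

variable {C} {S T : V ≃ₗ[k] V} {Sx Tx : ∀ x, K x ≃ₗ[k] K x}

lemma IsDiag.inv (h : C.IsDiag S Sx) : C.IsDiag S⁻¹ (fun x => (Sx x)⁻¹) := by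
  intro v x
  apply (Sx x).injective
  rw [← h]
  exact (congrArg (C.ev x) (S.apply_symm_apply v)).trans ((Sx x).apply_symm_apply _).symm

lemma IsDiag.mul (h : C.IsDiag S Sx) (h' : C.IsDiag T Tx) :
    C.IsDiag (S * T) (fun x => Sx x * Tx x) := by
  intro v x
  exact (h (T v) x).trans (congrArg (Sx x) (h' v x))

lemma IsDiag.eq (h : C.IsDiag S Sx) (h' : C.IsDiag T Sx) : S = T :=
  LinearEquiv.ext fun v => C.ext fun x => (h v x).trans (h' v x).symm

lemma IsDiag.apply_single (h : C.IsDiag S Sx) (x : ι) (u : K x) :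
    S (C.single x u) = C.single x (Sx x u) := by
  refine C.ext fun y => ?_
  rw [h]
  rcases eq_or_ne y x with rfl | hy
  · rw [C.ev_single_same, C.ev_single_same]
  · rw [C.ev_single_ne hy, C.ev_single_ne hy, map_zero]

lemma IsDiag.map_integral (h : C.IsDiag S Sx) (A : ∀ x, Submodule k (K x)) :
    (C.integral A).map (S : V →ₗ[k] V) =
      C.integral fun x => (A x).map (Sx x : K x →ₗ[k] K x) := by
  ext v
  rw [mem_integral]
  constructor
  · rintro ⟨w, hw, rfl⟩ x
    exact ⟨C.ev x w, C.mem_integral.1 hw x, (h w x).symm⟩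
  · intro hv
    refine ⟨S⁻¹ v, C.mem_integral.2 fun x => ?_, S.apply_symm_apply v⟩
    obtain ⟨u, hu, e⟩ := hv x
    rw [h.inv, ← e]
    have e' : (Sx x)⁻¹ ((Sx x) u) = u := (Sx x).symm_apply_apply u
    exact e'.symm ▸ hu

/-- Evaluating the relation on a family concentrated at `x` isolates the local relation. -/
lemma IsDiag.commute_apply (h : C.IsDiag S Sx) (h' : C.IsDiag T Tx) (hST : S * T = T * S) (x : ι) :
    Sx x * Tx x = Tx x * Sx x := by
  ext u
  have e := congrArg (C.ev x) (LinearEquiv.congr_fun hST (C.single x u))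
  rw [h.mul h', h'.mul h, C.ev_single_same] at e
  exact e

/-- Each bad index supplies a vector of `S(A⁺)` whose only coordinate outside the `A x` is at that
index. These vectors are independent modulo `A⁺`, and `S(A⁺)` is finite dimensional modulo `A⁺`. -/
lemma finite_not_map_le (h : C.IsDiag S Sx)
    (hS : Commensurable ((C.integral A).map (S : V →ₗ[k] V)) (C.integral A)) :
    {x | ¬ (A x).map (Sx x : K x →ₗ[k] K x) ≤ A x}.Finite := by
  obtain ⟨Z, hZ⟩ : ∃ Z, Z = {x | ¬ (A x).map (Sx x : K x →ₗ[k] K x) ≤ A x} := ⟨_, rfl⟩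
  rw [← hZ]
  have hex : ∀ x : Z, ∃ u ∈ A x, Sx x u ∉ A x := by
    rintro ⟨x, hx⟩
    rw [hZ, Set.mem_ofPred_eq, SetLike.not_le_iff_exists] at hx
    obtain ⟨_, ⟨u, hu, rfl⟩, hu'⟩ := hx
    exact ⟨u, hu, hu'⟩
  choose u hu hu' using hex
  have hfin := (commensurable_iff.1 hS).1
  have hmem : ∀ x : Z, (C.integral A).mkQ (S (C.single x (u x))) ∈
      ((C.integral A).map (S : V →ₗ[k] V)).map (C.integral A).mkQ := by
    intro x
    refine ⟨_, ⟨_, C.mem_integral.2 fun y => ?_, rfl⟩, rfl⟩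
    rcases eq_or_ne y x with rfl | hy
    · rw [C.ev_single_same]; exact hu x
    · rw [C.ev_single_ne hy]; exact zero_mem _
  have hli : LinearIndependent k (fun x : Z =>
      (⟨_, hmem x⟩ : ((C.integral A).map (S : V →ₗ[k] V)).map (C.integral A).mkQ)) := by
    refine LinearIndependent.of_comp (Submodule.subtype _) ?_
    rw [linearIndependent_iff']
    intro s c hc x hx
    have hc' : (C.integral A).mkQ (∑ y ∈ s, c y • S (C.single y (u y))) = 0 := by
      rw [map_sum, ← hc]
      exact Finset.sum_congr rfl fun y _ => map_smul _ _ _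
    rw [← LinearMap.mem_ker, Submodule.ker_mkQ, mem_integral] at hc'
    -- Looking at the coordinate `x` leaves one term of the relation; a nonzero coefficient would
    -- force `Sx x (u x)` into `A x`.
    have h1 := hc' x
    rw [map_sum, Finset.sum_eq_single_of_mem x hx] at h1
    · rw [map_smul, h, C.ev_single_same] at h1
      by_contra h0
      exact hu' x ((Submodule.smul_mem_iff _ h0).1 h1)
    · intro y _ hy
      rw [map_smul, h, C.ev_single_ne (fun e => hy (Subtype.ext e.symm)), map_zero, smul_zero]
  have := hli.finite
  exact Set.toFinite Z

/-- The previous bound, applied to `S` and to `S⁻¹`, gives both inclusions at all but finitely many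
indices. -/
lemma finite_map_ne (S : Gl (C.integral A)) (Sx : ∀ x, Gl (A x))
    (h : C.IsDiag S.1 fun x => (Sx x).1) :
    {x | (A x).map ((Sx x).1 : K x →ₗ[k] K x) ≠ A x}.Finite := by
  refine ((finite_not_map_le h S.2.1).union (finite_not_map_le h.inv S.2.2)).subset ?_
  intro x hx
  rw [Set.mem_union, Set.mem_ofPred_eq, Set.mem_ofPred_eq]
  by_contra! hc
  refine hx (le_antisymm hc.1 ?_)
  have := Submodule.map_mono (f := ((Sx x).1 : K x →ₗ[k] K x)) hc.2
  exact (GlTilde.map_map_inv (Sx x) (A x)).symm.le.trans this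

lemma cut_add_cut_compl (Z : Set ι) (v : V) : C.cut Z v + C.cut Zᶜ v = v := by
  refine C.ext fun x => ?_
  rw [map_add]
  by_cases hx : x ∈ Z
  · rw [C.ev_cut_mem hx, C.ev_cut_notMem (Set.notMem_compl_iff.2 hx), add_zero]
  · rw [C.ev_cut_notMem hx, C.ev_cut_mem (Set.mem_compl hx), zero_add]

lemma exists_part_equiv (h : C.IsDiag S Sx) (Z : Set ι) :
    ∃ R : V ≃ₗ[k] V, C.IsDiag R (cutOff Z Sx) := by
  have key : ∀ {S : V ≃ₗ[k] V} {Sx : ∀ x, K x ≃ₗ[k] K x} (_ : C.IsDiag S Sx) (v : V) (x : ι),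
      C.ev x (S (C.cut Z v) + C.cut Zᶜ v) = cutOff Z Sx x (C.ev x v) := by
    intro S Sx h v x
    rw [map_add, h]
    by_cases hx : x ∈ Z
    · rw [C.ev_cut_mem hx, C.ev_cut_notMem (Set.notMem_compl_iff.2 hx), add_zero,
        cutOff_mem hx]
    · rw [C.ev_cut_notMem hx, C.ev_cut_mem (Set.mem_compl hx), map_zero, zero_add,
        cutOff_notMem hx]
      rfl
  -- Apply `S` to the part in `Z` and keep the rest; the inverse does the same with `S⁻¹`.
  refine ⟨LinearEquiv.ofLinearMap ((S : V →ₗ[k] V) ∘ₗ C.cut Z + C.cut Zᶜ)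
    (((S⁻¹ : V ≃ₗ[k] V) : V →ₗ[k] V) ∘ₗ C.cut Z + C.cut Zᶜ) ?_ ?_, key h⟩
  · refine LinearMap.ext fun v => C.ext fun x => ?_
    refine (key h _ x).trans ((congrArg _ (key h.inv v x)).trans ?_)
    by_cases hx : x ∈ Z
    · rw [cutOff_mem hx, cutOff_mem hx]
      exact (Sx x).apply_symm_apply _
    · rw [cutOff_notMem hx, cutOff_notMem hx]
      rfl
  · refine LinearMap.ext fun v => C.ext fun x => ?_
    refine (key h.inv _ x).trans ((congrArg _ (key h v x)).trans ?_)
    by_cases hx : x ∈ Z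
    · rw [cutOff_mem hx, cutOff_mem hx]
      exact (Sx x).symm_apply_apply _
    · rw [cutOff_notMem hx, cutOff_notMem hx]
      rfl

/-- The automorphism which acts as `S` on the coordinates in `Z` and trivially on the others. -/
lemma exists_part (S : Gl (C.integral A)) (Sx : ∀ x, Gl (A x))
    (h : C.IsDiag S.1 fun x => (Sx x).1) (Z : Set ι) :
    ∃ R : Gl (C.integral A), C.IsDiag R.1 fun x => (cutOff Z Sx x).1 := by
  have hpw : ∀ (Tx : ∀ x, Gl (A x)), (fun x => (cutOff Z Tx x).1) =
      cutOff Z (fun x => (Tx x).1) := by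
    intro Tx
    funext x
    by_cases hx : x ∈ Z
    · rw [cutOff_mem hx, cutOff_mem hx]
    · rw [cutOff_notMem hx, cutOff_notMem hx]
      rfl
  obtain ⟨R, hR⟩ := exists_part_equiv h Z
  obtain ⟨R', hR'⟩ := exists_part_equiv h.inv Z
  have hR'' : R' = R⁻¹ := by
    refine hR'.eq ?_
    convert hR.inv using 2 with x
    by_cases hx : x ∈ Z
    · rw [cutOff_mem hx, cutOff_mem hx]
    · rw [cutOff_notMem hx, cutOff_notMem hx]
      exact inv_one.symm
  -- If `S` moves `A⁺` into `A⁺ + F`, then its part in `Z` moves `A⁺` into `A⁺ + cut Z F`: write `S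
  -- v = p + f` and keep only the coordinates of `p` and `f` in `Z`.
  have hle : ∀ {S R : V ≃ₗ[k] V} {Sx : ∀ x, K x ≃ₗ[k] K x}, C.IsDiag S Sx →
      C.IsDiag R (cutOff Z Sx) →
      Commensurable ((C.integral A).map (S : V →ₗ[k] V)) (C.integral A) →
      ∃ F : Submodule k V, FiniteDimensional k F ∧
        (C.integral A).map (R : V →ₗ[k] V) ≤ C.integral A ⊔ F := by
    intro S R Sx hS hR hc
    obtain ⟨F, hF, hle⟩ := (finite_map_iff _ _).1 (commensurable_iff.1 hc).1
    refine ⟨F.map (C.cut Z), inferInstance, ?_⟩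
    rintro _ ⟨v, hv, rfl⟩
    have hv' := C.mem_integral.1 hv
    obtain ⟨p, hp, f, hf, e⟩ := Submodule.mem_sup.1 (hle ⟨v, hv, rfl⟩)
    have hp' := C.mem_integral.1 hp
    have e1 : R v = (C.cut Z p + C.cut Zᶜ v) + C.cut Z f := by
      refine C.ext fun x => ?_
      rw [hR, map_add, map_add]
      by_cases hx : x ∈ Z
      · rw [C.ev_cut_mem hx, C.ev_cut_mem hx, C.ev_cut_notMem (Set.notMem_compl_iff.2 hx), add_zero,
          cutOff_mem hx, ← map_add, e]
        exact (hS v x).symm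
      · rw [C.ev_cut_notMem hx, C.ev_cut_notMem hx, C.ev_cut_mem (Set.mem_compl hx), zero_add,
          add_zero, cutOff_notMem hx]
        rfl
    refine Submodule.mem_sup.2 ⟨_, C.mem_integral.2 fun x => ?_, _, ⟨f, hf, rfl⟩, e1.symm⟩
    rw [map_add]
    refine add_mem ?_ ?_
    · by_cases hx : x ∈ Z
      · rw [C.ev_cut_mem hx]; exact hp' x
      · rw [C.ev_cut_notMem hx]; exact zero_mem _
    · by_cases hx : x ∈ Zᶜ
      · rw [C.ev_cut_mem hx]; exact hv' x
      · rw [C.ev_cut_notMem hx]; exact zero_mem _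
  -- The bound for `R⁻¹`, transported by `R`, is the missing half of commensurability for `R`.
  have hGl : ∀ {R : V ≃ₗ[k] V} {F F' : Submodule k V}, FiniteDimensional k F →
      FiniteDimensional k F' → (C.integral A).map (R : V →ₗ[k] V) ≤ C.integral A ⊔ F →
      (C.integral A).map ((R⁻¹ : V ≃ₗ[k] V) : V →ₗ[k] V) ≤ C.integral A ⊔ F' →
      Commensurable ((C.integral A).map (R : V →ₗ[k] V)) (C.integral A) := by
    intro R F F' _ _ h h'
    refine commensurable_of_le (F' := F'.map (R : V →ₗ[k] V)) h ?_
    rw [← Submodule.map_sup]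
    intro v hv
    exact ⟨R⁻¹ v, h' ⟨v, hv, rfl⟩, R.apply_symm_apply v⟩
  obtain ⟨F, hF, h1⟩ := hle h hR S.2.1
  obtain ⟨F', hF', h2⟩ := hle h.inv hR' S.2.2
  rw [hR''] at h2
  refine ⟨⟨R, hGl hF hF' h1 h2, hGl hF' hF h2 (by rwa [inv_inv])⟩, ?_⟩
  rw [hpw]
  exact hR

lemma gl_ext {S T : Gl (C.integral A)} {Sx : ∀ x, K x ≃ₗ[k] K x} (h : C.IsDiag S.1 Sx)
    (h' : C.IsDiag T.1 Sx) : S = T := Subtype.ext (h.eq h')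

/-- Outside `F` the two families coincide and contribute nothing, so the quotient is the finite
direct sum of the local quotients over `F`. -/
lemma finrank_map_integral (M B : ∀ x, Submodule k (K x)) (F : Finset ι)
    (h : ∀ x ∉ F, B x = M x) (hfin : ∀ x, FiniteDimensional k ((B x).map (M x).mkQ)) :
    Module.finrank k ((C.integral B).map (C.integral M).mkQ) =
      ∑ x ∈ F, Module.finrank k ((B x).map (M x).mkQ) := by
  let ψ : C.integral B →ₗ[k] ∀ x : F, (B x).map (M x).mkQ :=
    LinearMap.pi fun x => LinearMap.codRestrict _
      (((M x).mkQ ∘ₗ C.ev x) ∘ₗ (C.integral B).subtype)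
      fun v => ⟨_, C.mem_integral.1 v.2 x, rfl⟩
  have hψ : ∀ (v : C.integral B) (x : F), (ψ v x : K x ⧸ M x) = (M x).mkQ (C.ev x v) := fun _ _ => rfl
  have hker : LinearMap.ker ψ = (C.integral M).submoduleOf (C.integral B) := by
    ext v
    rw [LinearMap.mem_ker, Submodule.submoduleOf, Submodule.mem_comap, mem_integral]
    have hx : ∀ x : F, ψ v x = 0 ↔ C.ev x v ∈ M x := by
      intro x
      rw [← Submodule.coe_eq_zero, hψ, ← LinearMap.mem_ker, Submodule.ker_mkQ]
    constructor
    · intro hv x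
      by_cases hxF : x ∈ F
      · exact (hx ⟨x, hxF⟩).1 (congrFun hv _)
      · rw [← h x hxF]; exact C.mem_integral.1 v.2 x
    · intro hv
      funext x
      exact (hx x).2 (hv x)
  have hsurj : Function.Surjective ψ := by
    intro f
    choose b hb hbf using fun x => (f x).2
    refine ⟨⟨∑ x : F, C.single x (b x), C.mem_integral.2 fun y => ?_⟩, ?_⟩
    · rw [map_sum]
      refine sum_mem fun x _ => ?_
      rcases eq_or_ne y x with rfl | hy
      · rw [C.ev_single_same]; exact hb x
      · rw [C.ev_single_ne hy]; exact zero_mem _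
    · funext x
      refine Subtype.ext ?_
      rw [hψ, map_sum, Finset.sum_eq_single_of_mem x (Finset.mem_univ x), C.ev_single_same, hbf]
      intro y _ hy
      rw [C.ev_single_ne (fun e => hy (Subtype.ext e.symm))]
  rw [← finrank_quot_submoduleOf, ← hker, (ψ.quotKerEquivOfSurjective hsurj).finrank_eq,
    Module.finrank_pi_fintype, Finset.sum_coe_sort F
      (fun x => Module.finrank k ((B x).map (M x).mkQ))]

/-- The winding number is the sum of the local winding numbers. -/
lemma windingNumber_eq_sum (S : Gl (C.integral A)) (Sx : ∀ x, Gl (A x))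
    (h : C.IsDiag S.1 fun x => (Sx x).1) (F : Finset ι)
    (hF : ∀ x ∉ F, (A x).map ((Sx x).1 : K x →ₗ[k] K x) = A x) :
    windingNumber S = ∑ x ∈ F, windingNumber (Sx x) := by
  have hinf : C.integral A ⊓ (C.integral A).map (S.1 : V →ₗ[k] V) =
      C.integral fun x => A x ⊓ (A x).map ((Sx x).1 : K x →ₗ[k] K x) := by
    rw [h.map_integral]
    ext v
    simp only [Submodule.mem_inf, mem_integral, forall_and]
  have hc : ∀ x, Commensurable (A x ⊓ (A x).map ((Sx x).1 : K x →ₗ[k] K x)) (A x) := fun x =>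
    (Commensurable.refl _).inf (Sx x).2.1
  simp only [windingNumber_eq]
  rw [hinf, Finset.sum_sub_distrib, finrank_map_integral _ _ F
    (fun x hx => by rw [hF x hx, inf_idem])
    (fun x => DetIso.finite_of_level (Commensurable.refl _) (hc x)), h.map_integral,
    finrank_map_integral _ _ F (fun x hx => by rw [hF x hx, inf_idem])
    (fun x => DetIso.finite_of_level (Sx x).2.1 (hc x)), Nat.cast_sum, Nat.cast_sum]

/-- If `S` preserves the integral elements and is supported where `T` does too, then
`⟨S, T⟩ = 1`. -/
lemma scalarCommutator_eq_one_of_support {S T : Gl (C.integral A)} (hST : Commute S T)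
    {Sx Tx : ∀ x, Gl (A x)} (hS : C.IsDiag S.1 fun x => (Sx x).1)
    (hT : C.IsDiag T.1 fun x => (Tx x).1) (F : Set ι)
    (hSF : ∀ x ∈ F, Sx x = 1)
    (hSA : ∀ x, (A x).map ((Sx x).1 : K x →ₗ[k] K x) = A x)
    (hTA : ∀ x ∉ F, (A x).map ((Tx x).1 : K x →ₗ[k] K x) = A x) :
    scalarCommutator S T = 1 := by
  -- Split a family along `F`. The part in `F` is fixed by `S`; the part outside lies in `A⁺` and in
  -- `T(A⁺)`, because there `T` preserves the `A x`.
  have hle : ∀ B : ∀ x, Submodule k (K x), (∀ x ∉ F, B x = A x) →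
      C.integral B ≤ LinearMap.range (C.cut F) ⊔
        (C.integral A ⊓ (C.integral A).map (T.1 : V →ₗ[k] V)) := by
    intro B hB v hv
    rw [mem_integral] at hv
    have hcut : ∀ B' : ∀ x, Submodule k (K x), (∀ x ∉ F, B' x = A x) →
        C.cut Fᶜ v ∈ C.integral B' := by
      intro B' hB'
      rw [mem_integral]
      intro x
      by_cases hx : x ∈ Fᶜ
      · rw [C.ev_cut_mem hx, hB' x hx, ← hB x hx]
        exact hv x
      · rw [C.ev_cut_notMem hx]; exact zero_mem _
    rw [← C.cut_add_cut_compl F v]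
    refine add_mem (Submodule.mem_sup_left ⟨v, rfl⟩) (Submodule.mem_sup_right ⟨?_, ?_⟩)
    · exact hcut A fun _ _ => rfl
    · rw [SetLike.mem_coe, hT.map_integral]
      exact hcut _ hTA
  refine scalarCommutator_eq_one hST ?_ (LinearMap.range (C.cut F)) ?_ (hle A fun _ _ => rfl) ?_
  · rw [hS.map_integral]
    congr 1
    funext x
    exact hSA x
  · rintro _ ⟨v, rfl⟩
    refine C.ext fun x => ?_
    rw [hS]
    change (Sx x).1 _ = _
    by_cases hx : x ∈ F
    · rw [hSF x hx]; rfl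
    · rw [C.ev_cut_notMem hx, map_zero]
  · have := hle _ hTA
    rwa [← hT.map_integral] at this

/-! ### Splitting off single coordinates -/

lemma isSplit_single (x : ι) {Q : Submodule k V} (hQ : ∀ v ∈ Q, C.ev x v = 0) :
    IsSplit (C.single x) (C.ev x) Q := ⟨C.ev_single_same x, hQ⟩

lemma single_mem_integral {x : ι} {u : K x} (hu : u ∈ A x) : C.single x u ∈ C.integral A := by
  refine C.mem_integral.2 fun y => ?_
  rcases eq_or_ne y x with rfl | hy
  · rw [C.ev_single_same]; exact hu
  · rw [C.ev_single_ne hy]; exact zero_mem _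

/-- The elements of `integral A` whose coordinates in `Z` vanish. -/
def vanishing (C : Coordinates k V K) (A : ∀ x, Submodule k (K x)) (Z : Set ι) : Submodule k V :=
  C.integral A ⊓ ⨅ x ∈ Z, LinearMap.ker (C.ev x)

lemma mem_vanishing {Z : Set ι} {v : V} :
    v ∈ C.vanishing A Z ↔ v ∈ C.integral A ∧ ∀ x ∈ Z, C.ev x v = 0 := by
  simp [vanishing]

/-- Peeling one coordinate off the integral families puts them in the form `i(A x) + Q`. One peeling
serves for two parts at the same index, two for parts at distinct indices. -/
lemma extend_vanishing {Z : Set ι} {x : ι} (hx : x ∉ Z) :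
    extend (C.single x) (C.vanishing A (insert x Z)) (A x) = C.vanishing A Z := by
  apply le_antisymm
  · refine sup_le ?_ fun v hv => ?_
    · rintro _ ⟨u, hu, rfl⟩
      exact mem_vanishing.2 ⟨single_mem_integral hu, fun y hy =>
        C.ev_single_ne (ne_of_mem_of_not_mem hy hx) u⟩
    · rw [mem_vanishing] at hv ⊢
      exact ⟨hv.1, fun y hy => hv.2 y (Set.mem_insert_of_mem _ hy)⟩
  · intro v hv
    rw [mem_vanishing] at hv
    have hvx : C.ev x v ∈ A x := C.mem_integral.1 hv.1 x
    refine Submodule.mem_sup.2 ⟨_, ⟨_, hvx, rfl⟩, v - C.single x (C.ev x v), ?_,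
      add_sub_cancel _ _⟩
    refine mem_vanishing.2 ⟨sub_mem hv.1 (single_mem_integral hvx), ?_⟩
    rintro y (rfl | hy)
    · rw [map_sub, C.ev_single_same, sub_self]
    · rw [map_sub, C.ev_single_ne (ne_of_mem_of_not_mem hy hx), hv.2 y hy, sub_zero]

lemma vanishing_empty : C.vanishing A ∅ = C.integral A := by
  ext v; simp [mem_vanishing]

lemma IsDiag.single_part {S : V ≃ₗ[k] V} {Sx : ∀ x, Gl (A x)} {x : ι}
    (h : C.IsDiag S fun y => (cutOff {x} Sx y).1) :
    (∀ u, S (C.single x u) = C.single x ((Sx x).1 u)) ∧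
      ∀ v, C.ev x v = 0 → S v = v := by
  constructor
  · intro u
    rw [h.apply_single, cutOff_mem (Set.mem_singleton x)]
  · intro v hv
    refine C.ext fun y => ?_
    rw [h]
    change (cutOff {x} Sx y).1 _ = _
    rcases eq_or_ne y x with rfl | hy
    · rw [hv, map_zero]
    · rw [cutOff_notMem (Set.notMem_singleton_iff.2 hy)]
      rfl

lemma scalarCommutator_part_same {S T : Gl (C.integral A)} (hST : Commute S T)
    {Sx Tx : ∀ x, Gl (A x)} {x : ι} (hc : Commute (Sx x) (Tx x))
    (hS : C.IsDiag S.1 fun y => (cutOff {x} Sx y).1)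
    (hT : C.IsDiag T.1 fun y => (cutOff {x} Tx y).1) :
    scalarCommutator S T = scalarCommutator (Sx x) (Tx x) := by
  have hQ : ∀ v ∈ C.vanishing A (insert x ∅), C.ev x v = 0 := fun v hv =>
    (mem_vanishing.1 hv).2 x (Set.mem_insert _ _)
  exact scalarCommutator_extend (isSplit_single x hQ)
    ((extend_vanishing (Set.notMem_empty x)).trans vanishing_empty).symm hc hST
    hS.single_part.1 (fun v hv => hS.single_part.2 v (hQ v hv))
    hT.single_part.1 (fun v hv => hT.single_part.2 v (hQ v hv))

/-- Here `Q` consists of the integral families vanishing at both `x` and `y`, on which both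
automorphisms are the identity. -/
lemma scalarCommutator_part_ne {S T : Gl (C.integral A)} (hST : Commute S T)
    {Sx Tx : ∀ x, Gl (A x)} {x y : ι} (hxy : y ≠ x)
    (hS : C.IsDiag S.1 fun z => (cutOff {x} Sx z).1)
    (hT : C.IsDiag T.1 fun z => (cutOff {y} Tx z).1) :
    scalarCommutator S T = (-1) ^ (windingNumber (Sx x) * windingNumber (Tx y)) := by
  have hQ : ∀ v ∈ C.vanishing A (insert y (insert x ∅)), C.ev x v = 0 ∧ C.ev y v = 0 :=
    fun v hv => ⟨(mem_vanishing.1 hv).2 x (by simp), (mem_vanishing.1 hv).2 y (by simp)⟩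
  refine scalarCommutator_disjoint (isSplit_single x fun v hv => (hQ v hv).1)
    (isSplit_single y fun v hv => (hQ v hv).2) (C.ev_single_ne hxy.symm) (C.ev_single_ne hxy)
    ?_ hST hS.single_part.1 (fun u => hS.single_part.2 _ (C.ev_single_ne hxy.symm u))
    (fun v hv => hS.single_part.2 v (hQ v hv).1)
    (fun u => hT.single_part.2 _ (C.ev_single_ne hxy u)) hT.single_part.1
    (fun v hv => hT.single_part.2 v (hQ v hv).2)
  rw [extend_vanishing (by simpa using hxy), extend_vanishing (Set.notMem_empty x),
    vanishing_empty]

/-! ### The product formula -/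

/-- The product formula for the commutator pairing. -/
theorem scalarCommutator_eq_prod {S T : Gl (C.integral A)} {Sx Tx : ∀ x, Gl (A x)}
    (hS : C.IsDiag S.1 fun x => (Sx x).1) (hT : C.IsDiag T.1 fun x => (Tx x).1)
    (hc : ∀ x, Commute (Sx x) (Tx x)) (hw : windingNumber T = 0) (F : Finset ι)
    (hSF : ∀ x ∉ F, (A x).map ((Sx x).1 : K x →ₗ[k] K x) = A x)
    (hTF : ∀ x ∉ F, (A x).map ((Tx x).1 : K x →ₗ[k] K x) = A x) :
    scalarCommutator S T = ∏ x ∈ F, (-1 : kˣ) ^ (windingNumber (Sx x) * windingNumber (Tx x)) *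
      scalarCommutator (Sx x) (Tx x) := by
  classical
  choose cS hcS using exists_part S Sx hS
  choose cT hcT using exists_part T Tx hT
  have hone : ∀ x, (A x).map ((1 : Gl (A x)).1 : K x →ₗ[k] K x) = A x := fun x =>
    Submodule.map_id _
  -- All parts must commute before bimultiplicativity applies. At each coordinate the pair is either
  -- `(Sx x, Tx x)` or contains `1`.
  have hcomm : ∀ Z Z', Commute (cS Z) (cT Z') := by
    intro Z Z'
    refine gl_ext ((hcS Z).mul (hcT Z')) ?_
    have e : ∀ x, Commute (cutOff Z Sx x) (cutOff Z' Tx x) := by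
      intro x
      by_cases h : x ∈ Z
      · by_cases h' : x ∈ Z'
        · rw [cutOff_mem h, cutOff_mem h']; exact hc x
        · rw [cutOff_notMem h']; exact Commute.one_right _
      · rw [cutOff_notMem h]; exact Commute.one_left _
    have := (hcT Z').mul (hcS Z)
    rwa [show (fun x => (cutOff Z' Tx x).1 * (cutOff Z Sx x).1) =
      fun x => (cutOff Z Sx x).1 * (cutOff Z' Tx x).1 from
      funext fun x => congrArg Subtype.val (e x).eq.symm] at this
  have union : ∀ {Ux : ∀ x, Gl (A x)} {c : Set ι → Gl (C.integral A)},
      (∀ Z, C.IsDiag (c Z).1 fun x => (cutOff Z Ux x).1) →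
      ∀ {Z Z'}, Disjoint Z Z' → c (Z ∪ Z') = c Z * c Z' := by
    intro Ux c hcU Z Z' hd
    refine gl_ext (hcU _) ?_
    have e : ∀ x, cutOff (Z ∪ Z') Ux x = cutOff Z Ux x * cutOff Z' Ux x := by
      intro x
      by_cases h : x ∈ Z
      · rw [cutOff_mem (Set.mem_union_left _ h), cutOff_mem h,
          cutOff_notMem (Set.disjoint_left.1 hd h), mul_one]
      · rw [cutOff_notMem h, one_mul]
        by_cases h' : x ∈ Z'
        · rw [cutOff_mem (Set.mem_union_right _ h'), cutOff_mem h']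
        · rw [cutOff_notMem (fun hu => hu.elim h h'), cutOff_notMem h']
    have := (hcU Z).mul (hcU Z')
    rwa [show (fun x => (cutOff Z Ux x).1 * (cutOff Z' Ux x).1) =
      fun x => (cutOff (Z ∪ Z') Ux x).1 from
      funext fun x => congrArg Subtype.val (e x).symm] at this
  have empty : ∀ {Ux : ∀ x, Gl (A x)} {c : Set ι → Gl (C.integral A)},
      (∀ Z, C.IsDiag (c Z).1 fun x => (cutOff Z Ux x).1) → c ∅ = 1 := by
    intro Ux c hcU
    have := union hcU (Set.disjoint_empty ∅)
    rw [Set.union_self] at this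
    exact left_eq_mul.1 this
  have hSuniv : cS Set.univ = S := by
    refine gl_ext (hcS _) ?_
    rw [cutOff_univ]
    exact hS
  have hTuniv : cT Set.univ = T := by
    refine gl_ext (hcT _) ?_
    rw [cutOff_univ]
    exact hT
  have prodS : ∀ (G : Finset ι) Z, scalarCommutator (cS G) (cT Z) =
      ∏ x ∈ G, scalarCommutator (cS {x}) (cT Z) := by
    intro G Z
    induction G using Finset.induction_on with
    | empty => rw [Finset.coe_empty, empty hcS, scalarCommutator_one_left, Finset.prod_empty]
    | insert x G hx ih =>
      rw [Finset.coe_insert, Set.insert_eq, union hcS (by simpa using hx),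
        scalarCommutator_mul_left (hcomm _ _) (hcomm _ _), ih, Finset.prod_insert hx]
  have prodT : ∀ (G : Finset ι) Z, scalarCommutator (cS Z) (cT G) =
      ∏ x ∈ G, scalarCommutator (cS Z) (cT {x}) := by
    intro G Z
    induction G using Finset.induction_on with
    | empty =>
      rw [Finset.coe_empty, empty hcT, scalarCommutator_swap (Commute.one_left _),
        scalarCommutator_one_left, Finset.prod_empty, inv_one]
    | insert x G hx ih =>
      rw [Finset.coe_insert, Set.insert_eq, union hcT (by simpa using hx),
        scalarCommutator_mul_right (hcomm _ _) (hcomm _ _), ih, Finset.prod_insert hx]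
  have offS : scalarCommutator (cS (F : Set ι)ᶜ) (cT Set.univ) = 1 := by
    refine scalarCommutator_eq_one_of_support (hcomm _ _) (hcS _) (hcT _) F ?_ ?_ ?_
    · intro x hx
      exact cutOff_notMem (Set.notMem_compl_iff.2 hx)
    · intro x
      by_cases hx : x ∈ F
      · rw [cutOff_notMem (by simpa using hx)]; exact hone x
      · rw [cutOff_mem (by simpa using hx)]; exact hSF x hx
    · intro x hx
      rw [cutOff_univ]; exact hTF x hx
  -- After a swap of arguments the part of `T` outside `F` plays the role of the lattice-preserving
  -- automorphism.
  have offT : ∀ x ∈ F, scalarCommutator (cS {x}) (cT (F : Set ι)ᶜ) = 1 := by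
    intro y hy
    rw [scalarCommutator_swap (hcomm _ _).symm, inv_eq_one]
    refine scalarCommutator_eq_one_of_support (hcomm _ _).symm (hcT _) (hcS _) F ?_ ?_ ?_
    · intro x hx
      exact cutOff_notMem (Set.notMem_compl_iff.2 hx)
    · intro x
      by_cases hx : x ∈ F
      · rw [cutOff_notMem (by simpa using hx)]; exact hone x
      · rw [cutOff_mem (by simpa using hx)]; exact hTF x hx
    · intro x hx
      have : x ∉ ({y} : Set ι) := fun e => hx (e ▸ hy)
      rw [cutOff_notMem this]; exact hone x
  have hsum := windingNumber_eq_sum T Tx hT F hTF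
  rw [hw] at hsum
  calc scalarCommutator S T = scalarCommutator (cS F * cS (F : Set ι)ᶜ) (cT Set.univ) := by
        rw [← union hcS disjoint_compl_right, Set.union_compl_self, hSuniv, hTuniv]
    _ = ∏ x ∈ F, scalarCommutator (cS {x}) (cT F * cT (F : Set ι)ᶜ) := by
        rw [scalarCommutator_mul_left (hcomm _ _) (hcomm _ _), offS, mul_one, prodS,
          ← union hcT disjoint_compl_right, Set.union_compl_self]
    _ = _ := Finset.prod_congr rfl fun x hx => ?_
  rw [scalarCommutator_mul_right (hcomm _ _) (hcomm _ _), offT x hx, mul_one, prodT,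
    ← Finset.mul_prod_erase F _ hx, scalarCommutator_part_same (hcomm _ _) (hc x) (hcS _) (hcT _),
    mul_comm]
  congr 1
  rw [Finset.prod_congr rfl fun y hy => scalarCommutator_part_ne (hcomm _ _)
    (Finset.ne_of_mem_erase hy) (hcS _) (hcT _)]
  have hpow : ∀ (G : Finset ι) (f : ι → ℤ), ∏ y ∈ G, (-1 : kˣ) ^ f y = (-1) ^ ∑ y ∈ G, f y := by
    intro G f
    induction G using Finset.induction_on with
    | empty => simp
    | insert y G hy ih => rw [Finset.prod_insert hy, Finset.sum_insert hy, zpow_add, ih]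
  rw [hpow, ← Finset.mul_sum]
  -- As `w(T) = 0`, the winding numbers of `T` at the other points sum to `-w_x(T)`. The two
  -- exponents are thus opposite and have the same parity.
  refine neg_one_zpow_eq k ⟨-(windingNumber (Sx x) * windingNumber (Tx x)), ?_⟩
  rw [← Finset.add_sum_erase F _ hx] at hsum
  rw [eq_neg_of_add_eq_zero_right hsum.symm]
  ring

/-- Take for `F` the indices at which `S` or `T` moves `A x`. At every other index the winding
numbers vanish and the local pairing is trivial, so the product over `F` is the full product. -/
theorem finite_and_scalarCommutator_eq_finprod {S T : Gl (C.integral A)} {Sx Tx : ∀ x, Gl (A x)}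
    (hS : C.IsDiag S.1 fun x => (Sx x).1) (hT : C.IsDiag T.1 fun x => (Tx x).1)
    (hST : Commute S T) (hw : windingNumber T = 0) :
    {x | scalarCommutator (Sx x) (Tx x) ≠ 1}.Finite ∧
    {x | windingNumber (Sx x) ≠ 0}.Finite ∧ {x | windingNumber (Tx x) ≠ 0}.Finite ∧
    scalarCommutator S T = ∏ᶠ x, (-1 : kˣ) ^ (windingNumber (Sx x) * windingNumber (Tx x)) *
      scalarCommutator (Sx x) (Tx x) := by
  have hfin := (finite_map_ne S Sx hS).union (finite_map_ne T Tx hT)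
  obtain ⟨F, hF⟩ : ∃ F : Finset ι, F = hfin.toFinset := ⟨_, rfl⟩
  have hnot : ∀ x ∉ F, (A x).map ((Sx x).1 : K x →ₗ[k] K x) = A x ∧
      (A x).map ((Tx x).1 : K x →ₗ[k] K x) = A x := by
    intro x hx
    rw [hF, Set.Finite.mem_toFinset, Set.mem_union, not_or] at hx
    exact ⟨not_not.1 hx.1, not_not.1 hx.2⟩
  have hc : ∀ x, Commute (Sx x) (Tx x) := fun x =>
    Subtype.ext (hS.commute_apply hT (congrArg Subtype.val hST.eq) x)
  have hw0 : ∀ {x} (R : Gl (A x)), (A x).map (R.1 : K x →ₗ[k] K x) = A x →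
      windingNumber R = 0 := by
    intro x R h
    rw [windingNumber_eq, h, sub_self]
  have hc1 : ∀ x ∉ F, scalarCommutator (Sx x) (Tx x) = 1 := by
    intro x hx
    -- When `T` also preserves the lattice, `P` and `T(P)` coincide, so no representatives are
    -- needed and `W = ⊥` suffices.
    refine scalarCommutator_eq_one (hc x) (hnot x hx).1 ⊥ ?_ ?_ ?_
    · intro w hw
      rw [(Submodule.mem_bot k).1 hw, map_zero]
    · rw [(hnot x hx).2, inf_idem, bot_sup_eq]
    · rw [(hnot x hx).2, inf_idem, bot_sup_eq]
  refine ⟨F.finite_toSet.subset fun x hx => ?_, F.finite_toSet.subset fun x hx => ?_,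
    F.finite_toSet.subset fun x hx => ?_, ?_⟩
  · by_contra h
    exact hx (hc1 x h)
  · by_contra h
    exact hx (hw0 _ (hnot x h).1)
  · by_contra h
    exact hx (hw0 _ (hnot x h).2)
  · rw [scalarCommutator_eq_prod hS hT hc hw F (fun x hx => (hnot x hx).1)
      fun x hx => (hnot x hx).2, finprod_eq_prod_of_mulSupport_subset]
    intro x hx
    by_contra h
    refine hx ?_
    change _ * scalarCommutator (Sx x) (Tx x) = 1
    rw [hc1 x h, hw0 _ (hnot x h).1, zero_mul, zpow_zero, mul_one]

end Coordinates
end Coordinates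

/-! ### The adeles as a space of families -/

open Classical in
/-- The adeles as a space of families. -/
noncomputable def ProperCurve.coordinates {k : Type u} [Field k] (X : ProperCurve k) :
    Coordinates k X.Adeles X.LocalField where
  ev x :=
    { toFun := fun a => a x
      map_add' := fun _ _ => rfl
      map_smul' := fun _ _ => rfl }
  single x :=
    { toFun := fun u => RestrictedProduct.single X.localIntegers x u
      map_add' := fun u u' => RestrictedProduct.ext _ _ fun y => by
        rw [RestrictedProduct.add_apply]
        exact congrFun (Pi.single_add x u u') y
      map_smul' := fun c u => RestrictedProduct.ext _ _ fun y =>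
        congrFun (Pi.single_smul x c u) y }
  cut Z :=
    { toFun := fun a => RestrictedProduct.mk (fun x => if x ∈ Z then a x else 0)
        -- Replacing coordinates by `0` keeps them in `A_x` wherever they already were, so the
        -- family is again an adele.
        (a.2.mono fun x hx => by
          split_ifs
          · exact hx
          · exact zero_mem (X.localIntegers x))
      map_add' := fun a b => RestrictedProduct.ext _ _ fun x => by
        by_cases h : x ∈ Z <;> simp [h]
      map_smul' := fun c a => RestrictedProduct.ext _ _ fun x => by
        by_cases h : x ∈ Z <;> simp [h] }
  ext h := RestrictedProduct.ext _ _ h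
  ev_single_same x u := Pi.single_eq_same x u
  ev_single_ne h u := Pi.single_eq_of_ne h u
  ev_cut_mem h v := if_pos h
  ev_cut_notMem h v := if_neg h

lemma ProperCurve.coordinates_integral {k : Type u} [Field k] (X : ProperCurve k) :
    X.coordinates.integral X.localPlus = X.adelesPlus := by
  ext a
  exact X.coordinates.mem_integral.trans Iff.rfl

end DetExt

open DetExt
theorem theoremt {k : Type u} [Field k] [PerfectField k] (X : ProperCurve k)
    (hX : ∀ f : X.scheme.functionField, IsAlgebraic k f → ∃ c : k, algebraMap k _ c = f)
    (S T : Gl X.adelesPlus)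
    (Sx Tx : ∀ x : X.ClosedPoint, Gl (X.localPlus x))
    (hSx : ∀ (a : X.Adeles) (x : X.ClosedPoint), S.1 a x = (Sx x).1 (a x))
    (hTx : ∀ (a : X.Adeles) (x : X.ClosedPoint), T.1 a x = (Tx x).1 (a x))
    (hS : S ∈ Gl0 X.adelesPlus) (hT : T ∈ Gl0 X.adelesPlus) (hST : Commute S T) :
    {x : X.ClosedPoint | scalarCommutator (Sx x) (Tx x) ≠ 1}.Finite ∧
    {x : X.ClosedPoint | windingNumber (Sx x) ≠ 0}.Finite ∧
    {x : X.ClosedPoint | windingNumber (Tx x) ≠ 0}.Finite ∧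
    scalarCommutator S T = ∏ᶠ x : X.ClosedPoint,
      (-1 : kˣ) ^ (windingNumber (Sx x) * windingNumber (Tx x)) * scalarCommutator (Sx x) (Tx x) := by
  -- The types of `S` and `T` depend on the lattice, so they are generalised before it is rewritten.
  revert S T
  rw [← X.coordinates_integral]
  intro S T hSx hTx _ hT hST
  exact Coordinates.finite_and_scalarCommutator_eq_finprod (C := X.coordinates) hSx hTx hST hT
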